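/- **Setting.** Let $n\ge 1$, let $\Omega\subseteq\mathbb R^n$ be a smooth bounded domain (non-empty, open, connected, bounded, with $C^\infty$ boundary), let $T>0$, $\alpha>0$ and $\gamma(r)=\alpha r$. Let $\partial\Omega=\Gamma_0\cup\Gamma_1$ with $\Gamma_0\cap\Gamma_1=\emptyset$, both Borel. Let $\beta:\mathbb R\to 2^{\mathbb R}$ be maximal monotone with $D(\beta)=\mathbb R$ and $0\in\beta(0)$, let $\hat\beta$ be a proper, convex, lower semicontinuous function with $\partial\hat\beta=\beta$, and assume that there are $D_1,D_2>0$ such that $|\beta^0(r)|\le D_1\hat\beta(r)+D_2$ for all $r\in\mathbb R$, where $\beta^0(r)$ is the element of $\beta(r)$ of minimum absolute value. Data are $u_0,v_0\in L^2(\Omega)$ with $v_0=\gamma(u_0)$ a.e. in $\Omega$ and $\hat\beta(u_0)\in L^1(\Omega)$, $g\in L^2(0,T;L^2(\Omega))\cap L^1(0,T;L^\infty(\Omega))$ and $h\in L^2(0,T;L^2(\Gamma_1))$. A solution for these data is a triple $(u,v,\xi)$ with $u\in L^2(0,T;H^1(\Omega))$, $v\in H^1(0,T;H^1(\Omega)')\cap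 L^2(0,T;L^2(\Omega))$, $\xi\in L^2(0,T;L^2(\Gamma_1))$, such that for a.e. $t\in(0,T)$ and all $z\in H^1(\Omega)$ $$\Big\langle\frac{\partial v}{\partial t}(t),z\Big\rangle+\int_\Omega\nabla u(t)\cdot\nabla z\,dx+\int_{\Gamma_1}\xi(t)z\,ds=\int_\Omega g(t)z\,dx+\int_{\Gamma_1}h(t)z\,ds,$$ $v=\gamma(u)$ a.e. in $\Omega\times(0,T)$, $\xi\in\beta(u)$ a.e. in $\Gamma_1\times(0,T)$, and $v(0)=v_0$. On $\Gamma_1$, $u$ and $z$ stand for their traces. **Theorem.** There is a constant $C>0$, depending only on $\alpha$, $\Omega$ and $T$ (the same for all $\Gamma_0,\Gamma_1,\beta,\hat\beta$ and all data), such that any solutions $(u_i,v_i,\xi_i)$ for the data $(u_0^i,v_0^i,g_i,h_i)$, $i=1,2$, satisfy $$\|u_1-u_2\|^2_{L^2(0,T;H^1(\Omega))\cap L^\infty(0,T;L^2(\Omega))}\le C\Big[\|u_0^1-u_0^2\|^2_{L^2(\Omega)}+\|g_1-g_2\|^2_{L^2(0,T;L^2(\Omega))}+\|h_1-h_2\|^2_{L^2(0,T;L^2(\Gamma_1))}\Big],$$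 where the norm on the left is the sum of the norms of $L^2(0,T;H^1(\Omega))$ and $L^\infty(0,T;L^2(\Omega))$. Moreover, for all such data the problem has a unique solution: exactly one triple $(u,v,\xi)$, up to equality almost everywhere. -/

import Mathlib

open MeasureTheory Set Filter Topology
open scoped ENNReal ContDiff

noncomputable section

namespace DoublyNonlinear

/-! ### Domains -/

/-- Euclidean space `ℝⁿ`. -/
abbrev Euc (n : ℕ) : Type := EuclideanSpace ℝ (Fin n)

/-- A smooth bounded domain of `ℝⁿ`: a nonempty, open, connected, bounded set which, near every
boundary point and in a suitable orthonormal frame whose last vector is `e`, is the region strictly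
above the graph of a `C^∞` function of the remaining coordinates.
(`y - ⟪y, e⟫ e` is the orthogonal projection of `y` onto the hyperplane orthogonal to `e`.) -/
structure IsSmoothBoundedDomain {n : ℕ} (Ω : Set (Euc n)) : Prop where
  isOpen : IsOpen Ω
  isConnected : IsConnected Ω
  isBounded : Bornology.IsBounded Ω
  smooth_boundary : ∀ x ∈ frontier Ω, ∃ (e : Euc n) (ψ : Euc n → ℝ),
    ‖e‖ = 1 ∧ ContDiff ℝ ∞ ψ ∧
      ∀ᶠ y in 𝓝 x, (y ∈ Ω ↔ ψ (y - inner ℝ y e • e) < inner ℝ y e)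

/-- `∂Ω` is the disjoint union of the (Borel) sets `Γ₀` and `Γ₁`. -/
structure IsBoundaryPartition {n : ℕ} (Ω Γ₀ Γ₁ : Set (Euc n)) : Prop where
  measurableSet₀ : MeasurableSet Γ₀
  measurableSet₁ : MeasurableSet Γ₁
  union_eq : Γ₀ ∪ Γ₁ = frontier Ω
  inter_eq : Γ₀ ∩ Γ₁ = ∅

/-! ### Lebesgue and Sobolev spaces -/

/-- The real Hilbert space `L²(Ω)`. -/
abbrev L2 {n : ℕ} (Ω : Set (Euc n)) : Type := Lp ℝ 2 (volume.restrict Ω)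

/-- The real Hilbert space `L²(Ω; ℝⁿ)`. -/
abbrev L2vec {n : ℕ} (Ω : Set (Euc n)) : Type := Lp (Euc n) 2 (volume.restrict Ω)

/-- The surface measure on a piece `S` of a hypersurface of `ℝⁿ`: the `(n-1)`-dimensional
Hausdorff measure, normalized so as to agree with Lebesgue measure in flat pieces. -/
def surface {n : ℕ} (S : Set (Euc n)) : Measure (Euc n) :=
  (Measure.euclideanHausdorffMeasure (n - 1)).restrict S

/-- The real Hilbert space `L²(S)` over a piece `S` of a hypersurface, for the surface measure. -/
abbrev L2surf {n : ℕ} (S : Set (Euc n)) : Type := Lp ℝ 2 (surface S)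

/-- `φ` is a test function on the open set `U`: smooth with compact support inside `U`. -/
structure IsTestFunction {F : Type*} [NormedAddCommGroup F] [NormedSpace ℝ F]
    (U : Set F) (φ : F → ℝ) : Prop where
  contDiff : ContDiff ℝ ∞ φ
  hasCompactSupport : HasCompactSupport φ
  tsupport_subset : tsupport φ ⊆ U

/-- `G` is the weak gradient of `u` in `Ω`. -/
def IsWeakGradient {n : ℕ} {Ω : Set (Euc n)} (u : L2 Ω) (G : L2vec Ω) : Prop :=
  ∀ φ : Euc n → ℝ, IsTestFunction Ω φ → ∀ e : Euc n,
    ∫ x in Ω, u x * fderiv ℝ φ x e = -∫ x in Ω, inner ℝ (G x) e * φ x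

lemma integrable_mul_fderiv {n : ℕ} {Ω : Set (Euc n)} (u : L2 Ω) {φ : Euc n → ℝ}
    (hφ : IsTestFunction Ω φ) (e : Euc n) :
    Integrable (fun x => u x * fderiv ℝ φ x e) (volume.restrict Ω) := by
  have hc : Continuous fun x => fderiv ℝ φ x e :=
    (hφ.contDiff.continuous_fderiv (by simp)).clm_apply continuous_const
  have hs : HasCompactSupport fun x => fderiv ℝ φ x e := hφ.hasCompactSupport.fderiv_apply ℝ e
  exact (Lp.memLp u).integrable_mul (q := 2) ((hc.memLp_of_hasCompactSupport hs).restrict Ω)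

lemma integrable_inner_mul {n : ℕ} {Ω : Set (Euc n)} (G : L2vec Ω) {φ : Euc n → ℝ}
    (hφ : IsTestFunction Ω φ) (e : Euc n) :
    Integrable (fun x => inner ℝ (G x) e * φ x) (volume.restrict Ω) := by
  have hG : MemLp (fun x => inner ℝ (G x) e) 2 (volume.restrict Ω) :=
    (Lp.memLp G).inner_const e
  exact hG.integrable_mul (q := 2)
    ((hφ.contDiff.continuous.memLp_of_hasCompactSupport hφ.hasCompactSupport).restrict Ω)

lemma IsWeakGradient.add {n : ℕ} {Ω : Set (Euc n)} {u u' : L2 Ω} {G G' : L2vec Ω}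
    (h : IsWeakGradient u G) (h' : IsWeakGradient u' G') :
    IsWeakGradient (u + u') (G + G') := by
  intro φ hφ e
  have e1 : (fun x => (u + u') x * fderiv ℝ φ x e) =ᵐ[volume.restrict Ω]
      fun x => u x * fderiv ℝ φ x e + u' x * fderiv ℝ φ x e := by
    filter_upwards [Lp.coeFn_add u u'] with x hx
    rw [hx, Pi.add_apply, add_mul]
  have e2 : (fun x => inner ℝ ((G + G') x) e * φ x) =ᵐ[volume.restrict Ω]
      fun x => inner ℝ (G x) e * φ x + inner ℝ (G' x) e * φ x := by
    filter_upwards [Lp.coeFn_add G G'] with x hx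
    rw [hx, Pi.add_apply, inner_add_left, add_mul]
  rw [integral_congr_ae e1, integral_congr_ae e2,
    integral_add (integrable_mul_fderiv u hφ e) (integrable_mul_fderiv u' hφ e),
    integral_add (integrable_inner_mul G hφ e) (integrable_inner_mul G' hφ e),
    h φ hφ e, h' φ hφ e, neg_add]

lemma IsWeakGradient.smul {n : ℕ} {Ω : Set (Euc n)} {u : L2 Ω} {G : L2vec Ω}
    (c : ℝ) (h : IsWeakGradient u G) : IsWeakGradient (c • u) (c • G) := by
  intro φ hφ e
  have e1 : (fun x => (c • u) x * fderiv ℝ φ x e) =ᵐ[volume.restrict Ω]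
      fun x => c * (u x * fderiv ℝ φ x e) := by
    filter_upwards [Lp.coeFn_smul c u] with x hx
    rw [hx, Pi.smul_apply, smul_eq_mul, mul_assoc]
  have e2 : (fun x => inner ℝ ((c • G) x) e * φ x) =ᵐ[volume.restrict Ω]
      fun x => c * (inner ℝ (G x) e * φ x) := by
    filter_upwards [Lp.coeFn_smul c G] with x hx
    rw [hx, Pi.smul_apply, real_inner_smul_left, mul_assoc]
  rw [integral_congr_ae e1, integral_congr_ae e2, integral_const_mul, integral_const_mul,
    h φ hφ e, mul_neg]

lemma IsWeakGradient.zero {n : ℕ} {Ω : Set (Euc n)} :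
    IsWeakGradient (0 : L2 Ω) (0 : L2vec Ω) := by
  have h : IsWeakGradient ((0 : ℝ) • (0 : L2 Ω)) ((0 : ℝ) • (0 : L2vec Ω)) := by
    intro φ hφ e
    have e1 : (fun x => ((0 : ℝ) • (0 : L2 Ω)) x * fderiv ℝ φ x e) =ᵐ[volume.restrict Ω]
        fun _ => 0 := by
      filter_upwards [Lp.coeFn_smul (0 : ℝ) (0 : L2 Ω)] with x hx
      rw [hx, Pi.smul_apply, zero_smul, zero_mul]
    have e2 : (fun x => inner ℝ (((0 : ℝ) • (0 : L2vec Ω)) x) e * φ x) =ᵐ[volume.restrict Ω]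
        fun _ => 0 := by
      filter_upwards [Lp.coeFn_smul (0 : ℝ) (0 : L2vec Ω)] with x hx
      rw [hx, Pi.smul_apply, zero_smul, inner_zero_left, zero_mul]
    rw [integral_congr_ae e1, integral_congr_ae e2]
    simp
  simpa using h

/-- The Sobolev space `H¹(Ω)`: the pairs `(u, ∇u)` of a function of `L²(Ω)` and its weak gradient,
with the inner product `∫ u w + ∫ ∇u · ∇w`. -/
def H1 {n : ℕ} (Ω : Set (Euc n)) : Submodule ℝ (WithLp 2 (L2 Ω × L2vec Ω)) where
  carrier := {p | IsWeakGradient p.fst p.snd}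
  add_mem' h h' := IsWeakGradient.add h h'
  zero_mem' := IsWeakGradient.zero
  smul_mem' c _ h := IsWeakGradient.smul c h

/-- The embedding of `H¹(Ω)` into `L²(Ω)`. -/
def H1.toL2 {n : ℕ} (Ω : Set (Euc n)) : H1 Ω →L[ℝ] L2 Ω :=
  (WithLp.fstL 2 ℝ (L2 Ω) (L2vec Ω)).comp (H1 Ω).subtypeL

/-- The weak gradient of a function of `H¹(Ω)`. -/
def H1.grad {n : ℕ} (Ω : Set (Euc n)) : H1 Ω →L[ℝ] L2vec Ω :=
  (WithLp.sndL 2 ℝ (L2 Ω) (L2vec Ω)).comp (H1 Ω).subtypeL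

/-- The dual space `H¹(Ω)'`. -/
abbrev H1dual {n : ℕ} (Ω : Set (Euc n)) : Type := StrongDual ℝ (H1 Ω)

/-- The embedding of `L²(Ω)` into `H¹(Ω)'`, `f ↦ (z ↦ ∫ f z)`. -/
def L2.toH1dual {n : ℕ} {Ω : Set (Euc n)} (f : L2 Ω) : H1dual Ω :=
  (innerSL ℝ f).comp (H1.toL2 Ω)

/-- `w ∈ L²(∂Ω)` is the trace of `u ∈ H¹(Ω)`: the pair `(u, w)` is a limit, in `H¹(Ω) × L²(∂Ω)`,
of pairs `(φ|_Ω, φ|_∂Ω)` with `φ` of class `C¹` up to the boundary. -/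
def IsTrace {n : ℕ} {Ω : Set (Euc n)} (u : H1 Ω) (w : L2surf (frontier Ω)) : Prop :=
  (u, w) ∈ closure {p : H1 Ω × L2surf (frontier Ω) | ∃ φ : Euc n → ℝ, ContDiff ℝ 1 φ ∧
    H1.toL2 Ω p.1 =ᵐ[volume.restrict Ω] φ ∧ p.2 =ᵐ[surface (frontier Ω)] φ}

open Classical in
/-- The trace on `∂Ω` of a function of `H¹(Ω)`. (In a smooth bounded domain every function of
`H¹(Ω)` has exactly one trace, and the value `0` in the second case is never used.) -/
def trace {n : ℕ} {Ω : Set (Euc n)} (u : H1 Ω) : L2surf (frontier Ω) :=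
  if h : ∃ w, IsTrace u w then h.choose else 0

/-! ### Functions of time -/

/-- Lebesgue measure on the time interval `(0,T)`. -/
def timeMeasure (T : ℝ) : Measure ℝ := volume.restrict (Ioo 0 T)

/-- The Bochner space `L²(0,T;X)`. -/
abbrev L2T (T : ℝ) (X : Type) [NormedAddCommGroup X] : Type := Lp X 2 (timeMeasure T)

/-- `dv ∈ L²(0,T;H¹(Ω)')` is the weak time derivative of `v ∈ L²(0,T;L²(Ω))`, where `L²(Ω)` is
regarded as a subspace of `H¹(Ω)'`; so `v ∈ H¹(0,T;H¹(Ω)')` with `∂v/∂t = dv`. -/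
def IsTimeDerivative {n : ℕ} {Ω : Set (Euc n)} {T : ℝ}
    (v : L2T T (L2 Ω)) (dv : L2T T (H1dual Ω)) : Prop :=
  ∀ φ : ℝ → ℝ, IsTestFunction (Ioo 0 T) φ →
    ∫ t, deriv φ t • L2.toH1dual (v t) ∂timeMeasure T = -∫ t, φ t • dv t ∂timeMeasure T

/-- `v(0) = v₀`, in the sense of the representative of `v` in `C([0,T];H¹(Ω)')`. -/
def HasInitialValue {n : ℕ} {Ω : Set (Euc n)} {T : ℝ} (v : L2T T (L2 Ω)) (v₀ : L2 Ω) : Prop :=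
  ∃ V : ℝ → H1dual Ω, ContinuousOn V (Icc 0 T) ∧
    (∀ᵐ t ∂timeMeasure T, V t = L2.toH1dual (v t)) ∧ V 0 = L2.toH1dual v₀

/-! ### Monotone graphs -/

/-- A maximal monotone graph `β : ℝ → 2^ℝ`. -/
structure IsMaximalMonotone (β : ℝ → Set ℝ) : Prop where
  monotone : ∀ x y, ∀ a ∈ β x, ∀ b ∈ β y, 0 ≤ (a - b) * (x - y)
  maximal : ∀ x a, (∀ y, ∀ b ∈ β y, 0 ≤ (a - b) * (x - y)) → a ∈ β x

/-- The subdifferential of a function `j : ℝ → ℝ` at `r`. -/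
def subdifferential (j : ℝ → ℝ) (r : ℝ) : Set ℝ :=
  {s | ∀ y, j r + s * (y - r) ≤ j y}

/-- The hypotheses on `β` and on its potential `βhat`: `β` is maximal monotone, `D(β) = ℝ`,
`0 ∈ β(0)`, `βhat` is convex and lower semicontinuous with `∂βhat = β`, and the minimum-norm
element `β⁰(r)` of `β(r)` satisfies `|β⁰(r)| ≤ D₁ βhat(r) + D₂`.
(Since `D(β) = ℝ`, a potential of `β` is finite everywhere.) -/
structure IsBoundaryGraph (β : ℝ → Set ℝ) (βhat : ℝ → ℝ) : Prop where
  maximalMonotone : IsMaximalMonotone β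
  domain_eq : ∀ r, (β r).Nonempty
  zero_mem : (0 : ℝ) ∈ β 0
  convex : ConvexOn ℝ univ βhat
  lsc : LowerSemicontinuous βhat
  subdifferential_eq : ∀ r, subdifferential βhat r = β r
  growth : ∃ D₁ > 0, ∃ D₂ > 0, ∀ r, ∀ s ∈ β r, (∀ s' ∈ β r, |s| ≤ |s'|) → |s| ≤ D₁ * βhat r + D₂

/-- The graph of the linear function `r ↦ α r`. -/
def linearGraph (α : ℝ) (r : ℝ) : Set ℝ := {α * r}

/-- The operator `u ↦ 𝒜(u) = {v ∈ L²(Ω) : v(x) ∈ γ(u(x)) for a.e. x ∈ Ω}`. -/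
def graphOperator {n : ℕ} {Ω : Set (Euc n)} (γ : ℝ → Set ℝ) (u : L2 Ω) : Set (L2 Ω) :=
  {v | ∀ᵐ x ∂volume.restrict Ω, v x ∈ γ (u x)}

/-! ### The problem -/

/-- The hypotheses on the data: `v₀ ∈ γ(u₀)` a.e. in `Ω`, `βhat(u₀) ∈ L¹(Ω)` and
`g ∈ L¹(0,T;L^∞(Ω))`. -/
structure IsAdmissible {n : ℕ} {Ω : Set (Euc n)} {T : ℝ} (γ : ℝ → Set ℝ) (βhat : ℝ → ℝ)
    (u₀ v₀ : L2 Ω) (g : L2T T (L2 Ω)) : Prop where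
  initial_mem : v₀ ∈ graphOperator γ u₀
  initial_integrable : Integrable (fun x => βhat (u₀ x)) (volume.restrict Ω)
  source : ∫⁻ t, eLpNorm (g t) ⊤ (volume.restrict Ω) ∂timeMeasure T < ⊤

/-- `(u, v, ξ)`, with `u ∈ L²(0,T;H¹(Ω))`, `v ∈ H¹(0,T;H¹(Ω)') ∩ L²(0,T;L²(Ω))` and
`ξ ∈ L²(0,T;L²(Γ₁))`, solves the variational problem with data `v₀`, `g`, `h`. -/
structure IsSolution {n : ℕ} {Ω Γ₁ : Set (Euc n)} {T : ℝ} (γ β : ℝ → Set ℝ)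
    (v₀ : L2 Ω) (g : L2T T (L2 Ω)) (h : L2T T (L2surf Γ₁))
    (u : L2T T (H1 Ω)) (v : L2T T (L2 Ω)) (ξ : L2T T (L2surf Γ₁)) : Prop where
  equation : ∃ dv : L2T T (H1dual Ω), IsTimeDerivative v dv ∧
    ∀ᵐ t ∂timeMeasure T, ∀ z : H1 Ω,
      dv t z + (∫ x in Ω, inner ℝ (H1.grad Ω (u t) x) (H1.grad Ω z x))
          + (∫ x, ξ t x * trace z x ∂surface Γ₁)
        = (∫ x in Ω, g t x * H1.toL2 Ω z x) + (∫ x, h t x * trace z x ∂surface Γ₁)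
  mem_gamma : ∀ᵐ t ∂timeMeasure T, v t ∈ graphOperator γ (H1.toL2 Ω (u t))
  mem_beta : ∀ᵐ t ∂timeMeasure T, ∀ᵐ x ∂surface Γ₁, ξ t x ∈ β (trace (u t) x)
  initial : HasInitialValue v v₀

/-- The norm of `w` in `L²(0,T;H¹(Ω)) ∩ L^∞(0,T;L²(Ω))`, the sum of the two norms
(with value `∞` when `w ∉ L^∞(0,T;L²(Ω))`). -/
def energyNorm {n : ℕ} {Ω : Set (Euc n)} {T : ℝ} (w : L2T T (H1 Ω)) : ℝ≥0∞ :=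
  ENNReal.ofReal ‖w‖ + eLpNorm (fun t => H1.toL2 Ω (w t)) ⊤ (timeMeasure T)

end DoublyNonlinear

end

open DoublyNonlinear

/-!
The problem is an evolution equation between Hilbert spaces. With `V = H¹(Ω)`, `H = L²(Ω)`, the
embedding `J : V → H`, the gradient `D` and the trace `τ : V → L²(Γ₁)`, the variational identity and
the initial condition say that `α J† J u = α J† u₀ + ∫ (J† g + τ† h - D† D u - τ† ξ)`, once the dual
of `V` is identified with `V` by the Riesz isomorphism (`IsSolution.integrated`,
`isSolution_of_integrated`); moreover `ξ ∈ β(τ u)` almost everywhere.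

**Stability and uniqueness.** The difference of two solutions is tested with itself. The boundary
term has a sign since `β` is monotone, the source terms are bounded by the trace inequality, and
Gronwall's lemma concludes. As `J u` is not differentiable in `H`, the equation is tested in the form
of backward differences in time, for which `gronwall_delay` is the Gronwall lemma; the step then tends
to zero (`energy_bound`). The constant involves only `α`, `T` and the norm of the trace operator on
all of `∂Ω`. Hence `u` and `v = α u` are unique, so `τ† ξ` is determined, and `τ†` is injective because
traces are dense in `L²(Γ₁)` (`IsSmoothBoundedDomain.adjoint_trace_injective`).

**Existence.** The derivative is replaced by a backward difference with step `ε`, and `β` by its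
Yosida approximation with the same parameter `ε`. The resulting delay equation is solved step by step
(`exists_delay_solution`). Its solutions are bounded in `L²(0,T;V)` by the energy estimate
(`exists_bound_solution`). Their boundary terms are bounded in `L²(0,T;L²(Γ₁))` by testing with the
Yosida approximation of `u` itself (`exists_bound_boundary_term`): this is where the growth condition
on `β⁰`, the integrability of the potential of `u₀`, and `g ∈ L¹(0,T;L^∞(Ω))` enter. Weak limits exist
along an ultrafilter. The limit of the nonlinear term is identified by Minty's argument, in which the
energy inequality for the difference of approximate and limit solution replaces strong convergence
(`exists_evolution_solution`).

**Function spaces.** Functions of `H¹(Ω)` are approximated by averages over balls shifted into the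
domain along an interior cone (`IsSmoothBoundedDomain.exists_contDiff_norm_sub_lt`). The trace
inequality follows from integration along short segments pointing inwards from the boundary
(`IsSmoothBoundedDomain.exists_boundary_strip`,
`IsSmoothBoundedDomain.exists_lintegral_frontier_le`). The test functions `b ∘ u`, for monotone
Lipschitz `b`, are admissible by `IsSmoothBoundedDomain.exists_comp`; the scalar Yosida approximations
come from `IsBoundaryGraph.exists_yosida`.
-/

noncomputable section

namespace DoublyNonlinear

open scoped NNReal InnerProductSpace InnerProduct

/-! ### Hilbert space tools and averages -/

section Hilbert

variable {E : Type*} [NormedAddCommGroup E] [InnerProductSpace ℝ E] [CompleteSpace E]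

/-- Bounded sequences of a Hilbert space converge weakly along every ultrafilter. Working along an
ultrafilter avoids separability and the extraction of subsequences. -/
theorem exists_weak_limit (l : Ultrafilter ℕ) (x : ℕ → E) (C : ℝ) (hx : ∀ k, ‖x k‖ ≤ C) :
    ∃ p : E, ∀ z, Tendsto (fun k => inner ℝ (x k) z) l (𝓝 (inner ℝ p z)) := by
  let f : ℕ → WeakDual ℝ E := fun k => StrongDual.toWeakDual (InnerProductSpace.toDual ℝ E (x k))
  have hK := WeakDual.isCompact_closedBall (𝕜 := ℝ) (E := E) 0 C
  obtain ⟨a, -, ha⟩ := hK.ultrafilter_le_nhds (l.map f) (by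
    rw [le_principal_iff]
    refine Filter.mem_map.2 (Filter.Eventually.of_forall fun k => ?_)
    simpa [f] using hx k)
  refine ⟨(InnerProductSpace.toDual ℝ E).symm (WeakDual.toStrongDual a), fun z => ?_⟩
  have h1 : Tendsto f l (𝓝 a) := ha
  have h2 := (WeakDual.eval_continuous (𝕜 := ℝ) z).tendsto a |>.comp h1
  rw [InnerProductSpace.toDual_symm_apply]
  exact h2

/-- A strongly monotone Lipschitz map of a Hilbert space is bijective with Lipschitz inverse: for
small `θ` the map `u ↦ u - θ (P u - f)` is a contraction. -/
theorem exists_lipschitz_inverse {P : E → E} {L : ℝ≥0} (hL : LipschitzWith L P) {c : ℝ}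
    (hc : 0 < c) (hP : ∀ u v, c * ‖u - v‖ ^ 2 ≤ inner ℝ (P u - P v) (u - v)) :
    ∃ S : E → E, (∀ f, P (S f) = f) ∧ LipschitzWith (Real.toNNReal c⁻¹) S := by
  have hsurj : ∀ f, ∃ u, P u = f := by
    intro f
    set Λ : ℝ := L + c with hΛ
    have hΛ0 : 0 < Λ := by positivity
    -- `θ = c / Λ²` minimizes the squared contraction factor `1 - 2 θ c + θ² Λ²`
    set θ : ℝ := c / Λ ^ 2 with hθ
    have hθ0 : 0 < θ := by positivity
    set q : ℝ := Real.sqrt (1 - c ^ 2 / Λ ^ 2) with hq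
    have hcΛ : c ^ 2 / Λ ^ 2 ≤ 1 := by
      rw [div_le_one (by positivity)]
      have : 0 ≤ (L : ℝ) := L.2
      gcongr
      linarith
    have hq1 : q < 1 := by
      rw [hq, Real.sqrt_lt' one_pos]
      have : 0 < c ^ 2 / Λ ^ 2 := by positivity
      linarith
    have hcon : ContractingWith (Real.toNNReal q) (fun u => u - θ • (P u - f)) := by
      refine ⟨by rwa [Real.toNNReal_lt_one], LipschitzWith.of_dist_le_mul fun u v => ?_⟩
      rw [dist_eq_norm, dist_eq_norm, Real.coe_toNNReal _ (Real.sqrt_nonneg _)]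
      have e : u - θ • (P u - f) - (v - θ • (P v - f)) = (u - v) - θ • (P u - P v) := by
        rw [smul_sub, smul_sub, smul_sub]; abel
      rw [e]
      refine abs_le_of_sq_le_sq' ?_ (by positivity) |>.2
      rw [mul_pow, Real.sq_sqrt (by linarith), @norm_sub_sq_real, norm_smul, inner_smul_right,
        Real.norm_of_nonneg hθ0.le, real_inner_comm]
      have h1 := hP u v
      have h2 : ‖P u - P v‖ ≤ L * ‖u - v‖ := by
        simpa [dist_eq_norm] using hL.dist_le_mul u v
      have h3 : ‖P u - P v‖ ^ 2 ≤ Λ ^ 2 * ‖u - v‖ ^ 2 := by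
        rw [← mul_pow]
        have : (L : ℝ) ≤ Λ := by linarith
        gcongr
        exact h2.trans (by gcongr)
      have h4 : θ * (c * ‖u - v‖ ^ 2) ≤ θ * inner ℝ (P u - P v) (u - v) := by gcongr
      have h5 : θ ^ 2 * ‖P u - P v‖ ^ 2 ≤ θ ^ 2 * (Λ ^ 2 * ‖u - v‖ ^ 2) := by gcongr
      have h6 : θ ^ 2 * (Λ ^ 2 * ‖u - v‖ ^ 2) = c ^ 2 / Λ ^ 2 * ‖u - v‖ ^ 2 := by
        rw [hθ]; field_simp
      have h7 : θ * (c * ‖u - v‖ ^ 2) = c ^ 2 / Λ ^ 2 * ‖u - v‖ ^ 2 := by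
        rw [hθ]; field_simp
      nlinarith
    refine ⟨ContractingWith.fixedPoint _ hcon, ?_⟩
    have h := hcon.fixedPoint_isFixedPt
    have h' : θ • (P (ContractingWith.fixedPoint _ hcon) - f) = 0 := by
      have := h.eq
      simpa using this
    rcases smul_eq_zero.1 h' with h0 | h0
    · exact absurd h0 hθ0.ne'
    · exact sub_eq_zero.1 h0
  choose S hS using hsurj
  refine ⟨S, hS, LipschitzWith.of_dist_le_mul fun f g => ?_⟩
  rw [dist_eq_norm, dist_eq_norm, Real.coe_toNNReal _ (by positivity)]
  have h := hP (S f) (S g)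
  rw [hS, hS] at h
  have h2 := h.trans (real_inner_le_norm _ _)
  rw [inv_mul_eq_div, le_div_iff₀ hc]
  by_cases h0 : ‖S f - S g‖ = 0
  · rw [h0, zero_mul]; positivity
  · have : 0 < ‖S f - S g‖ := lt_of_le_of_ne (norm_nonneg _) (Ne.symm h0)
    nlinarith

end Hilbert

section Averages

variable {E : Type*} [NormedAddCommGroup E] [NormedSpace ℝ E] [FiniteDimensional ℝ E]
  [MeasurableSpace E] [BorelSpace E] {μ : Measure E} [μ.IsAddHaarMeasure]
  {F : Type*} [NormedAddCommGroup F]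

/-- Continuity of translations in `L²`. -/
theorem exists_eLpNorm_translate_sub_le {f : E → F} (hf : MemLp f 2 μ) {η : ℝ≥0∞} (hη : 0 < η) :
    ∃ δ > 0, ∀ s : E, ‖s‖ < δ → eLpNorm (fun x => f (s + x) - f x) 2 μ ≤ η := by
  have : Fact ((2 : ℝ≥0∞) ≠ ⊤) := ⟨by simp⟩
  let G : E → Lp F 2 μ := fun s => DomAddAct.mk s +ᵥ hf.toLp f
  have hG : Continuous G := by
    have h1 : Continuous fun s : E => (DomAddAct.mk s : Eᵈᵃᵃ) := DomAddAct.mkHomeomorph.continuous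
    exact h1.vadd continuous_const
  have h0 : G 0 = hf.toLp f := by simp [G]
  have h1 : ∀ᶠ s in 𝓝 (0 : E), edist (G s) (G 0) < η :=
    (hG.tendsto 0).eventually (Metric.eball_mem_nhds _ hη)
  obtain ⟨δ, hδ, h⟩ := Metric.eventually_nhds_iff.1 h1
  refine ⟨δ, hδ, fun s hs => ?_⟩
  have h2 := (h (y := s) (by simpa using hs)).le
  rw [h0, Lp.edist_def] at h2
  refine le_trans (le_of_eq ?_) h2
  apply eLpNorm_congr_ae
  have h3 : G s =ᵐ[μ] fun x => f (s + x) := by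
    have := DomAddAct.vadd_Lp_ae_eq (DomAddAct.mk s) (hf.toLp f)
    refine this.trans ?_
    have h4 := hf.coeFn_toLp
    exact (measurePreserving_vadd s μ).quasiMeasurePreserving.ae_eq_comp h4
  filter_upwards [h3, hf.coeFn_toLp] with x h5 h6
  simp [h5, h6]

/-- The means of `f` with respect to probability measures concentrated near `0` are close to `f` in
`L²`. This covers both mollification in space and averages over time windows. -/
theorem exists_eLpNorm_average_sub_le [NormedSpace ℝ F] [CompleteSpace F] {f : E → F}
    (hf : MemLp f 2 μ) {η : ℝ≥0∞} (hη : 0 < η) :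
    ∃ δ > 0, ∀ ν : Measure E, IsProbabilityMeasure ν → ν ≪ μ → (∀ᵐ s ∂ν, ‖s‖ < δ) →
      eLpNorm (fun x => (∫ s, f (s + x) ∂ν) - f x) 2 μ ≤ η := by
  obtain ⟨δ, hδ, hs⟩ := exists_eLpNorm_translate_sub_le hf hη
  refine ⟨δ, hδ, fun ν hν hνμ hνs => ?_⟩
  obtain ⟨f', hf'm, hff'⟩ := hf.1
  have htr : ∀ x, Measure.QuasiMeasurePreserving (fun s => s + x) ν μ := fun x =>
    ⟨measurable_add_const x, by
      have := (measurePreserving_add_right μ x).quasiMeasurePreserving.2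
      exact (hνμ.map (measurable_add_const x)).trans this⟩
  have hft : ∀ x, ∫ s, f (s + x) ∂ν = ∫ s, f' (s + x) ∂ν := fun x =>
    integral_congr_ae ((htr x).ae_eq_comp hff')
  have e2 : ∀ s, eLpNorm (fun x => f' (s + x) - f' x) 2 μ = eLpNorm (fun x => f (s + x) - f x) 2 μ := by
    intro s
    apply eLpNorm_congr_ae
    have h4 := (measurePreserving_add_left μ s).quasiMeasurePreserving.ae_eq_comp hff'
    filter_upwards [hff', h4] with x h1 h2
    simp only [Function.comp] at h2
    rw [h1, h2]
  have hsq : ∀ h : E → F, eLpNorm h 2 μ = (∫⁻ x, ‖h x‖ₑ ^ (2 : ℝ) ∂μ) ^ (1 / (2 : ℝ)) := by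
    intro h
    rw [eLpNorm_eq_lintegral_rpow_enorm_toReal (by simp) (by simp)]; simp
  have hm : Measurable fun p : E × E => ‖f' (p.2 + p.1) - f' p.1‖ₑ ^ (2 : ℝ) := by
    have : StronglyMeasurable fun p : E × E => f' (p.2 + p.1) - f' p.1 :=
      (hf'm.comp_measurable (measurable_snd.add measurable_fst)).sub
        (hf'm.comp_measurable measurable_fst)
    exact this.enorm.pow_const _
  have hJ : ∀ x, ‖(∫ s, f (s + x) ∂ν) - f' x‖ₑ ^ (2 : ℝ) ≤
      ∫⁻ s, ‖f' (s + x) - f' x‖ₑ ^ (2 : ℝ) ∂ν := by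
    intro x
    rw [hft x]
    by_cases htop : ∫⁻ s, ‖f' (s + x) - f' x‖ₑ ^ (2 : ℝ) ∂ν = ⊤
    · rw [htop]; exact le_top
    have hms : AEStronglyMeasurable (fun s => f' (s + x) - f' x) ν :=
      ((hf'm.comp_measurable (measurable_add_const x)).sub stronglyMeasurable_const).aestronglyMeasurable
    have hsq' : eLpNorm (fun s => f' (s + x) - f' x) 2 ν =
        (∫⁻ s, ‖f' (s + x) - f' x‖ₑ ^ (2 : ℝ) ∂ν) ^ (1 / (2 : ℝ)) := by
      rw [eLpNorm_eq_lintegral_rpow_enorm_toReal (by simp) (by simp)]; simp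
    have hL : MemLp (fun s => f' (s + x) - f' x) 2 ν :=
      ⟨hms, by rw [hsq']; exact ENNReal.rpow_lt_top_of_nonneg (by norm_num) htop⟩
    have hi : Integrable (fun s => f' (s + x) - f' x) ν := hL.integrable (by norm_num)
    have e3 : (∫ s, f' (s + x) ∂ν) - f' x = ∫ s, (f' (s + x) - f' x) ∂ν := by
      have hi2 : Integrable (fun s => f' (s + x)) ν := by
        exact (hi.add (integrable_const (f' x))).congr (ae_of_all _ fun s => by simp)
      rw [integral_sub hi2 (integrable_const _)]; simp
    rw [e3]
    have h1 : ‖∫ s, (f' (s + x) - f' x) ∂ν‖ₑ ≤ eLpNorm (fun s => f' (s + x) - f' x) 2 ν := by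
      refine (enorm_integral_le_lintegral_enorm _).trans ?_
      rw [← eLpNorm_one_eq_lintegral_enorm]
      exact eLpNorm_le_eLpNorm_of_exponent_le (by norm_num) hms
    calc _ ≤ (eLpNorm (fun s => f' (s + x) - f' x) 2 ν) ^ (2 : ℝ) := by gcongr
      _ = _ := by rw [hsq', ← ENNReal.rpow_mul]; simp
  have e4 : eLpNorm (fun x => (∫ s, f (s + x) ∂ν) - f x) 2 μ
      = eLpNorm (fun x => (∫ s, f (s + x) ∂ν) - f' x) 2 μ := by
    apply eLpNorm_congr_ae
    filter_upwards [hff'] with x hx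
    rw [hx]
  rw [e4, hsq]
  have key : ∫⁻ x, ‖(∫ s, f (s + x) ∂ν) - f' x‖ₑ ^ (2 : ℝ) ∂μ ≤ η ^ (2 : ℝ) := by
    calc _ ≤ ∫⁻ x, ∫⁻ s, ‖f' (s + x) - f' x‖ₑ ^ (2 : ℝ) ∂ν ∂μ := lintegral_mono hJ
      _ = ∫⁻ s, ∫⁻ x, ‖f' (s + x) - f' x‖ₑ ^ (2 : ℝ) ∂μ ∂ν :=
        lintegral_lintegral_swap hm.aemeasurable
      _ ≤ ∫⁻ s, η ^ (2 : ℝ) ∂ν := by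
        apply lintegral_mono_ae
        filter_upwards [hνs] with s hs'
        have h5 := hs s hs'
        rw [← e2, hsq] at h5
        calc _ = ((∫⁻ x, ‖f' (s + x) - f' x‖ₑ ^ (2 : ℝ) ∂μ) ^ (1 / (2 : ℝ))) ^ (2 : ℝ) := by
              rw [← ENNReal.rpow_mul]; simp
          _ ≤ _ := by gcongr
      _ = η ^ (2 : ℝ) := by simp
  calc _ ≤ (η ^ (2 : ℝ)) ^ (1 / (2 : ℝ)) := by gcongr
    _ = η := by rw [← ENNReal.rpow_mul]; simp

end Averages

/-! ### Functions of time and a Gronwall lemma with delay -/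

section Time

variable {F : Type*} [NormedAddCommGroup F] [NormedSpace ℝ F]

/-- The mean of `f` over the time window `(t - ε, t)`. -/
def backAvg (ε : ℝ) (f : ℝ → F) (t : ℝ) : F := ε⁻¹ • ∫ s in (t - ε)..t, f s

theorem tendsto_eLpNorm_backAvg_sub [CompleteSpace F] {f : ℝ → F} (hf : MemLp f 2 volume) :
    Tendsto (fun ε => eLpNorm (fun t => backAvg ε f t - f t) 2 volume) (𝓝[>] 0) (𝓝 0) := by
  rw [ENNReal.tendsto_nhds_zero]
  intro η hη
  obtain ⟨δ, hδ, h⟩ := exists_eLpNorm_average_sub_le hf hη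
  filter_upwards [Ioo_mem_nhdsGT hδ] with ε hε
  let ν : Measure ℝ := (ENNReal.ofReal ε)⁻¹ • volume.restrict (Ioc (-ε) 0)
  have hε0 : ENNReal.ofReal ε ≠ 0 := by simpa using hε.1
  have hν : IsProbabilityMeasure ν := by
    constructor
    simp only [ν, Measure.smul_apply, Measure.restrict_apply_univ, Real.volume_Ioc, smul_eq_mul]
    rw [show (0 : ℝ) - -ε = ε by ring]
    exact ENNReal.inv_mul_cancel hε0 (by simp)
  have hac : ν ≪ volume := Measure.smul_absolutelyContinuous.trans
    Measure.restrict_le_self.absolutelyContinuous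
  have hsup : ∀ᵐ s ∂ν, ‖s‖ < δ := by
    refine Measure.smul_absolutelyContinuous.ae_le ?_
    filter_upwards [ae_restrict_mem measurableSet_Ioc] with s hs
    rw [Real.norm_eq_abs, abs_lt]
    constructor <;> linarith [hs.1, hs.2, hε.2]
  refine le_trans (le_of_eq ?_) (h ν hν hac hsup)
  congr 1
  ext t
  congr 1
  simp only [ν, integral_smul_measure, backAvg]
  rw [ENNReal.toReal_inv, ENNReal.toReal_ofReal hε.1.le,
    ← intervalIntegral.integral_of_le (by linarith [hε.1]),
    intervalIntegral.integral_comp_add_right]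
  congr 2 <;> ring

/-- Integration by parts against a primitive. Since it follows from Fubini's theorem, `r` need only
be integrable. -/
theorem integral_deriv_smul_primitive [CompleteSpace F] {a b : ℝ} {φ : ℝ → ℝ} (hφ : ContDiff ℝ 1 φ)
    (hb : φ b = 0) {r : ℝ → F} (hr : IntegrableOn r (Ioo a b)) :
    ∫ t in Ioo a b, deriv φ t • ∫ s in a..t, r s = -∫ t in Ioo a b, φ t • r t := by
  have hd : IntegrableOn (deriv φ) (Ioo a b) :=
    ((hφ.continuous_deriv le_rfl).integrableOn_Icc).mono_set Ioo_subset_Icc_self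
  have hS : MeasurableSet {p : ℝ × ℝ | p.2 < p.1} := measurableSet_lt measurable_snd measurable_fst
  have hint : Integrable (Function.uncurry fun t s => (Iio t).indicator (fun s => deriv φ t • r s) s)
      ((volume.restrict (Ioo a b)).prod (volume.restrict (Ioo a b))) := by
    have h1 := (Integrable.smul_prod hd hr).indicator hS
    refine h1.congr (ae_of_all _ fun p => ?_)
    by_cases hp : p.2 < p.1 <;> simp [Function.uncurry, hp, Set.indicator]
  have e1 : ∀ t ∈ Ioo a b, deriv φ t • ∫ s in a..t, r s =
      ∫ s in Ioo a b, (Iio t).indicator (fun s => deriv φ t • r s) s := by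
    intro t ht
    rw [setIntegral_indicator measurableSet_Iio, intervalIntegral.integral_of_le ht.1.le,
      integral_Ioc_eq_integral_Ioo, integral_smul]
    congr 3
    ext s
    simp only [mem_Ioo, mem_inter_iff, mem_Iio]
    exact ⟨fun h => ⟨⟨h.1, h.2.trans ht.2⟩, h.2⟩, fun h => ⟨h.1.1, h.2⟩⟩
  have e2 : ∀ s ∈ Ioo a b, ∫ t in Ioo a b, (Iio t).indicator (fun s => deriv φ t • r s) s =
      -(φ s • r s) := by
    intro s hs
    have e3 : ∀ t, (Iio t).indicator (fun s => deriv φ t • r s) s =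
        (Ioi s).indicator (fun t => deriv φ t • r s) t := by
      intro t
      by_cases h : s < t <;> simp [Set.indicator, h]
    simp_rw [e3]
    rw [setIntegral_indicator measurableSet_Ioi, integral_smul_const]
    have e4 : Ioo a b ∩ Ioi s = Ioo s b := by
      ext t
      simp only [mem_Ioo, mem_inter_iff, mem_Ioi]
      exact ⟨fun h => ⟨h.2, h.1.2⟩, fun h => ⟨⟨hs.1.trans h.1, h.2⟩, h.1⟩⟩
    rw [e4, ← integral_Ioc_eq_integral_Ioo, ← intervalIntegral.integral_of_le hs.2.le,
      intervalIntegral.integral_deriv_eq_sub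
        (fun x _ => (hφ.differentiable one_ne_zero).differentiableAt)
        ((hφ.continuous_deriv le_rfl).intervalIntegrable _ _), hb, zero_sub, neg_smul]
  rw [setIntegral_congr_fun measurableSet_Ioo e1, integral_integral_swap hint,
    setIntegral_congr_fun measurableSet_Ioo e2, integral_neg]

/-- A test function of mean zero is the derivative of a test function. -/
theorem isTestFunction_primitive {a b : ℝ} {θ : ℝ → ℝ} (hθ : IsTestFunction (Ioo a b) θ)
    (h0 : ∫ t, θ t = 0) :
    IsTestFunction (Ioo a b) (fun t => ∫ s in a..t, θ s) ∧
      ∀ t, deriv (fun t => ∫ s in a..t, θ s) t = θ t := by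
  have hder : ∀ t, HasDerivAt (fun t => ∫ s in a..t, θ s) (θ t) t := fun t =>
    intervalIntegral.integral_hasDerivAt_right (hθ.contDiff.continuous.intervalIntegrable _ _)
      (hθ.contDiff.continuous.stronglyMeasurableAtFilter _ _) hθ.contDiff.continuous.continuousAt
  have hder' : deriv (fun t => ∫ s in a..t, θ s) = θ := funext fun t => (hder t).deriv
  -- The support of `θ` lies in a compact subinterval.
  obtain ⟨c, d, hac, hdb, hcd⟩ : ∃ c d, a < c ∧ d < b ∧ tsupport θ ⊆ Icc c d := by
    rcases (tsupport θ).eq_empty_or_nonempty with h | h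
    · exact ⟨a + 1, b - 1, by linarith, by linarith, by simp [h]⟩
    · have hK : IsCompact (tsupport θ) := hθ.hasCompactSupport
      have h1 := hK.sInf_mem h
      have h2 := hK.sSup_mem h
      exact ⟨_, _, (hθ.tsupport_subset h1).1, (hθ.tsupport_subset h2).2, fun x hx =>
        ⟨csInf_le hK.bddBelow hx, le_csSup hK.bddAbove hx⟩⟩
  have hz : ∀ t, t ∉ Icc c d → θ t = 0 := fun t ht =>
    image_eq_zero_of_notMem_tsupport fun h => ht (hcd h)
  have hsub : Function.support (fun t => ∫ s in a..t, θ s) ⊆ Icc c d := by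
    intro t ht
    by_contra hn
    apply ht
    rcases lt_or_ge t c with h | h
    · refine intervalIntegral.integral_zero_ae (ae_of_all _ fun s hs => hz s fun hs' => ?_)
      have : s ≤ max a t := hs.2
      have h2 : max a t < c := max_lt hac h
      linarith [hs'.1]
    · have hdt : d < t := by
        by_contra h'
        exact hn ⟨h, not_lt.1 h'⟩
      refine (intervalIntegral.integral_eq_integral_of_support_subset ?_).trans h0
      intro s hs
      by_contra hn'
      apply hs
      apply hz
      intro hs'
      exact hn' ⟨hac.trans_le hs'.1, hs'.2.trans hdt.le⟩
  refine ⟨⟨?_, ?_, ?_⟩, fun t => (hder t).deriv⟩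
  · rw [contDiff_infty_iff_deriv]
    exact ⟨fun t => (hder t).differentiableAt, by rw [hder']; exact hθ.contDiff⟩
  · exact HasCompactSupport.of_support_subset_isCompact isCompact_Icc hsub
  · exact (closure_minimal hsub isClosed_Icc).trans fun x hx =>
      ⟨hac.trans_le hx.1, hx.2.trans_lt hdb⟩

/-- The lemma of du Bois-Reymond: a function whose weak derivative vanishes is constant. An
arbitrary test function differs from a multiple of a fixed one of integral `1` by a derivative of a
test function. -/
theorem ae_eq_const_of_integral_deriv_smul [CompleteSpace F] {a b : ℝ} (hab : a < b) {w : ℝ → F}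
    (hw : IntegrableOn w (Ioo a b))
    (h : ∀ φ, IsTestFunction (Ioo a b) φ → ∫ t in Ioo a b, deriv φ t • w t = 0) :
    ∃ c : F, ∀ᵐ t ∂volume.restrict (Ioo a b), w t = c := by
  let B : ContDiffBump ((a + b) / 2) := ⟨(b - a) / 8, (b - a) / 4, by linarith, by linarith⟩
  let χ : ℝ → ℝ := B.normed volume
  have hχ : IsTestFunction (Ioo a b) χ := by
    refine ⟨B.contDiff_normed, B.hasCompactSupport_normed, ?_⟩
    rw [B.tsupport_normed_eq, Real.closedBall_eq_Icc]
    intro x hx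
    simp only [B, mem_Icc] at hx
    exact ⟨by linarith [hx.1], by linarith [hx.2]⟩
  have hχ1 : ∫ t, χ t = 1 := B.integral_normed
  set c : F := ∫ t in Ioo a b, χ t • w t with hc
  have hI : ∀ {ψ : ℝ → ℝ}, Continuous ψ → IntegrableOn (fun t => ψ t • w t) (Ioo a b) := by
    intro ψ hψ
    obtain ⟨M, hM⟩ := isCompact_Icc.exists_bound_of_continuousOn (s := Icc a b) hψ.continuousOn
    refine hw.bdd_smul M hψ.aestronglyMeasurable.restrict ?_
    filter_upwards [ae_restrict_mem measurableSet_Ioo] with t ht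
    exact hM t (Ioo_subset_Icc_self ht)
  refine ⟨c, ?_⟩
  have key : ∀ᵐ t, t ∈ Ioo a b → w t - c = 0 := by
    refine isOpen_Ioo.ae_eq_zero_of_integral_contDiff_smul_eq_zero (f := fun t => w t - c) ?_ ?_
    · exact (hw.sub (integrableOn_const (by simp) )).locallyIntegrableOn
    · intro ψ hψ hψc hψs
      have hψ' : IsTestFunction (Ioo a b) ψ := ⟨hψ, hψc, hψs⟩
      set m : ℝ := ∫ t, ψ t with hm
      have hθ : IsTestFunction (Ioo a b) (fun t => ψ t - m * χ t) := by
        refine ⟨hψ.sub (contDiff_const.mul hχ.contDiff),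
          hψc.sub (hχ.hasCompactSupport.mul_left), ?_⟩
        refine (tsupport_sub _ _).trans (union_subset hψs ?_)
        exact (tsupport_mul_subset_right).trans hχ.tsupport_subset
      have hθ0 : ∫ t, (ψ t - m * χ t) = 0 := by
        rw [integral_sub (hψ.continuous.integrable_of_hasCompactSupport hψc)
          ((hχ.contDiff.continuous.integrable_of_hasCompactSupport hχ.hasCompactSupport).const_mul m),
          integral_const_mul, hχ1, mul_one, sub_self]
      obtain ⟨h1, h2⟩ := isTestFunction_primitive hθ hθ0
      have h3 := h _ h1
      simp_rw [h2] at h3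
      have e0 : ∫ t, ψ t • (w t - c) = ∫ t in Ioo a b, ψ t • (w t - c) := by
        rw [setIntegral_eq_integral_of_forall_compl_eq_zero]
        intro t ht
        rw [image_eq_zero_of_notMem_tsupport (fun h => ht (hψs h)), zero_smul]
      have e00 : m = ∫ t in Ioo a b, ψ t := by
        rw [setIntegral_eq_integral_of_forall_compl_eq_zero]
        intro t ht
        exact image_eq_zero_of_notMem_tsupport (fun h => ht (hψs h))
      rw [e0]
      simp_rw [smul_sub]
      rw [integral_sub (hI hψ.continuous) ((hψ.continuous.integrableOn_Icc.mono_set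
        Ioo_subset_Icc_self).smul_const c), integral_smul_const, ← e00]
      simp_rw [sub_smul, mul_smul] at h3
      have h4 := integral_sub (hI hψ.continuous) ((hI hχ.contDiff.continuous).smul m)
      simp only [Pi.smul_apply] at h4
      rw [h4, integral_smul, ← hc] at h3
      exact h3
  rw [ae_restrict_iff' measurableSet_Ioo]
  filter_upwards [key] with t ht hm using sub_eq_zero.1 (ht hm)

/-- Gronwall's lemma for backward differences with step `ε`, for a function which is constant before
time `0`. In place of the value at `T` it bounds the mean over the last window `(T - ε, T)`. The
inequality is multiplied by `exp (-2 Φ)`, which turns it into a telescoping one as long as the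
increments of `Φ` over one step are at most `1 / 2`. -/
theorem gronwall_delay {ε T M : ℝ} (hε : 0 < ε) (hT : 0 < T) {Φ Z s R : ℝ → ℝ}
    {Z₀ : ℝ} (hΦ : Monotone Φ) (hΦ0 : ∀ t, -ε < t → 0 ≤ Φ t) (hΦM : ∀ t, t ≤ T → Φ t ≤ M)
    (hΦε : ∀ t ∈ Ioo 0 T, Φ t - Φ (t - ε) ≤ 1 / 2) (hZ : ∀ t, 0 ≤ Z t) (hZ₀ : ∀ t ≤ 0, Z t = Z₀)
    (hZi : IntervalIntegrable Z volume 0 T) (hs : ∀ t, 0 ≤ s t) (hR : ∀ t, 0 ≤ R t)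
    (hsi : IntervalIntegrable s volume 0 T) (hRi : IntervalIntegrable R volume 0 T)
    (hineq : ∀ᵐ t, t ∈ Ioo 0 T → Z t + ε * s t ≤
      Z (t - ε) + (Φ t - Φ (t - ε)) * Z t + ε * R t) :
    ε⁻¹ * (∫ t in (T - ε)..T, Z t) + ∫ t in (0 : ℝ)..T, s t ≤
      Real.exp (2 * M) * (Z₀ + ∫ t in (0 : ℝ)..T, R t) := by
  have hZi0 : IntervalIntegrable Z volume (-ε) 0 := by
    refine (intervalIntegrable_const (c := Z₀)).congr fun t ht => ?_
    rw [uIoc_of_le (by linarith)] at ht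
    exact (hZ₀ t ht.2).symm
  let P : ℝ → ℝ := fun t => Real.exp (-2 * Φ t)
  have hPanti : Antitone P := fun a b hab => Real.exp_le_exp.2 (by linarith [hΦ hab])
  have hP0 : ∀ t, 0 < P t := fun t => Real.exp_pos _
  have hP1 : ∀ t, -ε < t → P t ≤ 1 := fun t ht => by
    simp only [P, Real.exp_le_one_iff]; linarith [hΦ0 t ht]
  have hPM : ∀ t, t ≤ T → Real.exp (-2 * M) ≤ P t := fun t ht =>
    Real.exp_le_exp.2 (by linarith [hΦM t ht])
  let Y : ℝ → ℝ := fun t => P t * Z t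
  have hYi : ∀ a b, -ε ≤ a → a ≤ b → b ≤ T → IntervalIntegrable Y volume a b := by
    intro a b ha hab hb
    have h1 : IntervalIntegrable Z volume a b :=
      (hZi0.trans hZi).mono_set (by
        rw [uIcc_of_le hab, uIcc_of_le (by linarith)]; exact Icc_subset_Icc ha hb)
    rw [intervalIntegrable_iff_integrableOn_Ioc_of_le hab] at h1 ⊢
    refine Integrable.bdd_mul (c := 1) h1 hPanti.measurable.aestronglyMeasurable ?_
    filter_upwards [ae_restrict_mem measurableSet_Ioc] with t ht
    rw [Real.norm_of_nonneg (hP0 t).le]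
    exact hP1 t (ha.trans_lt ht.1)
  have hpt : ∀ᵐ t, t ∈ Ioo 0 T →
      Y t + ε * Real.exp (-2 * M) * s t ≤ Y (t - ε) + ε * R t := by
    filter_upwards [hineq] with t ht hm
    have h1 := ht hm
    set δ := Φ t - Φ (t - ε) with hδ
    have hδ0 : 0 ≤ δ := sub_nonneg.2 (hΦ (by linarith))
    have hδ2 := hΦε t hm
    have h2 : Real.exp (-2 * δ) ≤ 1 - δ := by
      -- `exp(-2δ) ≤ 1 / (1 + 2δ) ≤ 1 - δ` for `δ ≤ 1/2`
      have h3 := Real.add_one_le_exp (2 * δ)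
      have h4 : Real.exp (-2 * δ) * Real.exp (2 * δ) = 1 := by
        rw [← Real.exp_add]; simp
      have h5 := Real.exp_pos (-2 * δ)
      have h6 : Real.exp (-2 * δ) * (2 * δ + 1) ≤ 1 := by
        calc _ ≤ Real.exp (-2 * δ) * Real.exp (2 * δ) := by gcongr
          _ = 1 := h4
      by_contra hcon
      push Not at hcon
      nlinarith
    have hPδ : P t = P (t - ε) * Real.exp (-2 * δ) := by
      simp only [P]; rw [← Real.exp_add]; congr 1; rw [hδ]; ring
    have h3 : (1 - δ) * Z t + ε * s t ≤ Z (t - ε) + ε * R t := by linarith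
    have h4 : Y t ≤ P (t - ε) * ((1 - δ) * Z t) := by
      simp only [Y]; rw [hPδ, mul_assoc]
      exact mul_le_mul_of_nonneg_left (mul_le_mul_of_nonneg_right h2 (hZ t)) (hP0 _).le
    have h5 := mul_le_mul_of_nonneg_left h3 (hP0 (t - ε)).le
    have h6 : P (t - ε) * (ε * R t) ≤ ε * R t :=
      mul_le_of_le_one_left (mul_nonneg hε.le (hR t)) (hP1 _ (by linarith [hm.1]))
    have h7 : ε * Real.exp (-2 * M) * s t ≤ P (t - ε) * (ε * s t) := by
      have := mul_le_mul_of_nonneg_right (hPM (t - ε) (by linarith [hm.2]))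
        (mul_nonneg hε.le (hs t))
      linarith
    have h8 : Y (t - ε) = P (t - ε) * Z (t - ε) := rfl
    linarith
  have hYsh : IntervalIntegrable (fun t => Y (t - ε)) volume 0 T := by
    have := (hYi (-ε) (T - ε) le_rfl (by linarith) (by linarith)).comp_sub_right ε
    simpa using this
  have hint : ∫ t in (0 : ℝ)..T, (Y t + ε * Real.exp (-2 * M) * s t) ≤
      ∫ t in (0 : ℝ)..T, (Y (t - ε) + ε * R t) := by
    refine intervalIntegral.integral_mono_ae_restrict hT.le
      ((hYi 0 T (by linarith) hT.le le_rfl).add (hsi.const_mul _)) (hYsh.add (hRi.const_mul _)) ?_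
    have h0 : ∀ᵐ t ∂volume.restrict (Icc 0 T), t ∈ Ioo 0 T := by
      rw [← restrict_Ioo_eq_restrict_Icc]; exact ae_restrict_mem measurableSet_Ioo
    filter_upwards [h0, ae_restrict_of_ae hpt] with t ht h using h ht
  rw [intervalIntegral.integral_add (hYi 0 T (by linarith) hT.le le_rfl) (hsi.const_mul _),
    intervalIntegral.integral_add hYsh (hRi.const_mul _), intervalIntegral.integral_const_mul,
    intervalIntegral.integral_const_mul, intervalIntegral.integral_comp_sub_right] at hint
  have hYT : ∫ t in (0 : ℝ)..T, Y t = (∫ t in (0 - ε)..(T - ε), Y t) +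
      (∫ t in (T - ε)..T, Y t) - ∫ t in (0 - ε)..0, Y t := by
    have h1 := intervalIntegral.integral_add_adjacent_intervals
      (hYi (0 - ε) (T - ε) (by linarith) (by linarith) (by linarith))
      (hYi (T - ε) T (by linarith) (by linarith) le_rfl)
    have h2 := intervalIntegral.integral_add_adjacent_intervals
      (hYi (0 - ε) 0 (by linarith) (by linarith) hT.le)
      (hYi 0 T (by linarith) hT.le le_rfl)
    linarith
  have hY0 : ∫ t in (0 - ε)..0, Y t ≤ ε * Z₀ := by
    have h1 : ∫ t in (0 - ε)..0, Y t ≤ ∫ t in (0 - ε)..0, Z₀ := by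
      refine intervalIntegral.integral_mono_on_of_le_Ioo (by linarith)
        (hYi _ _ (by linarith) (by linarith) hT.le) intervalIntegrable_const fun t ht => ?_
      simp only [Y]
      rw [← hZ₀ t ht.2.le]
      exact mul_le_of_le_one_left (hZ t) (hP1 t (by linarith [ht.1]))
    refine h1.trans (le_of_eq ?_)
    simp
  have hYT' : Real.exp (-2 * M) * (∫ t in (T - ε)..T, Z t) ≤ ∫ t in (T - ε)..T, Y t := by
    rw [← intervalIntegral.integral_const_mul]
    refine intervalIntegral.integral_mono_on_of_le_Ioo (by linarith) ?_
      (hYi _ _ (by linarith) (by linarith) le_rfl) fun t ht => ?_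
    · refine IntervalIntegrable.const_mul ?_ _
      exact (hZi0.trans hZi).mono_set (by
        rw [uIcc_of_le (by linarith), uIcc_of_le (by linarith)]
        exact Icc_subset_Icc (by linarith) le_rfl)
    · exact mul_le_mul_of_nonneg_right (hPM t ht.2.le) (hZ t)
  have hfin : Real.exp (-2 * M) * (∫ t in (T - ε)..T, Z t) +
      ε * Real.exp (-2 * M) * (∫ t in (0 : ℝ)..T, s t) ≤
      ε * Z₀ + ε * ∫ t in (0 : ℝ)..T, R t := by linarith
  have hexp : Real.exp (2 * M) * Real.exp (-2 * M) = 1 := by rw [← Real.exp_add]; simp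
  have h9 := mul_le_mul_of_nonneg_left hfin
    (mul_nonneg (Real.exp_pos (2 * M)).le (inv_nonneg.2 hε.le))
  have hεi : ε⁻¹ * ε = 1 := inv_mul_cancel₀ hε.ne'
  calc ε⁻¹ * (∫ t in (T - ε)..T, Z t) + ∫ t in (0 : ℝ)..T, s t
      = Real.exp (2 * M) * ε⁻¹ * (Real.exp (-2 * M) * (∫ t in (T - ε)..T, Z t) +
      ε * Real.exp (-2 * M) * (∫ t in (0 : ℝ)..T, s t)) := by
        linear_combination (-(ε⁻¹ * (∫ t in (T - ε)..T, Z t)) - (ε⁻¹ * ε) *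
          (∫ t in (0 : ℝ)..T, s t)) * hexp - (∫ t in (0 : ℝ)..T, s t) * hεi
    _ ≤ _ := h9
    _ = _ := by linear_combination Real.exp (2 * M) * (Z₀ + ∫ t in (0 : ℝ)..T, R t) * hεi

end Time

/-! ### The energy estimate -/

section TimeSpaces

variable {F : Type*} [NormedAddCommGroup F]

theorem memLp_timeMeasure_mono {T S : ℝ} (h : S ≤ T) {w : ℝ → F} {p : ℝ≥0∞}
    (hw : MemLp w p (timeMeasure T)) : MemLp w p (timeMeasure S) :=
  hw.mono_measure (Measure.restrict_mono (Ioo_subset_Ioo_right h) le_rfl)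

theorem intervalIntegrable_of_integrable {T : ℝ} (hT : 0 ≤ T) {w : ℝ → F}
    (hw : Integrable w (timeMeasure T)) : IntervalIntegrable w volume 0 T := by
  rwa [intervalIntegrable_iff_integrableOn_Ioo_of_le hT]

theorem intervalIntegrable_norm_sq {T : ℝ} (hT : 0 ≤ T) {w : ℝ → F}
    (hw : MemLp w 2 (timeMeasure T)) : IntervalIntegrable (fun t => ‖w t‖ ^ 2) volume 0 T :=
  intervalIntegrable_of_integrable hT hw.norm.integrable_sq

theorem integral_timeMeasure [NormedSpace ℝ F] {T : ℝ} (hT : 0 ≤ T) (w : ℝ → F) :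
    ∫ t, w t ∂timeMeasure T = ∫ t in (0 : ℝ)..T, w t := by
  rw [intervalIntegral.integral_of_le hT, integral_Ioc_eq_integral_Ioo]; rfl

theorem integral_norm_sq_eq_toReal {Ω : Type*} [MeasurableSpace Ω] {μ : Measure Ω} {f : Ω → F}
    (hf : MemLp f 2 μ) : ∫ x, ‖f x‖ ^ 2 ∂μ = (eLpNorm f 2 μ).toReal ^ 2 := by
  have h0 : 0 ≤ ∫ x, ‖f x‖ ^ 2 ∂μ := integral_nonneg fun x => by positivity
  rw [hf.eLpNorm_eq_integral_rpow_norm (by simp) (by simp)]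
  have h2 : 0 ≤ (∫ x, ‖f x‖ ^ 2 ∂μ) ^ (2 : ℝ)⁻¹ := Real.rpow_nonneg h0 _
  simp only [ENNReal.toReal_ofNat, Real.rpow_ofNat]
  rw [ENNReal.toReal_ofReal h2, ← Real.rpow_natCast, ← Real.rpow_mul h0]
  norm_num

instance instIsFiniteMeasureTimeMeasure (T : ℝ) : IsFiniteMeasure (timeMeasure T) := by
  unfold timeMeasure; infer_instance

/-- The averages over backward windows of a function of `L²(0,T)`, extended by zero, converge to it
in `L²(ℝ)`, with the norms written as Bochner integrals. -/
theorem backAvg_indicator_sub [NormedSpace ℝ F] [CompleteSpace F] {T : ℝ} {r : ℝ → F}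
    (hr : MemLp r 2 (timeMeasure T)) :
    (∀ᶠ ε in 𝓝[>] (0 : ℝ), MemLp (fun t => backAvg ε ((Ioo 0 T).indicator r) t -
      (Ioo 0 T).indicator r t) 2 volume) ∧
    Tendsto (fun ε => ∫ t, ‖backAvg ε ((Ioo 0 T).indicator r) t -
      (Ioo 0 T).indicator r t‖ ^ 2) (𝓝[>] 0) (𝓝 0) := by
  set r' : ℝ → F := (Ioo 0 T).indicator r with hr'
  have hr'L : MemLp r' 2 volume := (memLp_indicator_iff_restrict measurableSet_Ioo).2 hr
  have hravg := tendsto_eLpNorm_backAvg_sub hr'L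
  let ρ : ℝ → ℝ → F := fun ε t => backAvg ε r' t - r' t
  have hr'i : Integrable r' := (integrable_indicator_iff measurableSet_Ioo).2
    (hr.integrable (by norm_num))
  have hρm : ∀ ε, AEStronglyMeasurable (ρ ε) volume := by
    intro ε
    refine AEStronglyMeasurable.sub ?_ hr'L.1
    have hc : Continuous fun t => ∫ s in (0 : ℝ)..t, r' s :=
      intervalIntegral.continuous_primitive (fun a b => hr'i.intervalIntegrable) 0
    have : backAvg ε r' = fun t => ε⁻¹ • ((∫ s in (0 : ℝ)..t, r' s) - ∫ s in (0 : ℝ)..(t - ε), r' s) := by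
      ext t
      rw [backAvg, intervalIntegral.integral_interval_sub_left hr'i.intervalIntegrable
        hr'i.intervalIntegrable]
    rw [this]
    exact ((hc.sub (hc.comp (continuous_id.sub continuous_const))).const_smul _).aestronglyMeasurable
  have hρL : ∀ᶠ ε in 𝓝[>] (0 : ℝ), MemLp (ρ ε) 2 volume := by
    filter_upwards [hravg.eventually (gt_mem_nhds ENNReal.zero_lt_top)] with ε hε
    exact ⟨hρm ε, hε⟩
  have hρ0 : Tendsto (fun ε => ∫ t, ‖ρ ε t‖ ^ 2) (𝓝[>] 0) (𝓝 0) := by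
    have h1 : Tendsto (fun ε => (eLpNorm (ρ ε) 2 volume).toReal ^ 2) (𝓝[>] 0) (𝓝 0) := by
      have := ((ENNReal.tendsto_toReal ENNReal.zero_ne_top).comp hravg).pow 2
      simpa using this
    refine h1.congr' ?_
    filter_upwards [hρL] with ε hε
    rw [integral_norm_sq_eq_toReal hε]
  exact ⟨hρL, hρ0⟩

end TimeSpaces

section Past

variable {V H K : Type*} [NormedAddCommGroup V] [InnerProductSpace ℝ V]
  [NormedAddCommGroup H] [InnerProductSpace ℝ H] [NormedAddCommGroup K] [InnerProductSpace ℝ K]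
  {J : V →L[ℝ] H} {D : V →L[ℝ] K}

/-- The function which is `J ∘ w` for positive times and the constant `w₀` before, so that backward
differences near time `0` see the initial value. -/
def withPast (J : V →L[ℝ] H) (w₀ : H) (w : ℝ → V) (t : ℝ) : H := if 0 < t then J (w t) else w₀

theorem withPast_pos {w₀ : H} {w : ℝ → V} {t : ℝ} (ht : 0 < t) :
    withPast J w₀ w t = J (w t) := if_pos ht

theorem withPast_nonpos {w₀ : H} {w : ℝ → V} {t : ℝ} (ht : t ≤ 0) :
    withPast J w₀ w t = w₀ := if_neg ht.not_gt

/-- The energy estimate in difference form: from `α (J w(t) - J w(t - ε), J w(t)) ≤ ε (-‖D w‖² + a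
‖w‖)`, by the delayed Gronwall lemma. The constant depends on `α` and `T` only. The part `‖J w‖²` of
`‖w‖²`, which `-‖D w‖²` does not control, goes into the Gronwall factor. -/
theorem energy_bound_of_backward_difference (hJD : ∀ u, ‖u‖ ^ 2 = ‖J u‖ ^ 2 + ‖D u‖ ^ 2)
    {α T ε : ℝ} (hα : 0 < α) (hT : 0 < T) (hε : 0 < ε) (hε1 : ε ≤ 1) (hεα : ε ≤ α / 4)
    {w : ℝ → V} {w₀ : H} {a : ℝ → ℝ} (hw : MemLp w 2 (timeMeasure T))
    (ha : MemLp a 2 (timeMeasure T))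
    (hineq : ∀ᵐ t, t ∈ Ioo 0 T →
      α * ⟪withPast J w₀ w t - withPast J w₀ w (t - ε), J (w t)⟫_ℝ ≤
        ε * (-‖D (w t)‖ ^ 2 + a t * ‖w t‖)) :
    ε⁻¹ * (∫ t in (T - ε)..T, ‖withPast J w₀ w t‖ ^ 2) + ∫ t in (0 : ℝ)..T, α⁻¹ * ‖w t‖ ^ 2 ≤
      Real.exp (2 * (2 / α * (T + 1))) * (‖w₀‖ ^ 2 + ∫ t in (0 : ℝ)..T, α⁻¹ * a t ^ 2) := by
  have hJw : IntervalIntegrable (fun t => ‖withPast J w₀ w t‖ ^ 2) volume 0 T := by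
    refine (intervalIntegrable_norm_sq hT.le (J.comp_memLp' hw)).congr fun t ht => ?_
    rw [uIoc_of_le hT.le] at ht
    simp [withPast_pos ht.1]
  refine gronwall_delay (Φ := fun t => 2 / α * (t + ε)) hε hT ?_ ?_ ?_ ?_ (fun t => by positivity)
    (fun t ht => by rw [withPast_nonpos ht]) hJw (fun t => by positivity) (fun t => by positivity)
    ((intervalIntegrable_norm_sq hT.le hw).const_mul _)
    ((intervalIntegrable_of_integrable hT.le ha.integrable_sq).const_mul _) ?_
  · intro s t hst
    change 2 / α * (s + ε) ≤ 2 / α * (t + ε)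
    gcongr
  · intro t ht
    have : 0 ≤ t + ε := by linarith
    positivity
  · intro t ht
    gcongr
  · intro t _
    have : 2 / α * (t + ε) - 2 / α * (t - ε + ε) = 2 * ε / α := by ring
    rw [this, div_le_iff₀ hα]
    linarith
  · filter_upwards [hineq] with t ht hm
    have h1 := ht hm
    rw [withPast_pos hm.1] at h1 ⊢
    set y := withPast J w₀ w (t - ε)
    have h2 : ‖J (w t)‖ ^ 2 / 2 - ‖y‖ ^ 2 / 2 ≤ ⟪J (w t) - y, J (w t)⟫_ℝ := by
      rw [inner_sub_left, real_inner_self_eq_norm_sq]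
      have h3 := real_inner_le_norm y (J (w t))
      nlinarith [sq_nonneg (‖y‖ - ‖J (w t)‖)]
    have h4 : a t * ‖w t‖ ≤ a t ^ 2 / 2 + ‖w t‖ ^ 2 / 2 := by
      nlinarith [sq_nonneg (a t - ‖w t‖)]
    have h5 := hJD (w t)
    have h6 : α * (‖J (w t)‖ ^ 2 / 2 - ‖y‖ ^ 2 / 2) ≤
        ε * (-(‖w t‖ ^ 2 / 2) + ‖J (w t)‖ ^ 2 + a t ^ 2 / 2) := by
      calc _ ≤ α * ⟪J (w t) - y, J (w t)⟫_ℝ := by gcongr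
        _ ≤ _ := h1
        _ ≤ _ := by
          refine mul_le_mul_of_nonneg_left ?_ hε.le
          linarith
    have h7 := mul_le_mul_of_nonneg_left h6 (inv_nonneg.2 hα.le)
    have h8 : α⁻¹ * α = 1 := inv_mul_cancel₀ hα.ne'
    have e1 : α⁻¹ * (α * (‖J (w t)‖ ^ 2 / 2 - ‖y‖ ^ 2 / 2)) =
        ‖J (w t)‖ ^ 2 / 2 - ‖y‖ ^ 2 / 2 := by
      rw [← mul_assoc, h8, one_mul]
    rw [e1] at h7
    have e2 : 2 / α * (t + ε) - 2 / α * (t - ε + ε) = 2 * ε * α⁻¹ := by ring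
    rw [e2]
    linarith

theorem memLp_withPast_sub {T ε : ℝ} (hε : 0 < ε) {w : ℝ → V} (hw : MemLp w 2 (timeMeasure T))
    (w₀ : H) : MemLp (fun t => withPast J w₀ w (t - ε)) 2 (timeMeasure T) := by
  let g : ℝ → H := (Ioo 0 T).indicator (fun t => J (w t)) + (Ioc (-ε) 0).indicator fun _ => w₀
  have hg : MemLp g 2 volume := by
    refine MemLp.add ((memLp_indicator_iff_restrict measurableSet_Ioo).2 (J.comp_memLp' hw)) ?_
    exact memLp_indicator_const 2 measurableSet_Ioc w₀ (Or.inr (by simp))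
  have h1 : MemLp (fun t => g (t - ε)) 2 (timeMeasure T) :=
    (hg.comp_measurePreserving (measurePreserving_sub_right volume ε)).restrict _
  refine h1.ae_eq ?_
  filter_upwards [ae_restrict_mem measurableSet_Ioo] with t ht
  rcases le_or_gt (t - ε) 0 with h | h
  · have h2 : t - ε ∈ Ioc (-ε) 0 := ⟨by linarith [ht.1], h⟩
    have h3 : t - ε ∉ Ioo 0 T := fun h' => absurd h'.1 h.not_gt
    simp [g, withPast_nonpos h, indicator_of_mem h2, indicator_of_notMem h3]
  · have h2 : t - ε ∉ Ioc (-ε) 0 := fun h' => absurd h'.2 h.not_ge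
    have h3 : t - ε ∈ Ioo 0 T := ⟨h, by linarith [ht.2]⟩
    simp [g, withPast_pos h, indicator_of_notMem h2, indicator_of_mem h3]

theorem norm_le_of_norm_sq_eq_add (hJD : ∀ u, ‖u‖ ^ 2 = ‖J u‖ ^ 2 + ‖D u‖ ^ 2) (u : V) :
    ‖J u‖ ≤ ‖u‖ := by
  refine abs_le_of_sq_le_sq' ?_ (norm_nonneg _) |>.2
  rw [hJD u]; linarith [sq_nonneg ‖D u‖]

end Past

section Energy

variable {V H K : Type*}
  [NormedAddCommGroup V] [InnerProductSpace ℝ V] [CompleteSpace V]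
  [NormedAddCommGroup H] [InnerProductSpace ℝ H] [CompleteSpace H]
  [NormedAddCommGroup K] [InnerProductSpace ℝ K]
  {J : V →L[ℝ] H} {D : V →L[ℝ] K}

/-- The backward difference of a function with derivative `r` is `ε` times the backward average of
`r`; the initial value `w₀` and the extension of `r` by zero account for the windows that start
before time `0`. -/
theorem smul_adjoint_withPast_sub {α T : ℝ} {w : ℝ → V} {w₀ : H} {r : ℝ → V}
    (hwr : ∀ᵐ t ∂timeMeasure T,
      α • (J†) (J (w t)) = α • (J†) w₀ + ∫ s in (0 : ℝ)..t, r s)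
    (hr : Integrable r (timeMeasure T)) {ε : ℝ} (hε : 0 < ε) :
    ∀ᵐ t, t ∈ Ioo 0 T →
      α • (J†) (withPast J w₀ w t - withPast J w₀ w (t - ε)) =
        ε • backAvg ε ((Ioo 0 T).indicator r) t := by
  have h1 : ∀ᵐ t, t ∈ Ioo 0 T →
      α • (J†) (J (w t)) = α • (J†) w₀ + ∫ s in (0 : ℝ)..t, r s :=
    (ae_restrict_iff' measurableSet_Ioo).1 hwr
  have h2 := (measurePreserving_sub_right volume ε).quasiMeasurePreserving.ae h1
  filter_upwards [h1, h2] with t h1 h2 hm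
  have hri : Integrable ((Ioo 0 T).indicator r) :=
    (integrable_indicator_iff measurableSet_Ioo).2 hr
  have hind : ∀ s, s ∈ Ioo 0 T → ∫ x in (0 : ℝ)..s, (Ioo 0 T).indicator r x =
      ∫ x in (0 : ℝ)..s, r x := by
    intro s hs
    refine intervalIntegral.integral_congr_ae (ae_of_all _ fun x hx => ?_)
    rw [uIoc_of_le hs.1.le] at hx
    exact indicator_of_mem (show x ∈ Ioo 0 T from ⟨hx.1, hx.2.trans_lt hs.2⟩) _
  have hsplit : ∫ x in (t - ε)..t, (Ioo 0 T).indicator r x =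
      (∫ x in (0 : ℝ)..t, (Ioo 0 T).indicator r x) -
        ∫ x in (0 : ℝ)..(t - ε), (Ioo 0 T).indicator r x := by
    rw [intervalIntegral.integral_interval_sub_left hri.intervalIntegrable hri.intervalIntegrable]
  rw [backAvg, smul_smul, mul_inv_cancel₀ hε.ne', one_smul, hsplit, hind t hm, map_sub, smul_sub,
    withPast_pos hm.1, h1 hm]
  rcases le_or_gt (t - ε) 0 with h | h
  · rw [withPast_nonpos h]
    have : ∫ x in (0 : ℝ)..(t - ε), (Ioo 0 T).indicator r x = 0 := by
      refine intervalIntegral.integral_zero_ae (ae_of_all _ fun x hx => ?_)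
      rw [uIoc_of_ge h] at hx
      exact indicator_of_notMem (fun hx' => absurd hx'.1 (not_lt.2 hx.2)) _
    rw [this]; abel
  · have hm' : t - ε ∈ Ioo 0 T := ⟨h, by linarith [hm.2]⟩
    rw [withPast_pos h, h2 hm', hind _ hm']; abel

/-- Almost every time is a Lebesgue point from the left. -/
theorem tendsto_inv_mul_integral_left {f : ℝ → ℝ} {T : ℝ} (hT : 0 < T)
    (hf : IntervalIntegrable f volume 0 T) :
    ∀ᵐ s ∂timeMeasure T, Tendsto (fun ε => ε⁻¹ * ∫ t in (s - ε)..s, f t) (𝓝[>] 0) (𝓝 (f s)) := by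
  have h := hf.ae_hasDerivAt_integral
  refine (ae_restrict_iff' measurableSet_Ioo).2 ?_
  filter_upwards [h] with s hs hm
  have hs' : s ∈ uIcc 0 T := by rw [uIcc_of_le hT.le]; exact Ioo_subset_Icc_self hm
  have h1 := (hs hs' 0 left_mem_uIcc).tendsto_slope_zero_left
  have h2 : Tendsto (fun ε : ℝ => -ε) (𝓝[>] 0) (𝓝[<] 0) := by
    have := tendsto_neg_nhdsGT (a := (0 : ℝ))
    simpa using this
  refine (h1.comp h2).congr' ?_
  filter_upwards [Ioo_mem_nhdsGT hm.1] with ε hε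
  have hi : ∀ x, x ∈ Icc 0 T → IntervalIntegrable f volume 0 x := fun x hx =>
    hf.mono_set (by rw [uIcc_of_le hx.1, uIcc_of_le hT.le]; exact Icc_subset_Icc_right hx.2)
  have h3 := intervalIntegral.integral_interval_sub_left (hi s (Ioo_subset_Icc_self hm))
    (hi (s - ε) ⟨by linarith [hε.2], by linarith [hε.1, hm.2]⟩)
  simp only [Function.comp, smul_eq_mul, ← h3]
  rw [← sub_eq_add_neg, inv_neg]; ring

/-- The energy estimate for `α (J† J w)' = r` with initial value `w₀`, tested with `w`. Only `J† J
w` has a derivative in `V`, so the chain rule for `‖J w‖²` is not available; instead the backward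
differences of the equation are tested with `w`, and the step `ε` tends to `0`. The resulting means
of `‖J w‖²` over backward windows converge at Lebesgue points. -/
theorem energy_bound (hJD : ∀ u, ‖u‖ ^ 2 = ‖J u‖ ^ 2 + ‖D u‖ ^ 2) {α T : ℝ} (hα : 0 < α)
    (hT : 0 < T) {w : ℝ → V} {w₀ : H} {r : ℝ → V} {b : ℝ → ℝ} (hw : MemLp w 2 (timeMeasure T))
    (hr : MemLp r 2 (timeMeasure T)) (hb : MemLp b 2 (timeMeasure T))
    (hwr : ∀ᵐ t ∂timeMeasure T,
      α • (J†) (J (w t)) = α • (J†) w₀ + ∫ s in (0 : ℝ)..t, r s)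
    (hineq : ∀ᵐ t ∂timeMeasure T, ⟪r t, w t⟫_ℝ ≤ -‖D (w t)‖ ^ 2 + b t * ‖w t‖) :
    (∫ t, ‖w t‖ ^ 2 ∂timeMeasure T ≤ α * (Real.exp (2 * (2 / α * (T + 1))) *
      (‖w₀‖ ^ 2 + 2 * α⁻¹ * ∫ t, b t ^ 2 ∂timeMeasure T))) ∧
    ∀ᵐ t ∂timeMeasure T, ‖J (w t)‖ ^ 2 ≤ Real.exp (2 * (2 / α * (T + 1))) *
      (‖w₀‖ ^ 2 + 2 * α⁻¹ * ∫ t, b t ^ 2 ∂timeMeasure T) := by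
  set r' : ℝ → V := (Ioo 0 T).indicator r with hr'
  let ρ : ℝ → ℝ → V := fun ε t => backAvg ε r' t - r' t
  obtain ⟨hρL, hρ0⟩ := backAvg_indicator_sub hr
  set E : ℝ := Real.exp (2 * (2 / α * (T + 1))) with hE
  set B : ℝ := ∫ t, b t ^ 2 ∂timeMeasure T with hB
  have hα' : 0 < α⁻¹ := inv_pos.2 hα
  -- the estimate on `(0, S)`, with an error that vanishes with `ε`
  have main : ∀ᶠ ε in 𝓝[>] (0 : ℝ), ∀ S ∈ Ioc 0 T,
      ε⁻¹ * (∫ t in (S - ε)..S, ‖withPast J w₀ w t‖ ^ 2) + ∫ t in (0 : ℝ)..S, α⁻¹ * ‖w t‖ ^ 2 ≤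
        E * (‖w₀‖ ^ 2 + 2 * α⁻¹ * (B + ∫ t, ‖ρ ε t‖ ^ 2)) := by
    have hpos : (0 : ℝ) < min 1 (α / 4) := by positivity
    filter_upwards [hρL, Ioo_mem_nhdsGT hpos] with ε hL hε S hS
    have hε1 : ε ≤ 1 := hε.2.le.trans (min_le_left _ _)
    have hεα : ε ≤ α / 4 := hε.2.le.trans (min_le_right _ _)
    have hLS : MemLp (ρ ε) 2 (timeMeasure S) := hL.restrict _
    have haS : MemLp (fun t => ‖b t‖ + ‖ρ ε t‖) 2 (timeMeasure S) :=
      (memLp_timeMeasure_mono hS.2 hb).norm.add hLS.norm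
    have h1 := energy_bound_of_backward_difference (D := D) (w₀ := w₀)
      (a := fun t => ‖b t‖ + ‖ρ ε t‖) hJD hα hS.1 hε.1 hε1 hεα (memLp_timeMeasure_mono hS.2 hw) haS ?_
    · refine h1.trans ?_
      have h2 : ∫ t in (0 : ℝ)..S, α⁻¹ * (‖b t‖ + ‖ρ ε t‖) ^ 2 ≤
          2 * α⁻¹ * (B + ∫ t, ‖ρ ε t‖ ^ 2) := by
        have hbS := (memLp_timeMeasure_mono hS.2 hb).norm.integrable_sq
        have hρS := hLS.norm.integrable_sq
        rw [← integral_timeMeasure hS.1.le]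
        calc _ ≤ ∫ t, 2 * α⁻¹ * (‖b t‖ ^ 2 + ‖ρ ε t‖ ^ 2) ∂timeMeasure S := by
              refine integral_mono (haS.integrable_sq.const_mul _)
                ((hbS.add hρS).const_mul _) fun t => ?_
              have h0 := sq_nonneg (‖b t‖ - ‖ρ ε t‖)
              have h3 : (‖b t‖ + ‖ρ ε t‖) ^ 2 ≤ 2 * (‖b t‖ ^ 2 + ‖ρ ε t‖ ^ 2) := by nlinarith
              calc α⁻¹ * (‖b t‖ + ‖ρ ε t‖) ^ 2 ≤ α⁻¹ * (2 * (‖b t‖ ^ 2 + ‖ρ ε t‖ ^ 2)) := by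
                    gcongr
                _ = _ := by ring
          _ = 2 * α⁻¹ * ((∫ t, ‖b t‖ ^ 2 ∂timeMeasure S) + ∫ t, ‖ρ ε t‖ ^ 2 ∂timeMeasure S) := by
              rw [integral_const_mul, integral_add hbS hρS]
          _ ≤ _ := by
              have h4 : ∫ t, ‖b t‖ ^ 2 ∂timeMeasure S ≤ B := by
                simp only [hB, Real.norm_eq_abs, sq_abs]
                exact integral_mono_measure (Measure.restrict_mono (Ioo_subset_Ioo_right hS.2) le_rfl)
                  (ae_of_all _ fun t => sq_nonneg _) hb.integrable_sq
              have h5 : ∫ t, ‖ρ ε t‖ ^ 2 ∂timeMeasure S ≤ ∫ t, ‖ρ ε t‖ ^ 2 :=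
                integral_mono_measure Measure.restrict_le_self
                  (ae_of_all _ fun t => sq_nonneg _) hL.norm.integrable_sq
              gcongr
      have h6 : Real.exp (2 * (2 / α * (S + 1))) ≤ E := by
        rw [hE]; have := hS.2; gcongr
      have h7 : 0 ≤ ∫ t in (0 : ℝ)..S, α⁻¹ * (‖b t‖ + ‖ρ ε t‖) ^ 2 :=
        intervalIntegral.integral_nonneg hS.1.le fun t _ => by positivity
      gcongr
    · have hineq' := (ae_restrict_iff' measurableSet_Ioo).1 hineq
      filter_upwards [smul_adjoint_withPast_sub hwr (hr.integrable (by norm_num)) hε.1, hineq']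
        with t ht hi hm
      have hmT : t ∈ Ioo 0 T := ⟨hm.1, hm.2.trans_le hS.2⟩
      rw [← ContinuousLinearMap.adjoint_inner_left, ← real_inner_smul_left, ht hmT,
        real_inner_smul_left]
      refine mul_le_mul_of_nonneg_left ?_ hε.1.le
      have e1 : backAvg ε r' t = r t + ρ ε t := by
        simp only [ρ, hr', indicator_of_mem hmT]; abel
      rw [e1, inner_add_left]
      have h8 := hi hmT
      have h9 := real_inner_le_norm (ρ ε t) (w t)
      have h10 : b t * ‖w t‖ ≤ ‖b t‖ * ‖w t‖ := by
        gcongr; exact le_abs_self _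
      linarith
  have hlim : Tendsto (fun ε => E * (‖w₀‖ ^ 2 + 2 * α⁻¹ * (B + ∫ t, ‖ρ ε t‖ ^ 2))) (𝓝[>] 0)
      (𝓝 (E * (‖w₀‖ ^ 2 + 2 * α⁻¹ * B))) := by
    have := ((hρ0.const_add B).const_mul (2 * α⁻¹)).const_add (‖w₀‖ ^ 2) |>.const_mul E
    simpa using this
  constructor
  · rw [integral_timeMeasure hT.le]
    have h1 : ∫ t in (0 : ℝ)..T, α⁻¹ * ‖w t‖ ^ 2 ≤ E * (‖w₀‖ ^ 2 + 2 * α⁻¹ * B) := by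
      refine ge_of_tendsto hlim ?_
      filter_upwards [main, self_mem_nhdsWithin] with ε h hε
      have h2 := h T ⟨hT, le_rfl⟩
      have h3 : 0 ≤ ε⁻¹ * (∫ t in (T - ε)..T, ‖withPast J w₀ w t‖ ^ 2) :=
        mul_nonneg (inv_nonneg.2 (le_of_lt hε)) (intervalIntegral.integral_nonneg
          (by linarith [mem_Ioi.1 hε]) fun t _ => by positivity)
      linarith
    rw [intervalIntegral.integral_const_mul, inv_mul_le_iff₀ hα] at h1
    exact h1
  · have hJw : IntervalIntegrable (fun t => ‖withPast J w₀ w t‖ ^ 2) volume 0 T := by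
      refine (intervalIntegrable_norm_sq hT.le (J.comp_memLp' hw)).congr fun t ht => ?_
      rw [uIoc_of_le hT.le] at ht
      simp [withPast_pos ht.1]
    filter_upwards [tendsto_inv_mul_integral_left hT hJw, ae_restrict_mem measurableSet_Ioo]
      with s hs hm
    rw [withPast_pos hm.1] at hs
    refine le_of_tendsto_of_tendsto hs hlim ?_
    filter_upwards [main] with ε h
    have h2 := h s ⟨hm.1, hm.2.le⟩
    have h3 : 0 ≤ ∫ t in (0 : ℝ)..s, α⁻¹ * ‖w t‖ ^ 2 :=
      intervalIntegral.integral_nonneg hm.1.le fun t _ => by positivity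
    linarith

end Energy

/-! ### The regularized delay equation -/

section Scheme

variable {V H K X : Type*}
  [NormedAddCommGroup V] [InnerProductSpace ℝ V] [CompleteSpace V]
  [NormedAddCommGroup H] [InnerProductSpace ℝ H] [CompleteSpace H]
  [NormedAddCommGroup K] [InnerProductSpace ℝ K] [CompleteSpace K]
  [NormedAddCommGroup X] [InnerProductSpace ℝ X] [CompleteSpace X]
  {J : V →L[ℝ] H} {D : V →L[ℝ] K} {τ : V →L[ℝ] X}

/-- One time step: the operator `κ J† J + D† D + τ† N τ` is strongly monotone and Lipschitz. -/
theorem exists_stationary_solver (hJD : ∀ u, ‖u‖ ^ 2 = ‖J u‖ ^ 2 + ‖D u‖ ^ 2) {κ : ℝ} (hκ : 0 < κ)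
    {N : X → X} {L : ℝ≥0} (hN : LipschitzWith L N) (hN0 : N 0 = 0)
    (hNm : ∀ x y, 0 ≤ ⟪N x - N y, x - y⟫_ℝ) :
    ∃ (S : V → V) (c : ℝ≥0), LipschitzWith c S ∧ S 0 = 0 ∧
      ∀ f, κ • (J†) (J (S f)) + (D†) (D (S f)) + (τ†) (N (τ (S f))) = f := by
  let P : V → V := fun u => κ • (J†) (J u) + (D†) (D u) + (τ†) (N (τ u))
  have hP : ∀ u v, min κ 1 * ‖u - v‖ ^ 2 ≤ ⟪P u - P v, u - v⟫_ℝ := by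
    intro u v
    have e : P u - P v = κ • (J†) (J (u - v)) + (D†) (D (u - v)) + (τ†) (N (τ u) - N (τ v)) := by
      simp only [P, map_sub, smul_sub]; abel
    rw [e, inner_add_left, inner_add_left, real_inner_smul_left,
      ContinuousLinearMap.adjoint_inner_left, ContinuousLinearMap.adjoint_inner_left,
      ContinuousLinearMap.adjoint_inner_left, real_inner_self_eq_norm_sq,
      real_inner_self_eq_norm_sq, map_sub τ, hJD]
    have h1 := hNm (τ u) (τ v)
    have h2 : min κ 1 * ‖J (u - v)‖ ^ 2 ≤ κ * ‖J (u - v)‖ ^ 2 := by gcongr; exact min_le_left _ _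
    have h3 : min κ 1 * ‖D (u - v)‖ ^ 2 ≤ 1 * ‖D (u - v)‖ ^ 2 := by gcongr; exact min_le_right _ _
    linarith
  have hL1 : LipschitzWith _ fun u => (κ • ((J†).comp J) + (D†).comp D) u :=
    (κ • ((J†).comp J) + (D†).comp D).lipschitz
  have hL2 : LipschitzWith _ fun u => (τ†) (N (τ u)) :=
    (τ†).lipschitz.comp (hN.comp τ.lipschitz)
  obtain ⟨S, hS, hSL⟩ := exists_lipschitz_inverse (P := P) (hL1.add hL2)
    (lt_min hκ one_pos) hP
  refine ⟨S, _, hSL, ?_, hS⟩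
  have h1 := hP (S 0) 0
  have h2 : P 0 = 0 := by simp [P, hN0]
  rw [hS, h2, sub_self, inner_zero_left, sub_zero] at h1
  have h3 : 0 < min κ 1 := lt_min hκ one_pos
  have h4 : ‖S 0‖ ^ 2 = 0 := by nlinarith [sq_nonneg ‖S 0‖]
  simpa using h4

/-- The regularized delay equation has a solution, by the method of steps: the unknown at time `t`
solves a stationary problem whose data involve the unknown at time `t - ε` only. -/
theorem exists_delay_solution (hJD : ∀ u, ‖u‖ ^ 2 = ‖J u‖ ^ 2 + ‖D u‖ ^ 2) {κ : ℝ} (hκ : 0 < κ)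
    {N : X → X} {L : ℝ≥0} (hN : LipschitzWith L N) (hN0 : N 0 = 0)
    (hNm : ∀ x y, 0 ≤ ⟪N x - N y, x - y⟫_ℝ) {T ε : ℝ} (hε : 0 < ε) (u₀ : H) {f : ℝ → V}
    (hf : MemLp f 2 (timeMeasure T)) :
    ∃ u : ℝ → V, MemLp u 2 (timeMeasure T) ∧ ∀ t ∈ Ioo 0 T,
      κ • (J†) (withPast J u₀ u t - withPast J u₀ u (t - ε)) =
        f t - (D†) (D (u t)) - (τ†) (N (τ (u t))) := by
  obtain ⟨S, c, hSL, hS0, hS⟩ := exists_stationary_solver (τ := τ) hJD hκ hN hN0 hNm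
  let next : (ℝ → V) → ℝ → V := fun w t => S (f t + κ • (J†) (withPast J u₀ w (t - ε)))
  let seq : ℕ → ℝ → V := fun k => next^[k] 0
  have hsucc : ∀ k, seq (k + 1) = next (seq k) := fun k => Function.iterate_succ_apply' _ _ _
  have hL : ∀ k, MemLp (seq k) 2 (timeMeasure T) := by
    intro k
    induction k with
    | zero => exact MemLp.zero
    | succ k ih =>
      rw [hsucc]
      exact hSL.comp_memLp hS0 (hf.add (((J†).comp_memLp' (memLp_withPast_sub hε ih u₀)).const_smul κ))
  -- the iterates are stationary on `(0, k ε]` from the `k`-th on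
  have hst : ∀ k : ℕ, ∀ t ≤ k * ε, 0 < t → seq (k + 1) t = seq k t := by
    intro k
    induction k with
    | zero => intro t ht h0; simp at ht; linarith
    | succ k ih =>
      intro t ht h0
      rw [hsucc (k + 1), hsucc k]
      simp only [next]
      congr 4
      rcases le_or_gt (t - ε) 0 with h | h
      · rw [withPast_nonpos h, withPast_nonpos h]
      · have ih' := ih (t - ε) (by push_cast at ht; linarith) h
        rw [hsucc] at ih'
        simp only [next] at ih'
        rw [withPast_pos h, withPast_pos h, ih']
  obtain ⟨k, hk⟩ := exists_nat_ge (T / ε)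
  refine ⟨seq k, hL k, fun t ht => ?_⟩
  have hkT : T ≤ k * ε := by rwa [div_le_iff₀ hε] at hk
  have h1 : seq k t = S (f t + κ • (J†) (withPast J u₀ (seq k) (t - ε))) := by
    rw [← hst k t (ht.2.le.trans hkT) ht.1, hsucc]
  have h2 := hS (f t + κ • (J†) (withPast J u₀ (seq k) (t - ε)))
  rw [← h1] at h2
  rw [withPast_pos ht.1, map_sub, smul_sub, sub_eq_iff_eq_add, ← sub_eq_zero]
  rw [← sub_eq_zero] at h2
  rw [← h2]; abel

end Scheme

/-! ### Yosida families and the bound of the boundary term -/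

section Apriori

variable {V H K X : Type*}
  [NormedAddCommGroup V] [InnerProductSpace ℝ V]
  [NormedAddCommGroup H] [InnerProductSpace ℝ H]
  [NormedAddCommGroup K] [InnerProductSpace ℝ K]
  [NormedAddCommGroup X] [InnerProductSpace ℝ X]

/-- The properties of the Yosida approximations `N l`, `l > 0`, of a maximal monotone operator on
the boundary space `X`, and of potentials `Ψ l` on `H`, on which the existence proof rests. Joint
monotonicity is stated in the resolvent points `x - l N l x`. The field `exists_test` provides for
every `u` a test function `p` with trace `N l (τ u)`, which pairs nonnegatively with `u` under `D`,
is a subgradient of `Ψ l` at `J u`, and is bounded, as measured by `q`, in terms of `Ψ l`. For the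
Yosida approximations `b l` of a graph in `ℝ`, `N l` and `p` are the superpositions `b l ∘ τ u` and
`b l ∘ u`, `Ψ l` is the integral of the Moreau envelope, and `q` is the norm of `L¹`. -/
structure IsYosidaFamily (J : V →L[ℝ] H) (D : V →L[ℝ] K) (τ : V →L[ℝ] X) (N : ℝ → X → X)
    (Ψ : ℝ → H → ℝ) (q : H → ℝ) (D₁ D₂ : ℝ) : Prop where
  map_zero : ∀ l > 0, N l 0 = 0
  monotone : ∀ l > 0, ∀ m > 0, ∀ x y,
    0 ≤ ⟪N l x - N m y, (x - l • N l x) - (y - m • N m y)⟫_ℝ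
  nonneg : ∀ l > 0, ∀ z, 0 ≤ Ψ l z
  continuous : ∀ l > 0, Continuous (Ψ l)
  growth : ∀ l > 0, ∃ C, ∀ z, Ψ l z ≤ C * ‖z‖ ^ 2
  exists_test : ∀ l > 0, ∀ u, ∃ p, τ p = N l (τ u) ∧ 0 ≤ ⟪D u, D p⟫_ℝ ∧
    (∀ z, Ψ l (J u) - Ψ l z ≤ ⟪J u - z, J p⟫_ℝ) ∧ q (J p) ≤ D₁ * Ψ l (J u) + D₂

variable {J : V →L[ℝ] H} {D : V →L[ℝ] K} {τ : V →L[ℝ] X} {N : ℝ → X → X} {Ψ : ℝ → H → ℝ}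
  {q : H → ℝ} {D₁ D₂ : ℝ}

theorem IsYosidaFamily.cocoercive (hN : IsYosidaFamily J D τ N Ψ q D₁ D₂) {l : ℝ} (hl : 0 < l)
    (x y : X) : l * ‖N l x - N l y‖ ^ 2 ≤ ⟪N l x - N l y, x - y⟫_ℝ := by
  have h := hN.monotone l hl l hl x y
  have e : (x - l • N l x) - (y - l • N l y) = (x - y) - l • (N l x - N l y) := by
    rw [smul_sub]; abel
  rw [e, inner_sub_right, inner_smul_right, real_inner_self_eq_norm_sq] at h
  linarith

theorem IsYosidaFamily.lipschitz (hN : IsYosidaFamily J D τ N Ψ q D₁ D₂) {l : ℝ} (hl : 0 < l) :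
    LipschitzWith (Real.toNNReal l⁻¹) (N l) := by
  refine LipschitzWith.of_dist_le_mul fun x y => ?_
  rw [dist_eq_norm, dist_eq_norm, Real.coe_toNNReal _ (by positivity), inv_mul_eq_div,
    le_div_iff₀ hl]
  have h := (hN.cocoercive hl x y).trans (real_inner_le_norm _ _)
  by_cases h0 : ‖N l x - N l y‖ = 0
  · rw [h0, zero_mul]; positivity
  · have : 0 < ‖N l x - N l y‖ := lt_of_le_of_ne (norm_nonneg _) (Ne.symm h0)
    nlinarith

/-- Averaging over backward windows does not increase the integral of a nonnegative function. -/
theorem integral_backAvg_le {T ε : ℝ} (hT : 0 ≤ T) (hε : 0 < ε) {G : ℝ → ℝ}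
    (hG : Integrable G (timeMeasure T)) (hG0 : ∀ t, 0 ≤ G t) :
    IntervalIntegrable (backAvg ε ((Ioo 0 T).indicator G)) volume 0 T ∧
    ∫ t in (0 : ℝ)..T, backAvg ε ((Ioo 0 T).indicator G) t ≤ ∫ t, G t ∂timeMeasure T := by
  set G' := (Ioo 0 T).indicator G with hG'
  have hi : Integrable G' := (integrable_indicator_iff measurableSet_Ioo).2 hG
  have hii : ∀ a b, IntervalIntegrable G' volume a b := fun a b => hi.intervalIntegrable
  let Γ : ℝ → ℝ := fun t => ∫ s in (0 : ℝ)..t, G' s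
  have hΓc : Continuous Γ := intervalIntegral.continuous_primitive hii 0
  have hG'0 : ∀ t, 0 ≤ G' t := fun t => indicator_nonneg (fun t _ => hG0 t) t
  have hΓd : ∀ s t, Γ t - Γ s = ∫ x in s..t, G' x := fun s t =>
    intervalIntegral.integral_interval_sub_left (hii _ _) (hii _ _)
  have hΓm : Monotone Γ := fun s t hst => by
    have := hΓd s t
    have h2 : 0 ≤ ∫ x in s..t, G' x := intervalIntegral.integral_nonneg hst fun x _ => hG'0 x
    linarith
  have hΓ0 : ∀ t ≤ 0, Γ t = 0 := fun t ht => by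
    refine intervalIntegral.integral_zero_ae (ae_of_all _ fun x hx => ?_)
    rw [uIoc_of_ge ht] at hx
    exact indicator_of_notMem (fun hx' : x ∈ Ioo 0 T => absurd hx'.1 (not_lt.2 hx.2)) _
  have hΓT : Γ T = ∫ t, G t ∂timeMeasure T := by
    simp only [Γ]
    rw [← integral_timeMeasure hT]
    refine integral_congr_ae ?_
    filter_upwards [ae_restrict_mem measurableSet_Ioo] with t ht using indicator_of_mem ht _
  have e : backAvg ε G' = fun t => ε⁻¹ * (Γ t - Γ (t - ε)) := by
    ext t; rw [hΓd, backAvg, smul_eq_mul]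
  have hΓs : Continuous fun t => Γ (t - ε) := hΓc.comp (continuous_id.sub continuous_const)
  rw [e]
  refine ⟨((hΓc.sub hΓs).const_mul _).intervalIntegrable _ _, ?_⟩
  rw [intervalIntegral.integral_const_mul, intervalIntegral.integral_sub
    (hΓc.intervalIntegrable _ _) (hΓs.intervalIntegrable _ _),
    intervalIntegral.integral_comp_sub_right, ← hΓT, inv_mul_le_iff₀ hε]
  have h1 := intervalIntegral.integral_add_adjacent_intervals (μ := volume)
    (hΓc.intervalIntegrable (0 - ε) 0) (hΓc.intervalIntegrable 0 T)
  have h2 := intervalIntegral.integral_add_adjacent_intervals (μ := volume)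
    (hΓc.intervalIntegrable (0 - ε) (T - ε)) (hΓc.intervalIntegrable (T - ε) T)
  have h3 : ∫ t in (0 - ε)..0, Γ t = 0 :=
    intervalIntegral.integral_zero_ae (ae_of_all _ fun x hx => by
      rw [uIoc_of_le (by linarith)] at hx; exact hΓ0 x hx.2)
  have h4 : ∫ t in (T - ε)..T, Γ t ≤ ∫ t in (T - ε)..T, Γ T :=
    intervalIntegral.integral_mono_on (by linarith) (hΓc.intervalIntegrable _ _)
      intervalIntegrable_const fun t ht => hΓm ht.2
  have h5 : ∫ t in (T - ε)..T, Γ T = ε * Γ T := by simp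
  linarith

/-- Uniform absolute continuity: the integrals over short windows are uniformly small. This makes
the increments of the Gronwall factor small. -/
theorem eventually_integral_indicator_le {T : ℝ} {G : ℝ → ℝ}
    (hG : Integrable G (timeMeasure T)) {η : ℝ} (hη : 0 < η) :
    ∀ᶠ ε in 𝓝[>] (0 : ℝ), ∀ t ∈ Ioo 0 T, ∫ s in (t - ε)..t, (Ioo 0 T).indicator G s ≤ η := by
  set G' := (Ioo 0 T).indicator G with hG'
  have hi : Integrable G' := (integrable_indicator_iff measurableSet_Ioo).2 hG
  have hii : ∀ a b, IntervalIntegrable G' volume a b := fun a b => hi.intervalIntegrable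
  have hΓc : Continuous fun t => ∫ s in (0 : ℝ)..t, G' s :=
    intervalIntegral.continuous_primitive hii 0
  have hu := isCompact_Icc.uniformContinuousOn_of_continuous (s := Icc (-1) T) hΓc.continuousOn
  obtain ⟨δ, hδ, h⟩ := Metric.uniformContinuousOn_iff.1 hu η hη
  have hpos : (0 : ℝ) < min δ 1 := by positivity
  filter_upwards [Ioo_mem_nhdsGT hpos] with ε hε t ht
  have hε1 : ε < δ := hε.2.trans_le (min_le_left _ _)
  have hε2 : ε < 1 := hε.2.trans_le (min_le_right _ _)
  have h1 := h t ⟨by linarith [ht.1], ht.2.le⟩ (t - ε)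
    ⟨by linarith [ht.1], by linarith [ht.2, hε.1]⟩ (by
      rw [Real.dist_eq, sub_sub_cancel, abs_of_pos hε.1]; exact hε1)
  rw [Real.dist_eq, intervalIntegral.integral_interval_sub_left (hii _ _) (hii _ _)] at h1
  exact (le_abs_self _).trans h1.le

variable [CompleteSpace V] [CompleteSpace H] [CompleteSpace K] [CompleteSpace X]

/-- The solutions of the regularized delay equations have boundary terms bounded in `L²(0,T;X)`. The
equation is tested with the Yosida approximation `p` of `u` itself; then the diffusion term has a
sign, the boundary term is `‖N ε (τ u)‖²`, the differences are those of `Ψ ε` up to the subgradient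
inequality, and `g` is paired with a function whose `q` is controlled by `Ψ ε`. Replacing `g` by its
backward average makes the resulting Gronwall factor a backward difference of the primitive of `G`,
which is small for small `ε`. -/
theorem exists_bound_boundary_term (hN : IsYosidaFamily J D τ N Ψ q D₁ D₂) (hD₁ : 0 ≤ D₁)
    (hD₂ : 0 ≤ D₂)
    {α T : ℝ} (hα : 0 < α) (hT : 0 < T) {u₀ : H} {M₀ : ℝ} (hM₀ : ∀ l > 0, Ψ l u₀ ≤ M₀)
    {g : ℝ → H} (hg : MemLp g 2 (timeMeasure T)) {h : ℝ → X} (hh : MemLp h 2 (timeMeasure T))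
    {G : ℝ → ℝ} (hG : Integrable G (timeMeasure T)) (hG0 : ∀ t, 0 ≤ G t)
    (hgG : ∀ᵐ t ∂timeMeasure T, ∀ z, ⟪g t, z⟫_ℝ ≤ G t * q z) :
    ∃ C, ∀ᶠ ε in 𝓝[>] (0 : ℝ), ∀ u : ℝ → V, MemLp u 2 (timeMeasure T) →
      (∀ t ∈ Ioo 0 T, (α / ε) • (J†) (withPast J u₀ u t - withPast J u₀ u (t - ε)) =
        ((J†) (backAvg ε ((Ioo 0 T).indicator g) t) + (τ†) (h t)) -
          (D†) (D (u t)) - (τ†) (N ε (τ (u t)))) →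
      ∫ t, ‖N ε (τ (u t))‖ ^ 2 ∂timeMeasure T ≤ C := by
  set G' := (Ioo 0 T).indicator G with hG'
  set g' := (Ioo 0 T).indicator g with hg'
  have hi : Integrable G' := (integrable_indicator_iff measurableSet_Ioo).2 hG
  have hgi : Integrable g' := (integrable_indicator_iff measurableSet_Ioo).2
    (hg.integrable (by norm_num))
  have hii : ∀ a b, IntervalIntegrable G' volume a b := fun a b => hi.intervalIntegrable
  have hG'0 : ∀ t, 0 ≤ G' t := fun t => indicator_nonneg (fun t _ => hG0 t) t
  let Γ : ℝ → ℝ := fun t => ∫ s in (0 : ℝ)..t, G' s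
  have hΓd : ∀ s t, Γ t - Γ s = ∫ x in s..t, G' x := fun s t =>
    intervalIntegral.integral_interval_sub_left (hii _ _) (hii _ _)
  have hΓm : Monotone Γ := fun s t hst => by
    have := hΓd s t
    have h2 : 0 ≤ ∫ x in s..t, G' x := intervalIntegral.integral_nonneg hst fun x _ => hG'0 x
    linarith
  have hΓ0 : ∀ t ≤ 0, Γ t = 0 := fun t ht => by
    refine intervalIntegral.integral_zero_ae (ae_of_all _ fun x hx => ?_)
    rw [uIoc_of_ge ht] at hx
    exact indicator_of_notMem (fun hx' : x ∈ Ioo 0 T => absurd hx'.1 (not_lt.2 hx.2)) _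
  have hgG' : ∀ᵐ t, ∀ z, ⟪g' t, z⟫_ℝ ≤ G' t * q z := by
    filter_upwards [(ae_restrict_iff' measurableSet_Ioo).1 hgG] with t ht z
    by_cases hm : t ∈ Ioo 0 T
    · simpa [hG', hg', indicator_of_mem hm] using ht hm z
    · simp [hG', hg', indicator_of_notMem hm]
  have hD : 0 ≤ D₁ / α := by positivity
  refine ⟨2 * α * (Real.exp (2 * (D₁ / α * Γ T)) *
    (M₀ + (α⁻¹ * (D₂ * (∫ t, G t ∂timeMeasure T) + (∫ t, ‖h t‖ ^ 2 ∂timeMeasure T) / 2)))), ?_⟩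
  have hη : 0 < (2 * (D₁ / α + 1))⁻¹ := by positivity
  filter_upwards [eventually_integral_indicator_le hG hη, self_mem_nhdsWithin] with ε hε1 hε u hu heq
  rw [mem_Ioi] at hε
  choose p hp1 hp2 hp3 hp4 using hN.exists_test ε hε
  have hJu : MemLp (fun t => J (u t)) 2 (timeMeasure T) := J.comp_memLp' hu
  have hξ : MemLp (fun t => N ε (τ (u t))) 2 (timeMeasure T) :=
    (hN.lipschitz hε).comp_memLp (hN.map_zero ε hε) (τ.comp_memLp' hu)
  obtain ⟨hBi, hB⟩ := integral_backAvg_le hT.le hε hG hG0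
  have hB0 : ∀ t, 0 ≤ backAvg ε G' t := fun t =>
    mul_nonneg (inv_nonneg.2 hε.le) (intervalIntegral.integral_nonneg (by linarith)
      fun x _ => hG'0 x)
  have hZi : IntervalIntegrable (fun t => Ψ ε (withPast J u₀ u t)) volume 0 T := by
    have h1 : Integrable (fun t => Ψ ε (J (u t))) (timeMeasure T) := by
      obtain ⟨C, hC⟩ := hN.growth ε hε
      refine (hJu.norm.integrable_sq.const_mul C).mono'
        ((hN.continuous ε hε).comp_aestronglyMeasurable hJu.1) (ae_of_all _ fun t => ?_)
      rw [Real.norm_of_nonneg (hN.nonneg ε hε _)]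
      exact hC _
    refine (intervalIntegrable_of_integrable hT.le h1).congr fun t ht => ?_
    rw [uIoc_of_le hT.le] at ht
    simp [withPast_pos ht.1]
  have hgr := gronwall_delay (Φ := fun t => D₁ / α * Γ t) (M := D₁ / α * Γ T)
    (Z := fun t => Ψ ε (withPast J u₀ u t)) (Z₀ := Ψ ε u₀)
    (s := fun t => (2 * α)⁻¹ * ‖N ε (τ (u t))‖ ^ 2)
    (R := fun t => α⁻¹ * (D₂ * backAvg ε G' t + ‖h t‖ ^ 2 / 2)) hε hT
    (fun s t hst => mul_le_mul_of_nonneg_left (hΓm hst) hD) ?_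
    (fun t ht => mul_le_mul_of_nonneg_left (hΓm ht) hD) ?_ (fun t => hN.nonneg ε hε _)
    (fun t ht => by rw [withPast_nonpos ht]) hZi (fun t => by positivity) ?_
    ((intervalIntegrable_norm_sq hT.le hξ).const_mul _)
    (((hBi.const_mul D₂).add ((intervalIntegrable_norm_sq hT.le hh).div_const 2)).const_mul _) ?_
  · have h1 : ∫ t in (0 : ℝ)..T, (2 * α)⁻¹ * ‖N ε (τ (u t))‖ ^ 2 =
        (2 * α)⁻¹ * ∫ t, ‖N ε (τ (u t))‖ ^ 2 ∂timeMeasure T := by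
      rw [intervalIntegral.integral_const_mul, integral_timeMeasure hT.le]
    have h2 : ∫ t in (0 : ℝ)..T, α⁻¹ * (D₂ * backAvg ε G' t + ‖h t‖ ^ 2 / 2) ≤
        α⁻¹ * (D₂ * (∫ t, G t ∂timeMeasure T) + (∫ t, ‖h t‖ ^ 2 ∂timeMeasure T) / 2) := by
      rw [intervalIntegral.integral_const_mul, intervalIntegral.integral_add (hBi.const_mul D₂)
        ((intervalIntegrable_norm_sq hT.le hh).div_const 2), intervalIntegral.integral_const_mul,
        intervalIntegral.integral_div, ← integral_timeMeasure hT.le (fun t => ‖h t‖ ^ 2)]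
      gcongr
    have h3 : 0 ≤ ε⁻¹ * ∫ t in (T - ε)..T, Ψ ε (withPast J u₀ u t) :=
      mul_nonneg (inv_nonneg.2 hε.le) (intervalIntegral.integral_nonneg (by linarith)
        fun x _ => hN.nonneg ε hε _)
    have h4 := hM₀ ε hε
    rw [h1] at hgr
    have h5 : (2 * α)⁻¹ * ∫ t, ‖N ε (τ (u t))‖ ^ 2 ∂timeMeasure T ≤
        Real.exp (2 * (D₁ / α * Γ T)) * (M₀ + (α⁻¹ * (D₂ * (∫ t, G t ∂timeMeasure T) +
          (∫ t, ‖h t‖ ^ 2 ∂timeMeasure T) / 2))) := by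
      refine le_trans (by linarith) (hgr.trans ?_)
      gcongr
    rwa [inv_mul_le_iff₀ (by positivity)] at h5
  · intro t _
    refine mul_nonneg hD ?_
    rcases le_or_gt t 0 with h | h
    · rw [hΓ0 t h]
    · rw [← hΓ0 0 le_rfl]; exact hΓm h.le
  · intro t ht
    rw [← mul_sub, hΓd]
    calc D₁ / α * ∫ x in (t - ε)..t, G' x ≤ D₁ / α * (2 * (D₁ / α + 1))⁻¹ := by
          gcongr; exact hε1 t ht
      _ ≤ 1 / 2 := by
          rw [← div_eq_mul_inv, div_le_div_iff₀ (by positivity) (by positivity)]; linarith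
  · intro t
    have := hB0 t
    positivity
  · refine ae_of_all _ fun t hm => ?_
    have hpos := hp3 (u t) (withPast J u₀ u (t - ε))
    have h1 := congrArg (fun y => ⟪y, p (u t)⟫_ℝ) (heq t hm)
    simp only [inner_sub_left, inner_add_left, real_inner_smul_left,
      ContinuousLinearMap.adjoint_inner_left] at h1
    rw [hp1, real_inner_self_eq_norm_sq, ← inner_sub_left, withPast_pos hm.1] at h1
    rw [withPast_pos hm.1]
    have h2 : ⟪backAvg ε g' t, J (p (u t))⟫_ℝ ≤ backAvg ε G' t * q (J (p (u t))) := by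
      rw [backAvg, backAvg, real_inner_smul_left, smul_eq_mul, mul_assoc]
      refine mul_le_mul_of_nonneg_left ?_ (inv_nonneg.2 hε.le)
      rw [← intervalIntegral.integral_mul_const, real_inner_comm,
        ← innerSL_apply_apply ℝ, ← ContinuousLinearMap.intervalIntegral_comp_comm _
          hgi.intervalIntegrable]
      refine intervalIntegral.integral_mono_ae (by linarith)
        ((innerSL ℝ (J (p (u t)))).integrable_comp hgi).intervalIntegrable
        ((hii _ _).mul_const _) ?_
      filter_upwards [hgG'] with s hs
      rw [innerSL_apply_apply, real_inner_comm]
      exact hs _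
    have h3 : backAvg ε G' t * q (J (p (u t))) ≤ backAvg ε G' t * (D₁ * Ψ ε (J (u t)) + D₂) :=
      mul_le_mul_of_nonneg_left (hp4 _) (hB0 t)
    have h4 : ⟪h t, N ε (τ (u t))⟫_ℝ ≤ ‖h t‖ ^ 2 / 2 + ‖N ε (τ (u t))‖ ^ 2 / 2 := by
      have := real_inner_le_norm (h t) (N ε (τ (u t)))
      nlinarith [sq_nonneg (‖h t‖ - ‖N ε (τ (u t))‖)]
    have h5 : Γ t - Γ (t - ε) = ε * backAvg ε G' t := by
      rw [hΓd, backAvg, smul_eq_mul, mul_inv_cancel_left₀ hε.ne']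
    have h6 := hp2 (u t)
    rw [← mul_sub, h5]
    -- the tested equation, multiplied by `ε / α`
    have h7 : ⟪J (u t) - withPast J u₀ u (t - ε), J (p (u t))⟫_ℝ =
        ε / α * (⟪backAvg ε g' t, J (p (u t))⟫_ℝ + ⟪h t, N ε (τ (u t))⟫_ℝ - ⟪D (u t), D (p (u t))⟫_ℝ
          - ‖N ε (τ (u t))‖ ^ 2) := by
      rw [← h1]; field_simp
    have h8 : ⟪J (u t) - withPast J u₀ u (t - ε), J (p (u t))⟫_ℝ ≤
        ε / α * (backAvg ε G' t * (D₁ * Ψ ε (J (u t)) + D₂) + ‖h t‖ ^ 2 / 2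
          - ‖N ε (τ (u t))‖ ^ 2 / 2) := by
      rw [h7]
      refine mul_le_mul_of_nonneg_left ?_ (by positivity)
      linarith
    have e1 : ε * ((2 * α)⁻¹ * ‖N ε (τ (u t))‖ ^ 2) = ε / α * (‖N ε (τ (u t))‖ ^ 2 / 2) := by
      field_simp
    have e2 : D₁ / α * (ε * backAvg ε G' t) * Ψ ε (J (u t)) +
        ε * (α⁻¹ * (D₂ * backAvg ε G' t + ‖h t‖ ^ 2 / 2)) =
        ε / α * (backAvg ε G' t * (D₁ * Ψ ε (J (u t)) + D₂) + ‖h t‖ ^ 2 / 2) := by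
      ring
    rw [e1]
    linarith

end Apriori

/-! ### Weak convergence and the bound of the solution -/

section WeakL2

variable {S : Type*} [MeasurableSpace S] {μ : Measure S}
  {E : Type*} [NormedAddCommGroup E] [InnerProductSpace ℝ E]

theorem integrable_inner_of_memLp {x y : S → E} (hx : MemLp x 2 μ) (hy : MemLp y 2 μ) :
    Integrable (fun t => ⟪x t, y t⟫_ℝ) μ := by
  refine (L2.integrable_inner (𝕜 := ℝ) (hx.toLp x) (hy.toLp y)).congr ?_
  filter_upwards [hx.coeFn_toLp, hy.coeFn_toLp] with t h1 h2
  rw [h1, h2]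

theorem inner_toLp {x y : S → E} (hx : MemLp x 2 μ) (hy : MemLp y 2 μ) :
    ⟪hx.toLp x, hy.toLp y⟫_ℝ = ∫ t, ⟪x t, y t⟫_ℝ ∂μ := by
  rw [L2.inner_def]
  refine integral_congr_ae ?_
  filter_upwards [hx.coeFn_toLp, hy.coeFn_toLp] with t h1 h2
  rw [h1, h2]

theorem norm_toLp_sq {x : S → E} (hx : MemLp x 2 μ) :
    ‖hx.toLp x‖ ^ 2 = ∫ t, ‖x t‖ ^ 2 ∂μ := by
  rw [← real_inner_self_eq_norm_sq, inner_toLp]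
  simp_rw [real_inner_self_eq_norm_sq]

theorem abs_integral_inner_le {x y : S → E} (hx : MemLp x 2 μ) (hy : MemLp y 2 μ) :
    |∫ t, ⟪x t, y t⟫_ℝ ∂μ| ≤ √(∫ t, ‖x t‖ ^ 2 ∂μ) * √(∫ t, ‖y t‖ ^ 2 ∂μ) := by
  rw [← inner_toLp hx hy, ← norm_toLp_sq hx, ← norm_toLp_sq hy, Real.sqrt_sq (norm_nonneg _),
    Real.sqrt_sq (norm_nonneg _)]
  exact abs_real_inner_le_norm _ _

theorem exists_weak_limit_L2 [CompleteSpace E] (l : Ultrafilter ℕ) {x : ℕ → S → E}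
    (hx : ∀ k, MemLp (x k) 2 μ) {C : ℝ} (hC : ∀ k, ∫ t, ‖x k t‖ ^ 2 ∂μ ≤ C) :
    ∃ p, MemLp p 2 μ ∧ ∀ z, MemLp z 2 μ →
      Tendsto (fun k => ∫ t, ⟪x k t, z t⟫_ℝ ∂μ) l (𝓝 (∫ t, ⟪p t, z t⟫_ℝ ∂μ)) := by
  obtain ⟨p, hp⟩ := exists_weak_limit l (fun k => (hx k).toLp (x k)) (√C) fun k =>
    Real.le_sqrt_of_sq_le (by rw [norm_toLp_sq]; exact hC k)
  refine ⟨p, Lp.memLp p, fun z hz => ?_⟩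
  have h := hp (hz.toLp z)
  simp_rw [inner_toLp] at h
  convert h using 2
  rw [← inner_toLp (Lp.memLp p) hz, Lp.toLp_coeFn]

/-- Pairings of a weakly with a strongly convergent sequence converge. -/
theorem tendsto_integral_inner_of_weak_strong {l : Filter ℕ} {x : ℕ → S → E} {p : S → E}
    (hx : ∀ k, MemLp (x k) 2 μ) {C : ℝ} (hC : ∀ k, ∫ t, ‖x k t‖ ^ 2 ∂μ ≤ C)
    (hw : ∀ z, MemLp z 2 μ →
      Tendsto (fun k => ∫ t, ⟪x k t, z t⟫_ℝ ∂μ) l (𝓝 (∫ t, ⟪p t, z t⟫_ℝ ∂μ)))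
    {z : ℕ → S → E} {y : S → E} (hz : ∀ k, MemLp (z k) 2 μ) (hy : MemLp y 2 μ)
    (hzy : Tendsto (fun k => ∫ t, ‖z k t - y t‖ ^ 2 ∂μ) l (𝓝 0)) :
    Tendsto (fun k => ∫ t, ⟪x k t, z k t⟫_ℝ ∂μ) l (𝓝 (∫ t, ⟪p t, y t⟫_ℝ ∂μ)) := by
  have h1 : Tendsto (fun k => ∫ t, ⟪x k t, z k t - y t⟫_ℝ ∂μ) l (𝓝 0) := by
    have h2 : Tendsto (fun k => √C * √(∫ t, ‖z k t - y t‖ ^ 2 ∂μ)) l (𝓝 0) := by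
      simpa using (hzy.sqrt).const_mul √C
    refine squeeze_zero_norm (fun k => ?_) h2
    exact (abs_integral_inner_le (hx k) ((hz k).sub hy)).trans
      (mul_le_mul_of_nonneg_right (Real.sqrt_le_sqrt (hC k)) (Real.sqrt_nonneg _))
  have h3 := (hw y hy).add h1
  rw [add_zero] at h3
  refine h3.congr fun k => ?_
  have h4 : MemLp (fun t => z k t - y t) 2 μ := (hz k).sub hy
  rw [← integral_add (integrable_inner_of_memLp (hx k) hy) (integrable_inner_of_memLp (hx k) h4)]
  refine integral_congr_ae (ae_of_all _ fun t => ?_)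
  simp only [inner_sub_right]
  ring

end WeakL2

section Existence

variable {V H K X : Type*}
  [NormedAddCommGroup V] [InnerProductSpace ℝ V] [CompleteSpace V]
  [NormedAddCommGroup H] [InnerProductSpace ℝ H] [CompleteSpace H]
  [NormedAddCommGroup K] [InnerProductSpace ℝ K] [CompleteSpace K]
  [NormedAddCommGroup X] [InnerProductSpace ℝ X] [CompleteSpace X]
  {J : V →L[ℝ] H} {D : V →L[ℝ] K} {τ : V →L[ℝ] X} {N : ℝ → X → X} {Ψ : ℝ → H → ℝ}
  {q : H → ℝ} {D₁ D₂ : ℝ}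

/-- The solutions of the regularized delay equations are bounded in `L²(0,T;V)`. -/
theorem exists_bound_solution (hJD : ∀ u, ‖u‖ ^ 2 = ‖J u‖ ^ 2 + ‖D u‖ ^ 2)
    (hN : IsYosidaFamily J D τ N Ψ q D₁ D₂)
    {α T : ℝ} (hα : 0 < α) (hT : 0 < T) {u₀ : H}
    {g : ℝ → H} (hg : MemLp g 2 (timeMeasure T)) {h : ℝ → X} (hh : MemLp h 2 (timeMeasure T)) :
    ∃ C, ∀ᶠ ε in 𝓝[>] (0 : ℝ), ∀ u : ℝ → V, MemLp u 2 (timeMeasure T) →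
      (∀ t ∈ Ioo 0 T, (α / ε) • (J†) (withPast J u₀ u t - withPast J u₀ u (t - ε)) =
        ((J†) (backAvg ε ((Ioo 0 T).indicator g) t) + (τ†) (h t)) -
          (D†) (D (u t)) - (τ†) (N ε (τ (u t)))) →
      ∫ t, ‖u t‖ ^ 2 ∂timeMeasure T ≤ C := by
  obtain ⟨hρL, hρ0⟩ := backAvg_indicator_sub hg
  set g' := (Ioo 0 T).indicator g with hg'
  set A : ℝ := 3 * (1 + (∫ t, ‖g t‖ ^ 2 ∂timeMeasure T) +
    ∫ t, (‖τ‖ * ‖h t‖) ^ 2 ∂timeMeasure T) with hA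
  refine ⟨α * (Real.exp (2 * (2 / α * (T + 1))) * (‖u₀‖ ^ 2 + α⁻¹ * A)), ?_⟩
  have hpos : (0 : ℝ) < min 1 (α / 4) := by positivity
  filter_upwards [hρL, hρ0.eventually (gt_mem_nhds one_pos), Ioo_mem_nhdsGT hpos]
    with ε hL hρ1 hε u hu heq
  have hε1 : ε ≤ 1 := hε.2.le.trans (min_le_left _ _)
  have hεα : ε ≤ α / 4 := hε.2.le.trans (min_le_right _ _)
  have hLT : MemLp (fun t => backAvg ε g' t - g' t) 2 (timeMeasure T) := hL.restrict _
  have hτh : MemLp (fun t => ‖τ‖ * ‖h t‖) 2 (timeMeasure T) := hh.norm.const_mul _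
  let a : ℝ → ℝ := fun t => ‖backAvg ε g' t - g' t‖ + ‖g t‖ + ‖τ‖ * ‖h t‖
  have ha : MemLp a 2 (timeMeasure T) := (hLT.norm.add hg.norm).add hτh
  have h1 := energy_bound_of_backward_difference (w₀ := u₀) hJD hα hT hε.1 hε1 hεα hu ha ?_
  · have h2 : ∫ t in (0 : ℝ)..T, α⁻¹ * a t ^ 2 ≤ α⁻¹ * A := by
      rw [intervalIntegral.integral_const_mul, ← integral_timeMeasure hT.le]
      refine mul_le_mul_of_nonneg_left ?_ (inv_nonneg.2 hα.le)
      calc _ ≤ ∫ t, 3 * (‖backAvg ε g' t - g' t‖ ^ 2 + ‖g t‖ ^ 2 + (‖τ‖ * ‖h t‖) ^ 2)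
            ∂timeMeasure T := by
            refine integral_mono ha.integrable_sq (((hLT.norm.integrable_sq.add
              hg.norm.integrable_sq).add hτh.integrable_sq).const_mul 3) fun t => ?_
            simp only [a]
            set x := ‖backAvg ε g' t - g' t‖
            set y := ‖g t‖
            set z := ‖τ‖ * ‖h t‖
            nlinarith [sq_nonneg (x - y), sq_nonneg (y - z), sq_nonneg (x - z)]
        _ = 3 * ((∫ t, ‖backAvg ε g' t - g' t‖ ^ 2 ∂timeMeasure T) +
            (∫ t, ‖g t‖ ^ 2 ∂timeMeasure T) + ∫ t, (‖τ‖ * ‖h t‖) ^ 2 ∂timeMeasure T) := by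
            have h3 : Integrable (fun t => ‖backAvg ε g' t - g' t‖ ^ 2 + ‖g t‖ ^ 2)
              (timeMeasure T) := hLT.norm.integrable_sq.add hg.norm.integrable_sq
            rw [integral_const_mul, integral_add h3 hτh.integrable_sq,
              integral_add hLT.norm.integrable_sq hg.norm.integrable_sq]
        _ ≤ _ := by
            have : ∫ t, ‖backAvg ε g' t - g' t‖ ^ 2 ∂timeMeasure T ≤ 1 :=
              (integral_mono_measure Measure.restrict_le_self
                (ae_of_all _ fun t => sq_nonneg _) hL.norm.integrable_sq).trans hρ1.le
            rw [hA]
            gcongr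
    have h3 : 0 ≤ ε⁻¹ * (∫ t in (T - ε)..T, ‖withPast J u₀ u t‖ ^ 2) :=
      mul_nonneg (inv_nonneg.2 hε.1.le) (intervalIntegral.integral_nonneg
        (by linarith [hε.1]) fun t _ => by positivity)
    rw [intervalIntegral.integral_const_mul, ← integral_timeMeasure hT.le] at h1
    rw [← inv_mul_le_iff₀ hα]
    refine le_trans (by linarith) (h1.trans ?_)
    gcongr
  · refine ae_of_all _ fun t hm => ?_
    have h1 := congrArg (fun y => ⟪y, u t⟫_ℝ) (heq t hm)
    simp only [inner_sub_left, inner_add_left, real_inner_smul_left,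
      ContinuousLinearMap.adjoint_inner_left] at h1
    rw [real_inner_self_eq_norm_sq, ← inner_sub_left] at h1
    have e : ∀ y : ℝ, α * y = ε * (α / ε * y) := fun y => by
      have := hε.1.ne'
      field_simp
    rw [e, h1]
    refine mul_le_mul_of_nonneg_left ?_ hε.1.le
    have hm0 : 0 ≤ ⟪N ε (τ (u t)), τ (u t)⟫_ℝ := by
      have := hN.cocoercive hε.1 (τ (u t)) 0
      rw [hN.map_zero ε hε.1, sub_zero, sub_zero] at this
      have h0 := hε.1
      exact le_trans (by positivity) this
    have h2 : ⟪backAvg ε g' t, J (u t)⟫_ℝ ≤ (‖backAvg ε g' t - g' t‖ + ‖g t‖) * ‖u t‖ := by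
      refine (real_inner_le_norm _ _).trans ?_
      gcongr
      · calc ‖backAvg ε g' t‖ = ‖(backAvg ε g' t - g' t) + g' t‖ := by rw [sub_add_cancel]
          _ ≤ ‖backAvg ε g' t - g' t‖ + ‖g' t‖ := norm_add_le _ _
          _ = _ := by rw [hg', indicator_of_mem hm]
      · exact norm_le_of_norm_sq_eq_add hJD _
    have h3 : ⟪h t, τ (u t)⟫_ℝ ≤ ‖τ‖ * ‖h t‖ * ‖u t‖ := by
      refine (real_inner_le_norm _ _).trans ?_
      calc _ ≤ ‖h t‖ * (‖τ‖ * ‖u t‖) := by gcongr; exact τ.le_opNorm _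
        _ = _ := by ring
    simp only [a]
    linarith

end Existence

theorem memLp_smul_const {E : Type*} [NormedAddCommGroup E] [NormedSpace ℝ E] {T : ℝ} {φ : ℝ → ℝ}
    (hφ : Continuous φ) (w : E) : MemLp (fun t => φ t • w) 2 (timeMeasure T) := by
  obtain ⟨M, hM⟩ := isCompact_Icc.exists_bound_of_continuousOn (s := Icc 0 T) hφ.continuousOn
  refine MemLp.of_bound (hφ.smul continuous_const).aestronglyMeasurable (M * ‖w‖) ?_
  filter_upwards [ae_restrict_mem measurableSet_Ioo] with t ht
  rw [norm_smul]
  gcongr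
  exact hM t (Ioo_subset_Icc_self ht)

/-! ### The time derivative in the limit of vanishing delay -/

/-- Discrete integration by parts, for a function `m` which is constant before time `0`. -/
theorem integral_mul_sub_delay {T ε m₀ : ℝ} (hT : 0 < T) (hε : 0 < ε) {m φ : ℝ → ℝ}
    (hm₀ : ∀ t ≤ 0, m t = m₀) (hm : IntervalIntegrable m volume 0 T) (hφ : Continuous φ)
    (hφT : ∀ t, T ≤ t → φ t = 0) :
    ∫ t in (0 : ℝ)..T, φ t * (m t - m (t - ε)) =
      (∫ t in (0 : ℝ)..T, (φ t - φ (t + ε)) * m t) - m₀ * ∫ t in (0 : ℝ)..ε, φ t := by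
  have hmp : IntervalIntegrable m volume (-ε) 0 := by
    refine (intervalIntegrable_const (c := m₀)).congr fun t ht => ?_
    rw [uIoc_of_le (by linarith)] at ht
    exact (hm₀ t ht.2).symm
  have hmm : ∀ a b, -ε ≤ a → a ≤ b → b ≤ T → IntervalIntegrable m volume a b := by
    intro a b ha hab hb
    exact (hmp.trans hm).mono_set (by
      rw [uIcc_of_le hab, uIcc_of_le (by linarith)]; exact Icc_subset_Icc ha hb)
  have hφs : Continuous fun t => φ (t + ε) := hφ.comp (continuous_id.add continuous_const)
  have hψ : ∀ a b, -ε ≤ a → a ≤ b → b ≤ T →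
      IntervalIntegrable (fun t => φ (t + ε) * m t) volume a b := fun a b ha hab hb =>
    (hmm a b ha hab hb).continuousOn_mul hφs.continuousOn
  have h1 : IntervalIntegrable (fun t => φ t * m t) volume 0 T := hm.continuousOn_mul hφ.continuousOn
  have h2 : IntervalIntegrable (fun t => φ t * m (t - ε)) volume 0 T := by
    have := (hψ (-ε) (T - ε) le_rfl (by linarith) (by linarith)).comp_sub_right ε
    simpa using this
  have e1 : ∫ t in (0 : ℝ)..T, φ t * m (t - ε) = ∫ t in (0 - ε)..(T - ε), φ (t + ε) * m t := by
    rw [← intervalIntegral.integral_comp_sub_right]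
    simp
  have e2 : (∫ t in (0 - ε)..(T - ε), φ (t + ε) * m t) + ∫ t in (T - ε)..T, φ (t + ε) * m t =
      (∫ t in (0 - ε)..0, φ (t + ε) * m t) + ∫ t in (0 : ℝ)..T, φ (t + ε) * m t := by
    rw [intervalIntegral.integral_add_adjacent_intervals
      (hψ _ _ (by linarith) (by linarith) (by linarith))
      (hψ _ _ (by linarith) (by linarith) (by linarith)),
      intervalIntegral.integral_add_adjacent_intervals
      (hψ _ _ (by linarith) (by linarith) (by linarith))
      (hψ _ _ (by linarith) (by linarith) (by linarith))]
  have e3 : ∫ t in (T - ε)..T, φ (t + ε) * m t = 0 := by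
    refine intervalIntegral.integral_zero_ae (ae_of_all _ fun t ht => ?_)
    rw [uIoc_of_le (by linarith)] at ht
    rw [hφT _ (by linarith [ht.1]), zero_mul]
  have e4 : ∫ t in (0 - ε)..0, φ (t + ε) * m t = m₀ * ∫ t in (0 : ℝ)..ε, φ t := by
    have : ∫ t in (0 - ε)..0, φ (t + ε) * m t = ∫ t in (0 - ε)..0, m₀ * φ (t + ε) := by
      refine intervalIntegral.integral_congr fun t ht => ?_
      rw [uIcc_of_le (by linarith)] at ht
      simp only [hm₀ t ht.2, mul_comm]
    rw [this, intervalIntegral.integral_const_mul, intervalIntegral.integral_comp_add_right]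
    simp
  have e5 : ∫ t in (0 : ℝ)..T, φ t * (m t - m (t - ε)) =
      (∫ t in (0 : ℝ)..T, φ t * m t) - ∫ t in (0 : ℝ)..T, φ t * m (t - ε) := by
    rw [← intervalIntegral.integral_sub h1 h2]
    simp_rw [mul_sub]
  have e6 : ∫ t in (0 : ℝ)..T, (φ t - φ (t + ε)) * m t =
      (∫ t in (0 : ℝ)..T, φ t * m t) - ∫ t in (0 : ℝ)..T, φ (t + ε) * m t := by
    rw [← intervalIntegral.integral_sub h1 (hψ _ _ (by linarith) (by linarith) (by linarith))]
    simp_rw [sub_mul]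
  rw [e5, e6]
  linarith

section Limit

variable {V H K X : Type*}
  [NormedAddCommGroup V] [InnerProductSpace ℝ V] [CompleteSpace V]
  [NormedAddCommGroup H] [InnerProductSpace ℝ H] [CompleteSpace H]
  [NormedAddCommGroup K] [InnerProductSpace ℝ K] [CompleteSpace K]
  [NormedAddCommGroup X] [InnerProductSpace ℝ X] [CompleteSpace X]
  {J : V →L[ℝ] H} {D : V →L[ℝ] K} {τ : V →L[ℝ] X} {N : ℝ → X → X} {Ψ : ℝ → H → ℝ}
  {q : H → ℝ} {D₁ D₂ : ℝ}

/-- The backward differences of weakly convergent functions converge to the weak derivative of the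
limit. As the test function `φ` need not vanish at time `0`, the limit also carries the initial
value `u₀`. -/
theorem tendsto_integral_backward_difference {T : ℝ} (hT : 0 < T) {l : Filter ℕ} {ε : ℕ → ℝ}
    (hε : ∀ k, 0 < ε k) (hε0 : Tendsto ε l (𝓝 0)) {u : ℕ → ℝ → V} {p : ℝ → V} {u₀ : H} {C : ℝ}
    (hu : ∀ k, MemLp (u k) 2 (timeMeasure T)) (hC : ∀ k, ∫ t, ‖u k t‖ ^ 2 ∂timeMeasure T ≤ C)
    (hw : ∀ z, MemLp z 2 (timeMeasure T) → Tendsto (fun k => ∫ t, ⟪u k t, z t⟫_ℝ ∂timeMeasure T) l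
      (𝓝 (∫ t, ⟪p t, z t⟫_ℝ ∂timeMeasure T))) {φ : ℝ → ℝ} (hφ : IsTestFunction (Ioo (-1) T) φ)
    (y : V) :
    Tendsto (fun k => (ε k)⁻¹ * ∫ t, φ t *
      ⟪withPast J u₀ (u k) t - withPast J u₀ (u k) (t - ε k), J y⟫_ℝ ∂timeMeasure T) l
      (𝓝 (-(∫ t, deriv φ t * ⟪J (p t), J y⟫_ℝ ∂timeMeasure T) - φ 0 * ⟪u₀, J y⟫_ℝ)) := by
  have hφc : Continuous φ := hφ.contDiff.continuous
  have hφT : ∀ t, T ≤ t → φ t = 0 := fun t ht =>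
    image_eq_zero_of_notMem_tsupport fun h => absurd (hφ.tsupport_subset h).2 (not_lt.2 ht)
  have hd1 : ContDiff ℝ 1 (deriv φ) :=
    ((contDiff_infty_iff_deriv.1 hφ.contDiff).2).of_le (by exact_mod_cast le_top)
  obtain ⟨L, hL⟩ := hd1.lipschitzWith_of_hasCompactSupport hφ.hasCompactSupport.deriv one_ne_zero
  have hTaylor : ∀ t e : ℝ, 0 < e → |e⁻¹ * (φ t - φ (t + e)) + deriv φ t| ≤ L * e := by
    intro t e he
    have hdiff : Differentiable ℝ φ := hφ.contDiff.differentiable (by simp)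
    obtain ⟨c, hc, hc'⟩ := exists_deriv_eq_slope φ (show t < t + e by linarith)
      hφc.continuousOn hdiff.differentiableOn
    have h1 : e⁻¹ * (φ t - φ (t + e)) = -deriv φ c := by
      rw [hc', add_sub_cancel_left]; field_simp; ring
    rw [h1]
    have h2 := hL.dist_le_mul t c
    rw [Real.dist_eq, Real.dist_eq] at h2
    calc |-deriv φ c + deriv φ t| = |deriv φ t - deriv φ c| := by congr 1; ring
      _ ≤ L * |t - c| := h2
      _ ≤ L * e := by
        gcongr
        rw [abs_le]; constructor <;> linarith [hc.1, hc.2]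
  set w : V := (J†) (J y) with hw'
  let z : ℕ → ℝ → V := fun k t => ((ε k)⁻¹ * (φ t - φ (t + ε k))) • w
  have hz : ∀ k, MemLp (z k) 2 (timeMeasure T) := fun k =>
    memLp_smul_const (continuous_const.mul (hφc.sub (hφc.comp (continuous_id.add continuous_const)))) _
  have hy : MemLp (fun t => (-deriv φ t) • w) 2 (timeMeasure T) := memLp_smul_const hd1.continuous.neg _
  have hzy : Tendsto (fun k => ∫ t, ‖z k t - (-deriv φ t) • w‖ ^ 2 ∂timeMeasure T) l (𝓝 0) := by
    have h1 : Tendsto (fun k => (L * ε k * ‖w‖) ^ 2 * T) l (𝓝 0) := by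
      have := (((hε0.const_mul (L : ℝ)).mul_const ‖w‖).pow 2).mul_const T
      simpa using this
    refine squeeze_zero (fun k => integral_nonneg fun t => sq_nonneg _) (fun k => ?_) h1
    calc _ ≤ ∫ t, (L * ε k * ‖w‖) ^ 2 ∂timeMeasure T := by
          refine integral_mono ((hz k).sub hy).norm.integrable_sq (integrable_const _) fun t => ?_
          simp only [z]
          rw [← sub_smul, norm_smul, sub_neg_eq_add]
          gcongr
          exact hTaylor t _ (hε k)
      _ = _ := by
          rw [integral_const, smul_eq_mul, mul_comm]
          simp [timeMeasure, Measure.real, hT.le]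
  have h1 := tendsto_integral_inner_of_weak_strong hu hC hw hz hy hzy
  have h2 : Tendsto (fun k => (ε k)⁻¹ * ∫ t in (0 : ℝ)..(ε k), φ t) l (𝓝 (φ 0)) := by
    have h3 : HasDerivAt (fun x => ∫ t in (0 : ℝ)..x, φ t) (φ 0) 0 :=
      intervalIntegral.integral_hasDerivAt_right (hφc.intervalIntegrable _ _)
        (hφc.stronglyMeasurableAtFilter _ _) hφc.continuousAt
    have h4 := h3.tendsto_slope_zero_right
    have h5 : Tendsto ε l (𝓝[>] 0) :=
      tendsto_nhdsWithin_iff.2 ⟨hε0, Eventually.of_forall hε⟩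
    simpa [Function.comp_def] using h4.comp h5
  have h6 := h1.sub (h2.const_mul ⟪u₀, J y⟫_ℝ)
  have e1 : ∫ t, ⟪p t, (-deriv φ t) • w⟫_ℝ ∂timeMeasure T =
      -(∫ t, deriv φ t * ⟪J (p t), J y⟫_ℝ ∂timeMeasure T) := by
    rw [← integral_neg]
    congr 1; ext t
    rw [inner_smul_right, hw', ContinuousLinearMap.adjoint_inner_right]; ring
  rw [e1, mul_comm ⟪u₀, J y⟫_ℝ (φ 0)] at h6
  refine h6.congr fun k => ?_
  have hJu : IntervalIntegrable (fun t => ⟪withPast J u₀ (u k) t, J y⟫_ℝ) volume 0 T := by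
    have h7 : Integrable (fun t => ⟪J (u k t), J y⟫_ℝ) (timeMeasure T) :=
      integrable_inner_of_memLp (J.comp_memLp' (hu k)) (memLp_const _)
    refine (intervalIntegrable_of_integrable hT.le h7).congr fun t ht => ?_
    rw [uIoc_of_le hT.le] at ht
    simp [withPast_pos ht.1]
  have h8 := integral_mul_sub_delay (m₀ := ⟪u₀, J y⟫_ℝ) hT (hε k)
    (fun t ht => by rw [withPast_nonpos ht]) hJu hφc hφT
  simp_rw [inner_sub_left]
  rw [integral_timeMeasure hT.le (fun t => φ t * _), h8, mul_sub,
    integral_timeMeasure hT.le (fun t => ⟪u k t, z k t⟫_ℝ)]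
  congr 1
  · rw [← intervalIntegral.integral_const_mul]
    refine intervalIntegral.integral_congr_ae (ae_of_all _ fun t ht => ?_)
    rw [uIoc_of_le hT.le] at ht
    simp only [z]
    rw [inner_smul_right, hw', ContinuousLinearMap.adjoint_inner_right, withPast_pos ht.1]; ring
  · ring

/-- The weak form of the evolution equation, with test functions that need not vanish at time `0`,
implies its integrated form. -/
theorem integrated_equation_of_weak {α T : ℝ} (hT : 0 < T) {u r : ℝ → V} {u₀ : H}
    (hu : MemLp u 2 (timeMeasure T)) (hr : MemLp r 2 (timeMeasure T))
    (hweak : ∀ φ, IsTestFunction (Ioo (-1) T) φ → ∀ y,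
      α * (-(∫ t, deriv φ t * ⟪J (u t), J y⟫_ℝ ∂timeMeasure T) - φ 0 * ⟪u₀, J y⟫_ℝ) =
        ∫ t, φ t * ⟪r t, y⟫_ℝ ∂timeMeasure T) :
    ∀ᵐ t ∂timeMeasure T, α • (J†) (J (u t)) = α • (J†) u₀ + ∫ s in (0 : ℝ)..t, r s := by
  set r' := (Ioo 0 T).indicator r with hr'
  have hri : Integrable r' := (integrable_indicator_iff measurableSet_Ioo).2
    (hr.integrable (by norm_num))
  have hprim : ∀ t, ∫ s in (-1 : ℝ)..t, r' s = ∫ s in (0 : ℝ)..t, r' s := by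
    intro t
    rw [← intervalIntegral.integral_add_adjacent_intervals (b := 0) hri.intervalIntegrable
      hri.intervalIntegrable, add_eq_right]
    refine intervalIntegral.integral_zero_ae (ae_of_all _ fun x hx => ?_)
    rw [uIoc_of_le (by norm_num)] at hx
    exact indicator_of_notMem (fun hx' : x ∈ Ioo 0 T => absurd hx'.1 (not_lt.2 hx.2)) _
  let A : ℝ → V := fun t => α • (J†) (withPast J u₀ u t)
  have hJu : IntegrableOn (fun t => J (u t)) (Ioo 0 T) :=
    (J.comp_memLp' hu).integrable (by norm_num)
  have hUi : IntegrableOn (withPast J u₀ u) (Ioo (-1) T) := by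
    have h1 : IntegrableOn (withPast J u₀ u) (Ioc (-1) 0) :=
      (integrableOn_const (by simp) : IntegrableOn (fun _ => u₀) _ _).congr_fun
        (fun t ht => (withPast_nonpos ht.2).symm) measurableSet_Ioc
    have h2 : IntegrableOn (withPast J u₀ u) (Ioo 0 T) :=
      hJu.congr_fun (fun t ht => (withPast_pos ht.1).symm) measurableSet_Ioo
    rw [← Ioc_union_Ioo_eq_Ioo (by norm_num : (-1 : ℝ) ≤ 0) hT]
    exact h1.union h2
  have hAi : IntegrableOn A (Ioo (-1) T) := ((J†).integrable_comp hUi).smul α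
  have hPc : Continuous fun t => ∫ s in (-1 : ℝ)..t, r' s :=
    intervalIntegral.continuous_primitive (fun a b => hri.intervalIntegrable) _
  have hPi : IntegrableOn (fun t => ∫ s in (-1 : ℝ)..t, r' s) (Ioo (-1) T) :=
    hPc.integrableOn_Icc.mono_set Ioo_subset_Icc_self
  obtain ⟨c, hc⟩ := ae_eq_const_of_integral_deriv_smul (a := -1) (b := T) (by linarith)
    (w := fun t => A t - ∫ s in (-1 : ℝ)..t, r' s) (hAi.sub hPi) (by
      intro φ hφ
      have hφc := hφ.contDiff.continuous
      have hφ1 : ContDiff ℝ 1 φ := hφ.contDiff.of_le (by exact_mod_cast le_top)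
      have hdc : Continuous (deriv φ) := hφ1.continuous_deriv le_rfl
      have hφT : φ T = 0 := image_eq_zero_of_notMem_tsupport fun h =>
        absurd (hφ.tsupport_subset h).2 (lt_irrefl _)
      have hφ' : φ (-1) = 0 := image_eq_zero_of_notMem_tsupport fun h =>
        absurd (hφ.tsupport_subset h).1 (lt_irrefl _)
      have hint : ∀ {w : ℝ → V} {ψ : ℝ → ℝ}, Continuous ψ → IntegrableOn w (Ioo (-1) T) →
          IntegrableOn (fun t => ψ t • w t) (Ioo (-1) T) := by
        intro w ψ hψ hw
        obtain ⟨M, hM⟩ := isCompact_Icc.exists_bound_of_continuousOn (s := Icc (-1) T)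
          hψ.continuousOn
        refine hw.bdd_smul M hψ.aestronglyMeasurable.restrict ?_
        filter_upwards [ae_restrict_mem measurableSet_Ioo] with t ht
        exact hM t (Ioo_subset_Icc_self ht)
      simp_rw [smul_sub]
      rw [integral_sub (hint hdc hAi) (hint hdc hPi),
        integral_deriv_smul_primitive hφ1 hφT hri.integrableOn, sub_neg_eq_add]
      refine ext_inner_right ℝ fun y => ?_
      rw [inner_zero_left, inner_add_left, real_inner_comm, ← integral_inner (hint hdc hAi),
        real_inner_comm, ← integral_inner (hint hφc hri.integrableOn)]
      have e1 : ∫ t in Ioo (-1) T, ⟪y, φ t • r' t⟫_ℝ = ∫ t, φ t * ⟪r t, y⟫_ℝ ∂timeMeasure T := by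
        have : ∀ t, ⟪y, φ t • r' t⟫_ℝ = (Ioo 0 T).indicator (fun t => φ t * ⟪r t, y⟫_ℝ) t := by
          intro t
          by_cases ht : t ∈ Ioo 0 T
          · rw [hr', indicator_of_mem ht, indicator_of_mem ht, inner_smul_right, real_inner_comm]
          · rw [hr', indicator_of_notMem ht, indicator_of_notMem ht, smul_zero, inner_zero_right]
        simp_rw [this]
        rw [setIntegral_indicator measurableSet_Ioo, inter_eq_self_of_subset_right
          (Ioo_subset_Ioo_left (by norm_num))]
        rfl
      have e2 : ∫ t in Ioo (-1) T, ⟪y, deriv φ t • A t⟫_ℝ =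
          α * ((∫ t, deriv φ t * ⟪J (u t), J y⟫_ℝ ∂timeMeasure T) + φ 0 * ⟪u₀, J y⟫_ℝ) := by
        have hi := (innerSL ℝ y).integrable_comp (hint hdc hAi)
        simp only [innerSL_apply_apply] at hi
        rw [← Ioc_union_Ioo_eq_Ioo (by norm_num : (-1 : ℝ) ≤ 0) hT] at hi ⊢
        rw [setIntegral_union (by
          rw [Set.disjoint_left]; intro t h1 h2; exact absurd h2.1 (not_lt.2 h1.2))
          measurableSet_Ioo (hi.mono_measure (Measure.restrict_mono subset_union_left le_rfl))
          (hi.mono_measure (Measure.restrict_mono subset_union_right le_rfl))]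
        have e3 : ∫ t in Ioc (-1) 0, ⟪y, deriv φ t • A t⟫_ℝ = α * (φ 0 * ⟪u₀, J y⟫_ℝ) := by
          have : ∀ t ∈ Ioc (-1 : ℝ) 0, ⟪y, deriv φ t • A t⟫_ℝ = deriv φ t * (α * ⟪u₀, J y⟫_ℝ) := by
            intro t ht
            simp only [A]
            rw [withPast_nonpos ht.2, inner_smul_right, inner_smul_right,
              ContinuousLinearMap.adjoint_inner_right, real_inner_comm]
          rw [setIntegral_congr_fun measurableSet_Ioc this, integral_mul_const,
            ← intervalIntegral.integral_of_le (by norm_num), intervalIntegral.integral_deriv_eq_sub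
            (fun x _ => (hφ1.differentiable one_ne_zero).differentiableAt)
            (hdc.intervalIntegrable _ _), hφ']
          ring
        have e4 : ∫ t in Ioo 0 T, ⟪y, deriv φ t • A t⟫_ℝ =
            α * ∫ t, deriv φ t * ⟪J (u t), J y⟫_ℝ ∂timeMeasure T := by
          rw [← integral_const_mul]
          refine setIntegral_congr_fun measurableSet_Ioo fun t ht => ?_
          simp only [A]
          rw [withPast_pos ht.1, inner_smul_right, inner_smul_right,
            ContinuousLinearMap.adjoint_inner_right, real_inner_comm]
          ring
        rw [e3, e4]; ring
      rw [e1, e2, ← hweak φ hφ y]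
      ring)
  have hc' := (ae_restrict_iff' measurableSet_Ioo).1 hc
  -- the constant is read off at negative times
  have hcval : c = α • (J†) u₀ := by
    have : (ae (volume.restrict (Ioo (-1 : ℝ) 0))).NeBot := by
      rw [ae_neBot, Ne, Measure.restrict_eq_zero]; simp
    obtain ⟨t, ht, hm⟩ := ((hc'.filter_mono (ae_mono Measure.restrict_le_self)).and
      (ae_restrict_mem (measurableSet_Ioo (a := (-1 : ℝ)) (b := 0)))).exists
      (f := ae (volume.restrict (Ioo (-1 : ℝ) 0)))
    have h1 := ht ⟨hm.1, by linarith [hm.2]⟩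
    rw [← h1, hprim]
    simp only [A]
    rw [withPast_nonpos hm.2.le, sub_eq_self]
    refine intervalIntegral.integral_zero_ae (ae_of_all _ fun x hx => ?_)
    rw [uIoc_of_ge hm.2.le] at hx
    exact indicator_of_notMem (fun hx' : x ∈ Ioo 0 T => absurd hx'.1 (not_lt.2 hx.2)) _
  refine (ae_restrict_iff' measurableSet_Ioo).2 ?_
  filter_upwards [hc'] with t ht hm
  have h1 := ht ⟨by linarith [hm.1], hm.2⟩
  rw [hcval, hprim, sub_eq_iff_eq_add] at h1
  simp only [A] at h1
  rw [withPast_pos hm.1] at h1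
  rw [h1]
  congr 1
  refine intervalIntegral.integral_congr_ae (ae_of_all _ fun x hx => ?_)
  rw [uIoc_of_le hm.1.le] at hx
  exact indicator_of_mem (show x ∈ Ioo 0 T from ⟨hx.1, hx.2.trans_lt hm.2⟩) _

end Limit

/-! ### Existence for the abstract evolution equation -/

theorem tendsto_integral_inner_zero {S : Type*} [MeasurableSpace S] {μ : Measure S}
    {E : Type*} [NormedAddCommGroup E] [InnerProductSpace ℝ E] {l : Filter ℕ} {x z : ℕ → S → E}
    (hx : ∀ k, MemLp (x k) 2 μ) (hz : ∀ k, MemLp (z k) 2 μ) {C : ℝ}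
    (hC : ∀ k, ∫ t, ‖z k t‖ ^ 2 ∂μ ≤ C)
    (hx0 : Tendsto (fun k => ∫ t, ‖x k t‖ ^ 2 ∂μ) l (𝓝 0)) :
    Tendsto (fun k => ∫ t, ⟪x k t, z k t⟫_ℝ ∂μ) l (𝓝 0) := by
  have h2 : Tendsto (fun k => √(∫ t, ‖x k t‖ ^ 2 ∂μ) * √C) l (𝓝 0) := by
    simpa using (hx0.sqrt).mul_const √C
  exact squeeze_zero_norm (fun k => (abs_integral_inner_le (hx k) (hz k)).trans
    (mul_le_mul_of_nonneg_left (Real.sqrt_le_sqrt (hC k)) (Real.sqrt_nonneg _))) h2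

section Delay

variable {V H : Type*} [NormedAddCommGroup V] [InnerProductSpace ℝ V]
  [NormedAddCommGroup H] [InnerProductSpace ℝ H] {J : V →L[ℝ] H}

/-- A delay, with zero values before time `0`, does not increase the norm of `L²(0,T)`. -/
theorem integral_withPast_zero_sub_le {T ε : ℝ} (hε : 0 < ε) {w : ℝ → V}
    (hw : MemLp w 2 (timeMeasure T)) :
    ∫ t, ‖withPast J 0 w (t - ε)‖ ^ 2 ∂timeMeasure T ≤ ∫ t, ‖J (w t)‖ ^ 2 ∂timeMeasure T := by
  let F : ℝ → ℝ := (Ioo 0 T).indicator fun t => ‖J (w t)‖ ^ 2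
  have hF : Integrable F := (integrable_indicator_iff measurableSet_Ioo).2
    (J.comp_memLp' hw).norm.integrable_sq
  have hF0 : ∀ t, 0 ≤ F t := fun t => indicator_nonneg (fun _ _ => sq_nonneg _) t
  calc _ = ∫ t, F (t - ε) ∂timeMeasure T := by
        refine setIntegral_congr_fun measurableSet_Ioo fun t ht => ?_
        rcases le_or_gt (t - ε) 0 with h | h
        · have h3 : t - ε ∉ Ioo 0 T := fun h' => absurd h'.1 h.not_gt
          simp [F, withPast_nonpos h, indicator_of_notMem h3]
        · have h3 : t - ε ∈ Ioo 0 T := ⟨h, by linarith [ht.2]⟩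
          simp only [F]
          rw [withPast_pos h, indicator_of_mem h3]
    _ ≤ ∫ t, F (t - ε) := setIntegral_le_integral (hF.comp_sub_right ε) (ae_of_all _ fun t => hF0 _)
    _ = ∫ t, F t := integral_sub_right_eq_self F ε
    _ = _ := integral_indicator measurableSet_Ioo

end Delay

section AbstractExistence

variable {V H K X : Type*}
  [NormedAddCommGroup V] [InnerProductSpace ℝ V] [CompleteSpace V]
  [NormedAddCommGroup H] [InnerProductSpace ℝ H] [CompleteSpace H]
  [NormedAddCommGroup K] [InnerProductSpace ℝ K] [CompleteSpace K]
  [NormedAddCommGroup X] [InnerProductSpace ℝ X] [CompleteSpace X]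
  {J : V →L[ℝ] H} {D : V →L[ℝ] K} {τ : V →L[ℝ] X} {N : ℝ → X → X} {Ψ : ℝ → H → ℝ}
  {q : H → ℝ} {D₁ D₂ : ℝ}

/-- Existence for the abstract evolution equation `α (J† J u)' + D† D u + τ† ξ = J† g + τ† h` with
`ξ` in the maximal monotone operator at `τ u`. The last clause expresses this inclusion through the
resolvent: it says that `ξ` is the Yosida approximation with parameter `1` at `τ u + ξ`. The
solutions of the delay equations, with the step `ε` also as the parameter of the Yosida
approximation, are bounded and converge weakly along an ultrafilter; the inclusion is recovered by
Minty's argument. The functional `q` stands for the norm of `L¹(Ω)` and `G` for the norm of `g` in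
`L^∞(Ω)`. -/
theorem exists_evolution_solution (hJD : ∀ u, ‖u‖ ^ 2 = ‖J u‖ ^ 2 + ‖D u‖ ^ 2)
    (hN : IsYosidaFamily J D τ N Ψ q D₁ D₂) (hD₁ : 0 ≤ D₁) (hD₂ : 0 ≤ D₂)
    {α T : ℝ} (hα : 0 < α) (hT : 0 < T) {u₀ : H} {M₀ : ℝ} (hM₀ : ∀ l > 0, Ψ l u₀ ≤ M₀)
    {g : ℝ → H} (hg : MemLp g 2 (timeMeasure T)) {h : ℝ → X} (hh : MemLp h 2 (timeMeasure T))
    {G : ℝ → ℝ} (hG : Integrable G (timeMeasure T)) (hG0 : ∀ t, 0 ≤ G t)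
    (hgG : ∀ᵐ t ∂timeMeasure T, ∀ z, ⟪g t, z⟫_ℝ ≤ G t * q z) :
    ∃ (u : ℝ → V) (ξ : ℝ → X), MemLp u 2 (timeMeasure T) ∧ MemLp ξ 2 (timeMeasure T) ∧
      (∀ᵐ t ∂timeMeasure T, α • (J†) (J (u t)) = α • (J†) u₀ + ∫ s in (0 : ℝ)..t,
        ((J†) (g s) + (τ†) (h s) - (D†) (D (u s)) - (τ†) (ξ s))) ∧
      ∀ᵐ t ∂timeMeasure T, ξ t = N 1 (τ (u t) + ξ t) := by
  set μ := timeMeasure T with hμ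
  obtain ⟨C₁, hC₁⟩ := exists_bound_solution (u₀ := u₀) hJD hN hα hT hg hh
  obtain ⟨C₂, hC₂⟩ := exists_bound_boundary_term hN hD₁ hD₂ hα hT hM₀ hg hh hG hG0 hgG
  obtain ⟨hψL, hψ0⟩ := backAvg_indicator_sub hg
  obtain ⟨ε, hεt, hε⟩ := exists_seq_forall_of_frequently
    ((hC₁.and (hC₂.and (hψL.and (self_mem_nhdsWithin (a := (0 : ℝ)) (s := Ioi 0))))).frequently)
  set g' := (Ioo 0 T).indicator g with hg'
  have hεpos : ∀ k, 0 < ε k := fun k => (hε k).2.2.2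
  have hε0 : Tendsto ε atTop (𝓝 0) := hεt.mono_right nhdsWithin_le_nhds
  let ψ : ℕ → ℝ → H := fun k t => backAvg (ε k) g' t - g' t
  have hψm : ∀ k, MemLp (ψ k) 2 μ := fun k => (hε k).2.2.1.restrict _
  have hψ0' : Tendsto (fun k => ∫ t, ‖ψ k t‖ ^ 2 ∂μ) atTop (𝓝 0) :=
    squeeze_zero (fun k => integral_nonneg fun t => sq_nonneg _) (fun k =>
      integral_mono_measure Measure.restrict_le_self (ae_of_all _ fun t => sq_nonneg _)
        (hε k).2.2.1.norm.integrable_sq) (hψ0.comp hεt)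
  have hg'm : MemLp g' 2 μ := by
    have : MemLp g' 2 volume := (memLp_indicator_iff_restrict measurableSet_Ioo).2 hg
    exact this.restrict _
  have hex : ∀ k, ∃ u : ℝ → V, MemLp u 2 μ ∧ ∀ t ∈ Ioo 0 T,
      (α / ε k) • (J†) (withPast J u₀ u t - withPast J u₀ u (t - ε k)) =
        ((J†) (backAvg (ε k) g' t) + (τ†) (h t)) - (D†) (D (u t)) - (τ†) (N (ε k) (τ (u t))) := by
    intro k
    refine exists_delay_solution hJD (div_pos hα (hεpos k)) (hN.lipschitz (hεpos k))
      (hN.map_zero _ (hεpos k)) (fun x y => ?_) (hεpos k) u₀ ?_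
    · have := hN.cocoercive (hεpos k) x y
      have h0 := hεpos k
      exact le_trans (by positivity) this
    · refine MemLp.add ((J†).comp_memLp' ?_) ((τ†).comp_memLp' hh)
      refine ((hψm k).add hg'm).ae_eq (ae_of_all _ fun t => ?_)
      simp [ψ]
  choose u hum hueq using hex
  let ζ : ℕ → ℝ → X := fun k t => N (ε k) (τ (u k t))
  have hζm : ∀ k, MemLp (ζ k) 2 μ := fun k =>
    (hN.lipschitz (hεpos k)).comp_memLp (hN.map_zero _ (hεpos k)) (τ.comp_memLp' (hum k))
  have huC : ∀ k, ∫ t, ‖u k t‖ ^ 2 ∂μ ≤ C₁ := fun k => (hε k).1 _ (hum k) (hueq k)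
  have hζC : ∀ k, ∫ t, ‖ζ k t‖ ^ 2 ∂μ ≤ C₂ := fun k => (hε k).2.1 _ (hum k) (hueq k)
  let l : Ultrafilter ℕ := Filter.hyperfilter ℕ
  have hl : (l : Filter ℕ) ≤ atTop := Nat.hyperfilter_le_atTop
  obtain ⟨p, hpm, hp⟩ := exists_weak_limit_L2 l hum huC
  obtain ⟨ξ, hξm, hξ⟩ := exists_weak_limit_L2 l hζm hζC
  let r : ℝ → V := fun s => (J†) (g s) + (τ†) (h s) - (D†) (D (p s)) - (τ†) (ξ s)
  have hrm : MemLp r 2 μ := (((((J†).comp_memLp' hg).add ((τ†).comp_memLp' hh)).sub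
    ((D†).comp_memLp' (D.comp_memLp' hpm))).sub ((τ†).comp_memLp' hξm))
  have hem : ∀ k, MemLp (fun t => u k t - p t) 2 μ := fun k => (hum k).sub hpm
  have hfm : ∀ k, MemLp (fun t => ζ k t - ξ t) 2 μ := fun k => (hζm k).sub hξm
  have hp0 : ∀ z, MemLp z 2 μ → Tendsto (fun k => ∫ t, ⟪u k t - p t, z t⟫_ℝ ∂μ) l (𝓝 0) := by
    intro z hz
    have h1 := (hp z hz).sub_const (∫ t, ⟪p t, z t⟫_ℝ ∂μ)
    rw [sub_self] at h1
    refine h1.congr fun k => ?_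
    simp_rw [inner_sub_left]
    rw [integral_sub (integrable_inner_of_memLp (hum k) hz) (integrable_inner_of_memLp hpm hz)]
  have hξ0 : ∀ z, MemLp z 2 μ → Tendsto (fun k => ∫ t, ⟪ζ k t - ξ t, z t⟫_ℝ ∂μ) l (𝓝 0) := by
    intro z hz
    have h1 := (hξ z hz).sub_const (∫ t, ⟪ξ t, z t⟫_ℝ ∂μ)
    rw [sub_self] at h1
    refine h1.congr fun k => ?_
    simp_rw [inner_sub_left]
    rw [integral_sub (integrable_inner_of_memLp (hζm k) hz) (integrable_inner_of_memLp hξm hz)]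
  -- the equation for `u k`, tested with `z`
  have htest : ∀ k, ∀ t ∈ Ioo 0 T, ∀ z,
      α / ε k * ⟪withPast J u₀ (u k) t - withPast J u₀ (u k) (t - ε k), J z⟫_ℝ =
        ⟪r t, z⟫_ℝ + ⟪ψ k t, J z⟫_ℝ - ⟪u k t - p t, (D†) (D z)⟫_ℝ - ⟪ζ k t - ξ t, τ z⟫_ℝ := by
    intro k t ht z
    have h1 := congrArg (fun y => ⟪y, z⟫_ℝ) (hueq k t ht)
    beta_reduce at h1
    rw [real_inner_smul_left, ContinuousLinearMap.adjoint_inner_left] at h1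
    rw [h1]
    have h2 : ψ k t = backAvg (ε k) g' t - g t := by simp only [ψ, hg', indicator_of_mem ht]
    rw [h2]
    simp only [r, ζ, inner_sub_left, inner_add_left, ContinuousLinearMap.adjoint_inner_left,
      ContinuousLinearMap.adjoint_inner_right, map_sub]
    ring
  have heqn : ∀ᵐ t ∂μ, α • (J†) (J (p t)) = α • (J†) u₀ + ∫ s in (0 : ℝ)..t, r s := by
    refine integrated_equation_of_weak hT hpm hrm fun φ hφ y => ?_
    have hφc : Continuous φ := hφ.contDiff.continuous
    have h1 := (tendsto_integral_backward_difference (J := J) (u₀ := u₀) hT hεpos (hε0.mono_left hl)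
      hum huC hp hφ y).const_mul α
    have h2 : Tendsto (fun k => ((∫ t, ⟪r t, φ t • y⟫_ℝ ∂μ) + ∫ t, ⟪ψ k t, φ t • J y⟫_ℝ ∂μ) -
        (∫ t, ⟪u k t - p t, φ t • (D†) (D y)⟫_ℝ ∂μ) - ∫ t, ⟪ζ k t - ξ t, φ t • τ y⟫_ℝ ∂μ) l
        (𝓝 (∫ t, ⟪r t, φ t • y⟫_ℝ ∂μ)) := by
      have h3 := tendsto_integral_inner_zero hψm (fun _ => memLp_smul_const hφc (J y)) (fun _ => le_rfl) hψ0'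
      have h4 := ((tendsto_const_nhds (x := ∫ t, ⟪r t, φ t • y⟫_ℝ ∂μ)).add (h3.mono_left hl)).sub
        (hp0 _ (memLp_smul_const hφc ((D†) (D y)))) |>.sub (hξ0 _ (memLp_smul_const hφc (τ y)))
      simpa using h4
    have h5 := tendsto_nhds_unique h1 (h2.congr fun k => ?_)
    · rw [h5]
      refine integral_congr_ae (ae_of_all _ fun t => ?_)
      simp only
      rw [inner_smul_right]
    · have i1 := integrable_inner_of_memLp hrm (memLp_smul_const hφc y)
      have i2 := integrable_inner_of_memLp (hψm k) (memLp_smul_const hφc (J y))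
      have i12 : Integrable (fun t => ⟪r t, φ t • y⟫_ℝ + ⟪ψ k t, φ t • J y⟫_ℝ) μ := i1.add i2
      have i3 := integrable_inner_of_memLp (hem k) (memLp_smul_const hφc ((D†) (D y)))
      have i123 : Integrable (fun t => ⟪r t, φ t • y⟫_ℝ + ⟪ψ k t, φ t • J y⟫_ℝ -
          ⟪u k t - p t, φ t • (D†) (D y)⟫_ℝ) μ := i12.sub i3
      rw [← integral_add i1 i2, ← integral_sub i12 i3, ← integral_sub i123
        (integrable_inner_of_memLp (hfm k) (memLp_smul_const hφc _)), ← mul_assoc, ← div_eq_mul_inv,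
        ← integral_const_mul]
      refine setIntegral_congr_fun measurableSet_Ioo fun t ht => ?_
      simp only [inner_smul_right]
      have := htest k t ht y
      linear_combination -(φ t) * this
  refine ⟨p, ξ, hpm, hξm, heqn, ?_⟩
  -- Minty's argument: the error in the energy identity vanishes in the limit
  obtain ⟨hρL, hρ0⟩ := backAvg_indicator_sub hrm
  set r' := (Ioo 0 T).indicator r with hr'
  let ρ : ℕ → ℝ → V := fun k t => backAvg (ε k) r' t - r' t
  have hρm : ∀ᶠ k in atTop, MemLp (ρ k) 2 volume := hεt.eventually hρL
  obtain ⟨k₀, hk₀⟩ := eventually_atTop.1 hρm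
  let b : ℕ → ℝ := fun k => (∫ t, ⟪ψ k t, J (u k t - p t)⟫_ℝ ∂μ) - ∫ t, ⟪ρ k t, u k t - p t⟫_ℝ ∂μ
  have hbound : ∀ k, ∫ t, ‖u k t - p t‖ ^ 2 ∂μ ≤ 2 * (C₁ + ∫ t, ‖p t‖ ^ 2 ∂μ) := by
    intro k
    calc _ ≤ ∫ t, 2 * (‖u k t‖ ^ 2 + ‖p t‖ ^ 2) ∂μ := by
          refine integral_mono (hem k).norm.integrable_sq
            (((hum k).norm.integrable_sq.add hpm.norm.integrable_sq).const_mul 2) fun t => ?_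
          simp only
          have h1 := norm_sub_le (u k t) (p t)
          have h2 : ‖u k t - p t‖ ^ 2 ≤ (‖u k t‖ + ‖p t‖) ^ 2 := by gcongr
          nlinarith [sq_nonneg (‖u k t‖ - ‖p t‖)]
      _ = 2 * ((∫ t, ‖u k t‖ ^ 2 ∂μ) + ∫ t, ‖p t‖ ^ 2 ∂μ) := by
          rw [integral_const_mul, integral_add (hum k).norm.integrable_sq hpm.norm.integrable_sq]
      _ ≤ _ := by gcongr; exact huC k
  have hboundJ : ∀ k, ∫ t, ‖J (u k t - p t)‖ ^ 2 ∂μ ≤ 2 * (C₁ + ∫ t, ‖p t‖ ^ 2 ∂μ) := fun k =>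
    (integral_mono (J.comp_memLp' (hem k)).norm.integrable_sq (hem k).norm.integrable_sq fun t => by
      have := norm_le_of_norm_sq_eq_add hJD (u k t - p t)
      simp only [Function.comp]
      gcongr).trans (hbound k)
  have hb0 : Tendsto b l (𝓝 0) := by
    have h1 := tendsto_integral_inner_zero hψm (fun k => J.comp_memLp' (hem k)) hboundJ hψ0'
    have h2 : Tendsto (fun k => ∫ t, ⟪ρ (k + k₀) t, u (k + k₀) t - p t⟫_ℝ ∂μ) atTop (𝓝 0) := by
      refine tendsto_integral_inner_zero (fun k => (hk₀ (k + k₀) (by omega)).restrict _)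
        (fun k => hem _) (fun k => hbound _) ?_
      refine squeeze_zero (fun k => integral_nonneg fun t => sq_nonneg _) (fun k =>
        integral_mono_measure Measure.restrict_le_self (ae_of_all _ fun t => sq_nonneg _)
          (hk₀ (k + k₀) (by omega)).norm.integrable_sq)
        ((hρ0.comp hεt).comp (tendsto_add_atTop_nat k₀))
    have h3 := h1.sub ((tendsto_add_atTop_iff_nat (f := fun k =>
      ∫ t, ⟪ρ k t, u k t - p t⟫_ℝ ∂μ) k₀).1 h2)
    rw [sub_zero] at h3
    exact h3.mono_left hl
  -- the difference of the equations of `u k` and `p`, tested with `u k - p`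
  have hmono : ∀ k, k₀ ≤ k → ∫ t, ⟪ζ k t - ξ t, τ (u k t - p t)⟫_ℝ ∂μ ≤ b k := by
    intro k hk
    have hρk : MemLp (ρ k) 2 μ := (hk₀ k hk).restrict _
    have hE1 : Integrable (fun t => ‖J (u k t - p t)‖ ^ 2) μ :=
      (J.comp_memLp' (hem k)).norm.integrable_sq
    have hE2 := (memLp_withPast_sub (J := J) (hεpos k) (hem k) 0).norm.integrable_sq
    have hE := integral_withPast_zero_sub_le (J := J) (hεpos k) (hem k)
    have hi1 : Integrable (fun t => ⟪ψ k t, J (u k t - p t)⟫_ℝ) μ :=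
      integrable_inner_of_memLp (hψm k) (J.comp_memLp' (hem k))
    have hi2 := integrable_inner_of_memLp hρk (hem k)
    have hi12 : Integrable (fun t => ⟪ψ k t, J (u k t - p t)⟫_ℝ - ⟪ρ k t, u k t - p t⟫_ℝ) μ :=
      hi1.sub hi2
    have hc0 : 0 ≤ α / (2 * ε k) := div_nonneg hα.le (mul_nonneg zero_le_two (hεpos k).le)
    have hpt : ∀ᵐ t ∂μ, ⟪ζ k t - ξ t, τ (u k t - p t)⟫_ℝ ≤
        (⟪ψ k t, J (u k t - p t)⟫_ℝ - ⟪ρ k t, u k t - p t⟫_ℝ) - α / (2 * ε k) *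
          (‖J (u k t - p t)‖ ^ 2 - ‖withPast J 0 (fun t => u k t - p t) (t - ε k)‖ ^ 2) := by
      have h1 := ae_restrict_of_ae (s := Ioo 0 T)
        (smul_adjoint_withPast_sub heqn (hrm.integrable (by norm_num)) (hεpos k))
      filter_upwards [h1, ae_restrict_mem measurableSet_Ioo] with t ht hm
      set e := u k t - p t with he
      set y := withPast J 0 (fun t => u k t - p t) (t - ε k) with hy
      have hsub : ∀ s, withPast J 0 (fun t => u k t - p t) s =
          withPast J u₀ (u k) s - withPast J u₀ p s := by
        intro s
        rcases le_or_gt s 0 with hs | hs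
        · simp [withPast_nonpos hs]
        · simp [withPast_pos hs]
      have h2 := htest k t hm e
      have h3 := congrArg (fun y => ⟪y, e⟫_ℝ) (ht hm)
      simp only [real_inner_smul_left, ContinuousLinearMap.adjoint_inner_left] at h3
      have h4 : backAvg (ε k) r' t = r t + ρ k t := by
        simp only [ρ, hr', indicator_of_mem hm]; abel
      rw [h4, inner_add_left] at h3
      have h5 : ⟪J e - y, J e⟫_ℝ = ⟪withPast J u₀ (u k) t - withPast J u₀ (u k) (t - ε k), J e⟫_ℝ -
          ⟪withPast J u₀ p t - withPast J u₀ p (t - ε k), J e⟫_ℝ := by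
        rw [hy, hsub, ← inner_sub_left, he, map_sub, withPast_pos hm.1, withPast_pos hm.1]
        congr 1; abel
      have h6 : ‖J e‖ ^ 2 / 2 - ‖y‖ ^ 2 / 2 ≤ ⟪J e - y, J e⟫_ℝ := by
        rw [inner_sub_left, real_inner_self_eq_norm_sq]
        have h7 := real_inner_le_norm y (J e)
        nlinarith [sq_nonneg (‖y‖ - ‖J e‖)]
      have h8 : ⟪e, (D†) (D e)⟫_ℝ = ‖D e‖ ^ 2 := by
        rw [ContinuousLinearMap.adjoint_inner_right, real_inner_self_eq_norm_sq]
      have h9 : α / ε k * ⟪J e - y, J e⟫_ℝ = ⟪ψ k t, J e⟫_ℝ - ‖D e‖ ^ 2 -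
          ⟪ζ k t - ξ t, τ e⟫_ℝ - ⟪ρ k t, e⟫_ℝ := by
        have h10 : α / ε k * ⟪withPast J u₀ p t - withPast J u₀ p (t - ε k), J e⟫_ℝ =
            ⟪r t, e⟫_ℝ + ⟪ρ k t, e⟫_ℝ := by
          rw [div_mul_eq_mul_div, h3, mul_div_cancel_left₀ _ (hεpos k).ne']
        rw [h5, mul_sub, h2, h10, h8]; ring
      have h11 : α / (2 * ε k) * (‖J e‖ ^ 2 - ‖y‖ ^ 2) ≤ α / ε k * ⟪J e - y, J e⟫_ℝ := by
        have e1 : α / (2 * ε k) * (‖J e‖ ^ 2 - ‖y‖ ^ 2) =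
            α / ε k * (‖J e‖ ^ 2 / 2 - ‖y‖ ^ 2 / 2) := by
          field_simp
        rw [e1]
        exact mul_le_mul_of_nonneg_left h6 (div_pos hα (hεpos k)).le
      have h12 := sq_nonneg ‖D e‖
      linarith
    have hE12 : Integrable (fun t => ‖J (u k t - p t)‖ ^ 2 -
        ‖withPast J 0 (fun t => u k t - p t) (t - ε k)‖ ^ 2) μ := hE1.sub hE2
    refine (integral_mono_ae (integrable_inner_of_memLp (hfm k) (τ.comp_memLp' (hem k)))
      (hi12.sub (hE12.const_mul _)) hpt).trans ?_
    have e1 : ∫ t, ((⟪ψ k t, J (u k t - p t)⟫_ℝ - ⟪ρ k t, u k t - p t⟫_ℝ) - α / (2 * ε k) *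
          (‖J (u k t - p t)‖ ^ 2 - ‖withPast J 0 (fun t => u k t - p t) (t - ε k)‖ ^ 2)) ∂μ =
        b k - α / (2 * ε k) * ((∫ t, ‖J (u k t - p t)‖ ^ 2 ∂μ) -
          ∫ t, ‖withPast J 0 (fun t => u k t - p t) (t - ε k)‖ ^ 2 ∂μ) := by
      rw [integral_sub hi12 (hE12.const_mul _), integral_const_mul,
        integral_sub hE1 hE2, integral_sub hi1 hi2]
    refine e1.le.trans ?_
    have := mul_nonneg hc0 (sub_nonneg.2 hE)
    linarith
  -- `η` lies in the limit operator at `τ p + ξ - η`; by monotonicity against this pair, `‖ξ - η‖²`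
  -- is bounded by terms that vanish in the limit
  let η : ℝ → X := fun t => N 1 (τ (p t) + ξ t)
  have hηm : MemLp η 2 μ := (hN.lipschitz one_pos).comp_memLp (hN.map_zero 1 one_pos)
    ((τ.comp_memLp' hpm).add hξm)
  have hdm : MemLp (fun t => ξ t - η t) 2 μ := hξm.sub hηm
  have hfin : ∀ k, k₀ ≤ k → ∫ t, ‖ξ t - η t‖ ^ 2 ∂μ ≤ b k +
      (∫ t, ⟪u k t - p t, (τ†) (ξ t - η t)⟫_ℝ ∂μ) - (∫ t, ⟪ζ k t - ξ t, ξ t - η t⟫_ℝ ∂μ) +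
      ε k * ∫ t, ⟪ζ k t, η t⟫_ℝ ∂μ := by
    intro k hk
    have hi1 : Integrable (fun t => ⟪ζ k t - ξ t, τ (u k t - p t)⟫_ℝ) μ :=
      integrable_inner_of_memLp (hfm k) (τ.comp_memLp' (hem k))
    have hi2 : Integrable (fun t => ⟪u k t - p t, (τ†) (ξ t - η t)⟫_ℝ) μ :=
      integrable_inner_of_memLp (hem k) ((τ†).comp_memLp' hdm)
    have hi3 := integrable_inner_of_memLp (hfm k) hdm
    have hi12 : Integrable (fun t => ⟪ζ k t - ξ t, τ (u k t - p t)⟫_ℝ +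
        ⟪u k t - p t, (τ†) (ξ t - η t)⟫_ℝ) μ := hi1.add hi2
    have hi123 : Integrable (fun t => ⟪ζ k t - ξ t, τ (u k t - p t)⟫_ℝ +
        ⟪u k t - p t, (τ†) (ξ t - η t)⟫_ℝ - ⟪ζ k t - ξ t, ξ t - η t⟫_ℝ) μ := hi12.sub hi3
    have hi4 := integrable_inner_of_memLp (hζm k) hηm
    have hpt : ∀ t, ‖ξ t - η t‖ ^ 2 ≤ ⟪ζ k t - ξ t, τ (u k t - p t)⟫_ℝ +
        ⟪u k t - p t, (τ†) (ξ t - η t)⟫_ℝ - ⟪ζ k t - ξ t, ξ t - η t⟫_ℝ +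
        ε k * ⟪ζ k t, η t⟫_ℝ := by
      intro t
      have h1 := hN.monotone (ε k) (hεpos k) 1 one_pos (τ (u k t)) (τ (p t) + ξ t)
      have h2 : (τ (u k t) - ε k • N (ε k) (τ (u k t))) -
          (τ (p t) + ξ t - (1 : ℝ) • N 1 (τ (p t) + ξ t)) =
          τ (u k t - p t) - (ξ t - η t) - ε k • ζ k t := by
        simp only [η, ζ, map_sub, one_smul]; abel
      rw [h2] at h1
      have h3 : N (ε k) (τ (u k t)) - N 1 (τ (p t) + ξ t) = (ζ k t - ξ t) + (ξ t - η t) := by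
        simp only [η, ζ]; abel
      rw [h3, inner_sub_right, inner_sub_right, inner_smul_right, inner_add_left, inner_add_left,
        real_inner_self_eq_norm_sq] at h1
      have h4 : ⟪ζ k t - ξ t + (ξ t - η t), ζ k t⟫_ℝ = ‖ζ k t‖ ^ 2 - ⟪ζ k t, η t⟫_ℝ := by
        rw [sub_add_sub_cancel, inner_sub_left, real_inner_self_eq_norm_sq, real_inner_comm]
      rw [h4] at h1
      rw [ContinuousLinearMap.adjoint_inner_right, real_inner_comm (ξ t - η t)]
      have h5 : 0 ≤ ε k * ‖ζ k t‖ ^ 2 := mul_nonneg (hεpos k).le (sq_nonneg _)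
      linarith
    have h6 := integral_mono hdm.norm.integrable_sq (hi123.add (hi4.const_mul _))
      hpt
    have e1 : ∫ t, (⟪ζ k t - ξ t, τ (u k t - p t)⟫_ℝ +
        ⟪u k t - p t, (τ†) (ξ t - η t)⟫_ℝ - ⟪ζ k t - ξ t, ξ t - η t⟫_ℝ +
        ε k * ⟪ζ k t, η t⟫_ℝ) ∂μ = (∫ t, ⟪ζ k t - ξ t, τ (u k t - p t)⟫_ℝ ∂μ) +
      (∫ t, ⟪u k t - p t, (τ†) (ξ t - η t)⟫_ℝ ∂μ) - (∫ t, ⟪ζ k t - ξ t, ξ t - η t⟫_ℝ ∂μ) +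
      ε k * ∫ t, ⟪ζ k t, η t⟫_ℝ ∂μ := by
      rw [integral_add hi123 (hi4.const_mul _), integral_sub hi12 hi3,
        integral_add hi1 hi2, integral_const_mul]
    have h7 := h6.trans e1.le
    linarith [hmono k hk]
  have hlim : Tendsto (fun k => b k +
      (∫ t, ⟪u k t - p t, (τ†) (ξ t - η t)⟫_ℝ ∂μ) - (∫ t, ⟪ζ k t - ξ t, ξ t - η t⟫_ℝ ∂μ) +
      ε k * ∫ t, ⟪ζ k t, η t⟫_ℝ ∂μ) l (𝓝 0) := by
    have := ((hb0.add (hp0 _ ((τ†).comp_memLp' hdm))).sub (hξ0 _ hdm)).add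
      ((hε0.mono_left hl).mul (hξ η hηm))
    simpa using this
  have hzero : ∫ t, ‖ξ t - η t‖ ^ 2 ∂μ ≤ 0 :=
    ge_of_tendsto hlim (((eventually_ge_atTop k₀).filter_mono hl).mono hfin)
  have hz2 := (integral_eq_zero_iff_of_nonneg (fun t => sq_nonneg ‖ξ t - η t‖)
    hdm.norm.integrable_sq).1 (le_antisymm hzero (integral_nonneg fun t => sq_nonneg _))
  filter_upwards [hz2] with t ht
  have : ‖ξ t - η t‖ = 0 := by simpa using ht
  exact sub_eq_zero.1 (norm_eq_zero.1 this)

end AbstractExistence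

/-! ### Sobolev functions -/

section SobolevBasics

variable {n : ℕ} {Ω : Set (Euc n)}

theorem memLp_restrict_of_continuous {F : Type*} [NormedAddCommGroup F]
    (hb : Bornology.IsBounded Ω) {f : Euc n → F} (hf : Continuous f) :
    MemLp f 2 (volume.restrict Ω) := by
  have : IsFiniteMeasure (volume.restrict Ω) := ⟨by simpa using hb.measure_lt_top⟩
  obtain ⟨M, hM⟩ := hb.isCompact_closure.exists_bound_of_continuousOn (hf.continuousOn)
  refine MemLp.of_bound hf.aestronglyMeasurable M ?_
  have : ∀ᵐ x ∂(volume.restrict (closure Ω)), ‖f x‖ ≤ M :=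
    (ae_restrict_mem isClosed_closure.measurableSet).mono fun x hx => hM x hx
  exact ae_mono (Measure.restrict_mono subset_closure le_rfl) this

theorem inner_gradient (φ : Euc n → ℝ) (x e : Euc n) :
    ⟪gradient φ x, e⟫_ℝ = fderiv ℝ φ x e := by
  rw [gradient, InnerProductSpace.toDual_symm_apply]

theorem continuous_gradient {φ : Euc n → ℝ} (hφ : ContDiff ℝ 1 φ) : Continuous (gradient φ) :=
  (InnerProductSpace.toDual ℝ (Euc n)).symm.continuous.comp (hφ.continuous_fderiv (by simp))

/-- For a `C¹` function the classical gradient is the weak gradient. -/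
theorem setIntegral_mul_fderiv {φ χ : Euc n → ℝ} (hφ : ContDiff ℝ 1 φ) (hχ : IsTestFunction Ω χ)
    (e : Euc n) :
    ∫ x in Ω, φ x * fderiv ℝ χ x e = -∫ x in Ω, ⟪gradient φ x, e⟫_ℝ * χ x := by
  have hz : ∀ x, x ∉ Ω → x ∉ tsupport χ := fun x hx h => hx (hχ.tsupport_subset h)
  have hχ1 : ContDiff ℝ 1 χ := hχ.contDiff.of_le (by simp)
  have hcd : Continuous fun x => fderiv ℝ χ x e :=
    (hχ1.continuous_fderiv (by simp)).clm_apply continuous_const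
  have hcφ : Continuous fun x => fderiv ℝ φ x e :=
    (hφ.continuous_fderiv (by simp)).clm_apply continuous_const
  have hsd : HasCompactSupport fun x => fderiv ℝ χ x e := hχ.hasCompactSupport.fderiv_apply ℝ e
  rw [setIntegral_eq_integral_of_forall_compl_eq_zero, setIntegral_eq_integral_of_forall_compl_eq_zero]
  · simp_rw [inner_gradient]
    exact integral_mul_fderiv_eq_neg_fderiv_mul_of_integrable
      ((hcφ.mul hχ1.continuous).integrable_of_hasCompactSupport hχ.hasCompactSupport.mul_left)
      ((hφ.continuous.mul hcd).integrable_of_hasCompactSupport hsd.mul_left)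
      ((hφ.continuous.mul hχ1.continuous).integrable_of_hasCompactSupport
        hχ.hasCompactSupport.mul_left)
      (fun x _ => (hφ.differentiable one_ne_zero) x) (fun x _ => (hχ1.differentiable one_ne_zero) x)
  · intro x hx
    rw [image_eq_zero_of_notMem_tsupport (hz x hx), mul_zero]
  · intro x hx
    rw [fderiv_of_notMem_tsupport ℝ (hz x hx)]
    simp

/-- The restriction to `Ω` of a `C¹` function belongs to `H¹(Ω)`. -/
theorem exists_H1_of_contDiff (hb : Bornology.IsBounded Ω) {φ : Euc n → ℝ} (hφ : ContDiff ℝ 1 φ) :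
    ∃ z : H1 Ω, H1.toL2 Ω z =ᵐ[volume.restrict Ω] φ := by
  have h1 := memLp_restrict_of_continuous hb hφ.continuous
  have h2 := memLp_restrict_of_continuous hb (continuous_gradient hφ)
  refine ⟨⟨WithLp.toLp 2 (h1.toLp φ, h2.toLp _), fun χ hχ e => ?_⟩, h1.coeFn_toLp⟩
  have e1 : ∫ x in Ω, (h1.toLp φ) x * fderiv ℝ χ x e = ∫ x in Ω, φ x * fderiv ℝ χ x e :=
    integral_congr_ae (h1.coeFn_toLp.mono fun x hx => by simp only [hx])
  have e2 : ∫ x in Ω, ⟪(h2.toLp _) x, e⟫_ℝ * χ x = ∫ x in Ω, ⟪gradient φ x, e⟫_ℝ * χ x :=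
    integral_congr_ae (h2.coeFn_toLp.mono fun x hx => by simp only [hx])
  exact e1.trans ((setIntegral_mul_fderiv hφ hχ e).trans (by rw [← e2]; rfl))

theorem H1.isWeakGradient (z : H1 Ω) : IsWeakGradient (H1.toL2 Ω z) (H1.grad Ω z) := z.2

theorem H1.norm_sq (z : H1 Ω) : ‖z‖ ^ 2 = ‖H1.toL2 Ω z‖ ^ 2 + ‖H1.grad Ω z‖ ^ 2 :=
  WithLp.prod_norm_sq_eq_of_L2 z.1

/-- The weak gradient of the restriction of a `C¹` function is the classical gradient, since weak
gradients are unique. -/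
theorem H1.grad_ae_eq_gradient (ho : IsOpen Ω) {z : H1 Ω} {φ : Euc n → ℝ}
    (hφ : ContDiff ℝ 1 φ) (hz : H1.toL2 Ω z =ᵐ[volume.restrict Ω] φ) :
    H1.grad Ω z =ᵐ[volume.restrict Ω] gradient φ := by
  have hli : ∀ {F : Type} [NormedAddCommGroup F] {f : Euc n → F},
      LocallyIntegrable f (volume.restrict Ω) → LocallyIntegrableOn f Ω volume := by
    intro F _ f hf
    refine (locallyIntegrableOn_iff ho.isLocallyClosed).2 fun K hK hKc => ?_
    have := hf.integrableOn_isCompact hKc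
    rwa [IntegrableOn, Measure.restrict_restrict hKc.measurableSet, inter_eq_left.2 hK] at this
  have hG : LocallyIntegrableOn (fun x => H1.grad Ω z x - gradient φ x) Ω volume :=
    (hli ((Lp.memLp (H1.grad Ω z)).locallyIntegrable (by norm_num))).sub
      ((continuous_gradient hφ).locallyIntegrable.locallyIntegrableOn Ω)
  have key := ho.ae_eq_zero_of_integral_contDiff_smul_eq_zero hG fun χ hχ hχc hχs => ?_
  · rw [EventuallyEq, ae_restrict_iff' ho.measurableSet]
    exact key.mono fun x hx hxΩ => sub_eq_zero.1 (hx hxΩ)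
  · have hT : IsTestFunction Ω χ := ⟨hχ, hχc, hχs⟩
    have hz0 : ∀ x, x ∉ Ω → χ x = 0 := fun x hx =>
      image_eq_zero_of_notMem_tsupport fun h => hx (hχs h)
    rw [← setIntegral_eq_integral_of_forall_compl_eq_zero (s := Ω)
      (fun x hx => by rw [hz0 x hx, zero_smul])]
    have hi1 : Integrable (fun x => χ x • H1.grad Ω z x) (volume.restrict Ω) := by
      exact memLp_one_iff_integrable.1 ((Lp.memLp (H1.grad Ω z)).smul (p := 2)
        ((hχ.continuous.memLp_of_hasCompactSupport (μ := volume) hχc).restrict Ω))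
    have hi2 : Integrable (fun x => χ x • gradient φ x) (volume.restrict Ω) :=
      ((hχ.continuous.smul (continuous_gradient hφ)).integrable_of_hasCompactSupport
        hχc.smul_right).restrict
    have hsub : Integrable (fun x => χ x • (H1.grad Ω z x - gradient φ x)) (volume.restrict Ω) := by
      simp_rw [smul_sub]; exact hi1.sub hi2
    refine ext_inner_right ℝ fun e => ?_
    rw [inner_zero_left, real_inner_comm, ← integral_inner hsub]
    have e1 := H1.isWeakGradient z χ hT e
    have e2 := setIntegral_mul_fderiv hφ hT e
    have e3 : ∫ x in Ω, H1.toL2 Ω z x * fderiv ℝ χ x e = ∫ x in Ω, φ x * fderiv ℝ χ x e :=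
      integral_congr_ae (hz.mono fun x hx => by simp only [hx])
    have e4 : (fun x => ⟪e, χ x • (H1.grad Ω z x - gradient φ x)⟫_ℝ) = fun x =>
        ⟪H1.grad Ω z x, e⟫_ℝ * χ x - ⟪gradient φ x, e⟫_ℝ * χ x := by
      ext x
      rw [inner_smul_right, inner_sub_right, real_inner_comm, real_inner_comm _ (gradient φ x)]
      ring
    have hi4 : Integrable (fun x => ⟪gradient φ x, e⟫_ℝ * χ x) (volume.restrict Ω) :=
      ((((continuous_gradient hφ).inner continuous_const).mul
        hχ.continuous).integrable_of_hasCompactSupport hχc.mul_left).restrict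
    rw [e4, integral_sub (integrable_inner_mul _ hT e) hi4]
    linarith

/-- `H¹(Ω)` is complete: having a given weak gradient is a closed condition. -/
instance H1.completeSpace : CompleteSpace (H1 Ω) := by
  have hcl : IsClosed ((H1 Ω : Submodule ℝ (WithLp 2 (L2 Ω × L2vec Ω))) :
      Set (WithLp 2 (L2 Ω × L2vec Ω))) := by
    have : ((H1 Ω : Submodule ℝ (WithLp 2 (L2 Ω × L2vec Ω))) :
        Set (WithLp 2 (L2 Ω × L2vec Ω))) = ⋂ (χ : Euc n → ℝ) (_ : IsTestFunction Ω χ) (e : Euc n),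
        {p | ∫ x in Ω, p.fst x * fderiv ℝ χ x e = -∫ x in Ω, ⟪p.snd x, e⟫_ℝ * χ x} := by
      ext p
      simp only [mem_iInter, mem_ofPred_eq]
      rfl
    rw [this]
    refine isClosed_iInter fun χ => isClosed_iInter fun hχ => isClosed_iInter fun e => ?_
    have hχc := hχ.contDiff.continuous
    have m1 : MemLp (fun x => fderiv ℝ χ x e) 2 (volume.restrict Ω) :=
      (((hχ.contDiff.continuous_fderiv (by simp)).clm_apply
        continuous_const).memLp_of_hasCompactSupport
          (hχ.hasCompactSupport.fderiv_apply ℝ e)).restrict Ω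
    have m2 : MemLp (fun x => χ x • e) 2 (volume.restrict Ω) :=
      ((hχc.smul continuous_const).memLp_of_hasCompactSupport
        hχ.hasCompactSupport.smul_right).restrict Ω
    have c1 : ∀ p : WithLp 2 (L2 Ω × L2vec Ω), ∫ x in Ω, p.fst x * fderiv ℝ χ x e =
        ⟪WithLp.fstL 2 ℝ (L2 Ω) (L2vec Ω) p, m1.toLp _⟫_ℝ := by
      intro p
      rw [L2.inner_def]
      refine integral_congr_ae (m1.coeFn_toLp.mono fun x hx => ?_)
      simp only [hx]
      simp [mul_comm]
    have c2 : ∀ p : WithLp 2 (L2 Ω × L2vec Ω), ∫ x in Ω, ⟪p.snd x, e⟫_ℝ * χ x =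
        ⟪WithLp.sndL 2 ℝ (L2 Ω) (L2vec Ω) p, m2.toLp _⟫_ℝ := by
      intro p
      rw [L2.inner_def]
      refine integral_congr_ae (m2.coeFn_toLp.mono fun x hx => ?_)
      simp only [hx]
      simp [inner_smul_right, mul_comm]
    simp_rw [c1, c2]
    exact isClosed_eq (by fun_prop) (by fun_prop)
  exact hcl.completeSpace_coe

end SobolevBasics

/-! ### Local approximation by smooth functions -/

section Density

variable {n : ℕ} {Ω : Set (Euc n)}

/-- Near each point of its closure, a smooth domain satisfies a uniform interior cone condition. -/
theorem IsSmoothBoundedDomain.exists_inner_cone (hΩ : IsSmoothBoundedDomain Ω) {x : Euc n}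
    (hx : x ∈ closure Ω) :
    ∃ U : Set (Euc n), IsOpen U ∧ x ∈ U ∧ ∃ e : Euc n, ∃ c > 0, ∃ t₀ > 0,
      ∀ y ∈ Ω ∩ U, ∀ t ∈ Ioo 0 t₀, ∀ s, ‖s - t • e‖ < c * t → y + s ∈ Ω := by
  by_cases hxΩ : x ∈ Ω
  · obtain ⟨r, hr, hb⟩ := Metric.isOpen_iff.1 hΩ.isOpen x hxΩ
    refine ⟨Metric.ball x (r / 2), Metric.isOpen_ball, Metric.mem_ball_self (by positivity), 0, 1,
      one_pos, r / 2, by positivity, fun y hy t ht s hs => hb ?_⟩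
    rw [smul_zero, sub_zero, one_mul] at hs
    have h1 := mem_ball_iff_norm.1 hy.2
    rw [mem_ball_iff_norm]
    calc ‖y + s - x‖ = ‖(y - x) + s‖ := by congr 1; abel
      _ ≤ ‖y - x‖ + ‖s‖ := norm_add_le _ _
      _ < r := by linarith [ht.2]
  have hxf : x ∈ frontier Ω := by rw [hΩ.isOpen.frontier_eq]; exact ⟨hx, hxΩ⟩
  obtain ⟨e, ψ, he, hψ, hV⟩ := hΩ.smooth_boundary x hxf
  have hψ' : ContDiff ℝ 1 fun y : Euc n => ψ (y - ⟪y, e⟫_ℝ • e) :=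
    (hψ.of_le (by simp)).comp (contDiff_id.sub ((contDiff_id.inner ℝ contDiff_const).smul
      contDiff_const))
  obtain ⟨K, V', hV', hK⟩ := hψ'.locallyLipschitz x
  obtain ⟨δ, hδ, hball⟩ := Metric.eventually_nhds_iff_ball.1 (hV.and hV')
  have hee : ⟪e, e⟫_ℝ = 1 := by rw [real_inner_self_eq_norm_sq, he, one_pow]
  have hc0 : (0 : ℝ) < 1 / (K + 2) := by positivity
  have hc1 : 1 / ((K : ℝ) + 2) ≤ 1 := by
    rw [div_le_one (by positivity)]; linarith [K.2]
  refine ⟨Metric.ball x (δ / 2), Metric.isOpen_ball, Metric.mem_ball_self (by positivity), e,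
    1 / (K + 2), hc0, δ / 4, by positivity, fun y hy t ht s hs => ?_⟩
  have h1 := mem_ball_iff_norm.1 hy.2
  have hst : ‖s - t • e‖ < t := hs.trans_le (mul_le_of_le_one_left ht.1.le hc1)
  have hte : ‖t • e‖ = t := by rw [norm_smul, he, mul_one, Real.norm_of_nonneg ht.1.le]
  have hs2 : ‖s‖ < 2 * t := by
    calc ‖s‖ = ‖(s - t • e) + t • e‖ := by congr 1; abel
      _ ≤ ‖s - t • e‖ + ‖t • e‖ := norm_add_le _ _
      _ < 2 * t := by linarith
  have hyb : y ∈ Metric.ball x δ := by rw [mem_ball_iff_norm]; linarith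
  have hysb : y + s ∈ Metric.ball x δ := by
    rw [mem_ball_iff_norm]
    calc ‖y + s - x‖ = ‖(y - x) + s‖ := by congr 1; abel
      _ ≤ ‖y - x‖ + ‖s‖ := norm_add_le _ _
      _ < δ := by linarith [ht.2]
  have hytb : y + t • e ∈ Metric.ball x δ := by
    rw [mem_ball_iff_norm]
    calc ‖y + t • e - x‖ = ‖(y - x) + t • e‖ := by congr 1; abel
      _ ≤ ‖y - x‖ + ‖t • e‖ := norm_add_le _ _
      _ < δ := by linarith [ht.2]
  refine (hball _ hysb).1.2 ?_
  have h2 := (hball y hyb).1.1 hy.1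
  have h3 := hK.dist_le_mul _ (hball _ hysb).2 _ (hball _ hytb).2
  have h4 : y + t • e - ⟪y + t • e, e⟫_ℝ • e = y - ⟪y, e⟫_ℝ • e := by
    rw [inner_add_left, real_inner_smul_left, hee, mul_one, add_smul]; abel
  rw [h4, Real.dist_eq, dist_eq_norm, show y + s - (y + t • e) = s - t • e by abel] at h3
  have h5 : ⟪y + s, e⟫_ℝ = ⟪y, e⟫_ℝ + t + ⟪s - t • e, e⟫_ℝ := by
    rw [inner_add_left, inner_sub_left, real_inner_smul_left, hee]; ring
  have h6 := abs_le.1 (abs_real_inner_le_norm (s - t • e) e)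
  rw [he, mul_one] at h6
  have h7 : (K + 1) * ‖s - t • e‖ < t := by
    have : (K + 2) * (1 / ((K : ℝ) + 2) * t) = t := by field_simp
    nlinarith [K.2, norm_nonneg (s - t • e), hs]
  have h8 := (abs_le.1 h3).2
  linarith

section Average

variable {F : Type*} [NormedAddCommGroup F] [NormedSpace ℝ F]

theorem integral_smul_comp_add_eq_convolution (ρ : Euc n → ℝ) (f : Euc n → F) (y : Euc n) :
    ∫ s, ρ s • f (s + y) =
      MeasureTheory.convolution (fun w => ρ (-w)) f (ContinuousLinearMap.lsmul ℝ ℝ) volume y := by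
  rw [convolution_def, ← integral_neg_eq_self]
  simp only [ContinuousLinearMap.lsmul_apply]
  refine integral_congr_ae (ae_of_all _ fun s => ?_)
  simp only
  congr 2; abel

theorem contDiff_integral_smul_comp_add [CompleteSpace F] {ρ : Euc n → ℝ} (hρ : ContDiff ℝ ∞ ρ)
    (hρc : HasCompactSupport ρ) {f : Euc n → F} (hf : LocallyIntegrable f) :
    ContDiff ℝ 1 fun y => ∫ s, ρ s • f (s + y) := by
  simp_rw [integral_smul_comp_add_eq_convolution]
  exact (hρc.comp_homeomorph (Homeomorph.neg _)).contDiff_convolution_left (n := 1) _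
    ((hρ.comp contDiff_neg).of_le (by simp)) hf

/-- The derivative of a mollification falls on the kernel, so that it tests the weak gradient. -/
theorem fderiv_integral_smul_comp_add {ρ : Euc n → ℝ} (hρ : ContDiff ℝ ∞ ρ)
    (hρc : HasCompactSupport ρ) {f : Euc n → ℝ} (hf : LocallyIntegrable f) (y e : Euc n) :
    fderiv ℝ (fun y => ∫ s, ρ s • f (s + y)) y e =
      -∫ z, f z * fderiv ℝ (fun z => ρ (z - y)) z e := by
  simp_rw [integral_smul_comp_add_eq_convolution]
  have hc : HasCompactSupport fun w : Euc n => ρ (-w) := hρc.comp_homeomorph (Homeomorph.neg _)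
  have hd : ContDiff ℝ 1 fun w : Euc n => ρ (-w) := (hρ.comp contDiff_neg).of_le (by simp)
  have h1 := hc.hasFDerivAt_convolution_left (μ := volume) (ContinuousLinearMap.lsmul ℝ ℝ) hd hf y
  rw [h1.fderiv, convolution_def]
  have hex := (hc.fderiv ℝ).convolutionExists_left (μ := volume)
    ((ContinuousLinearMap.lsmul ℝ ℝ : ℝ →L[ℝ] ℝ →L[ℝ] ℝ).precompL (Euc n))
    (hd.continuous_fderiv (by simp)) hf y
  rw [ContinuousLinearMap.integral_apply hex, ← integral_neg]
  rw [← integral_sub_left_eq_self _ volume y]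
  refine integral_congr_ae (ae_of_all _ fun z => ?_)
  simp only [ContinuousLinearMap.precompL_apply, ContinuousLinearMap.lsmul_apply, smul_eq_mul,
    sub_sub_cancel]
  have h2 : (fun z : Euc n => ρ (z - y)) = (fun w : Euc n => ρ (-w)) ∘ fun z => y - z := by
    ext z; simp
  have h3 : fderiv ℝ (fun z : Euc n => ρ (z - y)) z e =
      -(fderiv ℝ (fun w : Euc n => ρ (-w)) (y - z) e) := by
    rw [h2, fderiv_comp z ((hd.differentiable one_ne_zero) _) (by fun_prop)]
    rw [fderiv_const_sub, fderiv_fun_id]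
    simp
  rw [h3]; ring

end Average

/-- Near a point where an interior cone condition holds, a function of `H¹(Ω)` is approximated by
averages over small balls around points shifted into the cone. Such averages only see values in `Ω`,
so that no extension operator is needed: on `Ω ∩ U` the gradient `Φ` of the average is the average
of the gradient. -/
theorem exists_local_approximation (ho : IsOpen Ω) (u : H1 Ω) {U : Set (Euc n)} {e : Euc n}
    {c t₀ : ℝ} (hc : 0 < c) (ht₀ : 0 < t₀)
    (hcone : ∀ y ∈ Ω ∩ U, ∀ t ∈ Ioo 0 t₀, ∀ s, ‖s - t • e‖ < c * t → y + s ∈ Ω)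
    {η : ℝ≥0∞} (hη : 0 < η) :
    ∃ (φ : Euc n → ℝ) (Φ : Euc n → Euc n), ContDiff ℝ 1 φ ∧ Continuous Φ ∧
      (∀ y ∈ Ω ∩ U, gradient φ y = Φ y) ∧
      eLpNorm (fun x => φ x - H1.toL2 Ω u x) 2 (volume.restrict Ω) ≤ η ∧
      eLpNorm (fun x => Φ x - H1.grad Ω u x) 2 (volume.restrict Ω) ≤ η := by
  set f : Euc n → ℝ := Ω.indicator (H1.toL2 Ω u) with hf
  set G : Euc n → Euc n := Ω.indicator (H1.grad Ω u) with hG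
  have hfm : MemLp f 2 volume :=
    (memLp_indicator_iff_restrict ho.measurableSet).2 (Lp.memLp (H1.toL2 Ω u))
  have hGm : MemLp G 2 volume :=
    (memLp_indicator_iff_restrict ho.measurableSet).2 (Lp.memLp (H1.grad Ω u))
  have hfl := hfm.locallyIntegrable (by norm_num)
  have hGl := hGm.locallyIntegrable (by norm_num)
  obtain ⟨δ₁, hδ₁, h1⟩ := exists_eLpNorm_average_sub_le hfm hη
  obtain ⟨δ₂, hδ₂, h2⟩ := exists_eLpNorm_average_sub_le hGm hη
  -- the kernel lives in a small ball around `t • e`, so that it only sees values in `Ω`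
  obtain ⟨t, ht0, htt, ht1, ht2⟩ : ∃ t, 0 < t ∧ t < t₀ ∧ (‖e‖ + c) * t < δ₁ ∧ (‖e‖ + c) * t < δ₂ := by
    have hlim : Tendsto (fun t : ℝ => (‖e‖ + c) * t) (𝓝[>] 0) (𝓝 0) := by
      have : Tendsto (fun t : ℝ => (‖e‖ + c) * t) (𝓝 0) (𝓝 ((‖e‖ + c) * 0)) :=
        (continuous_const.mul continuous_id).tendsto 0
      rw [mul_zero] at this
      exact this.mono_left nhdsWithin_le_nhds
    obtain ⟨t, h⟩ := (((hlim.eventually_lt_const hδ₁).and (hlim.eventually_lt_const hδ₂)).and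
      (Ioo_mem_nhdsGT ht₀)).exists
    exact ⟨t, h.2.1, h.2.2, h.1.1, h.1.2⟩
  let B : ContDiffBump (t • e) := ⟨c * t / 4, c * t / 2, by positivity, by
    have := mul_pos hc ht0; linarith⟩
  set ρ : Euc n → ℝ := B.normed volume with hρ
  have hρd : ContDiff ℝ ∞ ρ := B.contDiff_normed
  have hρc : HasCompactSupport ρ := B.hasCompactSupport_normed
  let ν : Measure (Euc n) := volume.withDensity fun s => ENNReal.ofReal (ρ s)
  have hρm : Measurable fun s => ENNReal.ofReal (ρ s) := hρd.continuous.measurable.ennreal_ofReal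
  have hν : IsProbabilityMeasure ν := ⟨by
    rw [withDensity_apply _ MeasurableSet.univ, Measure.restrict_univ,
      ← ofReal_integral_eq_lintegral_ofReal B.integrable_normed
        (ae_of_all _ fun s => B.nonneg_normed s), B.integral_normed, ENNReal.ofReal_one]⟩
  have hνs : ∀ᵐ s ∂ν, ‖s‖ ≤ (‖e‖ + c) * t := by
    rw [ae_withDensity_iff hρm]
    refine ae_of_all _ fun s hs => ?_
    have hs1 : s ∈ Function.support ρ := fun h0 => hs (by rw [h0, ENNReal.ofReal_zero])
    rw [B.support_normed_eq, mem_ball_iff_norm] at hs1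
    have hs2 : ‖s - t • e‖ < c * t / 2 := hs1
    calc ‖s‖ = ‖(s - t • e) + t • e‖ := by congr 1; abel
      _ ≤ ‖s - t • e‖ + ‖t • e‖ := norm_add_le _ _
      _ ≤ c * t + t * ‖e‖ := by
          rw [norm_smul, Real.norm_of_nonneg ht0.le]
          have := mul_pos hc ht0
          linarith
      _ = _ := by ring
  have hνint : ∀ {F : Type} [NormedAddCommGroup F] [NormedSpace ℝ F] (f : Euc n → F) (y : Euc n),
      ∫ s, f (s + y) ∂ν = ∫ s, ρ s • f (s + y) := by
    intro F _ _ f y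
    rw [integral_withDensity_eq_integral_toReal_smul hρm (ae_of_all _ fun s => ENNReal.ofReal_lt_top)]
    refine integral_congr_ae (ae_of_all _ fun s => ?_)
    simp only
    rw [ENNReal.toReal_ofReal (B.nonneg_normed s)]
  have e1 := h1 ν hν (withDensity_absolutelyContinuous _ _) (hνs.mono fun s hs => hs.trans_lt ht1)
  have e2 := h2 ν hν (withDensity_absolutelyContinuous _ _) (hνs.mono fun s hs => hs.trans_lt ht2)
  simp_rw [hνint] at e1 e2
  refine ⟨fun y => ∫ s, ρ s • f (s + y), fun y => ∫ s, ρ s • G (s + y),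
    contDiff_integral_smul_comp_add hρd hρc hfl,
    (contDiff_integral_smul_comp_add hρd hρc hGl).continuous, fun y hy => ?_, ?_, ?_⟩
  · refine ext_inner_right ℝ fun v => ?_
    rw [inner_gradient, fderiv_integral_smul_comp_add hρd hρc hfl]
    have hsub : ∀ z ∈ tsupport fun z => ρ (z - y), ‖(z - y) - t • e‖ ≤ c * t / 2 := by
      intro z hz
      have : z - y ∈ tsupport ρ := tsupport_comp_subset_preimage ρ (f := fun z => z - y) (by fun_prop) hz
      rw [B.tsupport_normed_eq, mem_closedBall_iff_norm] at this
      exact this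
    have hχ : IsTestFunction Ω fun z => ρ (z - y) := by
      refine ⟨hρd.comp (contDiff_id.sub contDiff_const), ?_, fun z hz => ?_⟩
      · exact hρc.comp_homeomorph (Homeomorph.subRight y)
      · have := hcone y hy t ⟨ht0, htt⟩ (z - y) (by
          have := hsub z hz
          have := mul_pos hc ht0
          linarith)
        simpa using this
    have w := H1.isWeakGradient u _ hχ v
    have i1 : ∫ z, f z * fderiv ℝ (fun z => ρ (z - y)) z v =
        ∫ z in Ω, H1.toL2 Ω u z * fderiv ℝ (fun z => ρ (z - y)) z v := by
      rw [← integral_indicator ho.measurableSet]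
      refine integral_congr_ae (ae_of_all _ fun z => ?_)
      simp only [hf, indicator]
      split_ifs <;> simp
    have i2 : ∫ z in Ω, ⟪H1.grad Ω u z, v⟫_ℝ * ρ (z - y) = ∫ z, ⟪v, ρ (z - y) • G z⟫_ℝ := by
      rw [← integral_indicator ho.measurableSet]
      refine integral_congr_ae (ae_of_all _ fun z => ?_)
      simp only [hG, indicator]
      split_ifs
      · rw [inner_smul_right, real_inner_comm]; ring
      · simp
    have hint : Integrable fun z => ρ (z - y) • G z :=
      hGl.integrable_smul_left_of_hasCompactSupport
        (hχ.contDiff.continuous) hχ.hasCompactSupport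
    rw [i1, w, neg_neg, i2, integral_inner hint, real_inner_comm]
    congr 1
    rw [← integral_add_right_eq_self _ y]
    refine integral_congr_ae (ae_of_all _ fun z => ?_)
    simp
  · refine le_trans (le_of_eq ?_) ((eLpNorm_mono_measure _ (Measure.restrict_le_self (s := Ω))).trans e1)
    refine eLpNorm_congr_ae ((ae_restrict_mem ho.measurableSet).mono fun x hx => ?_)
    simp only [hf, indicator_of_mem hx]
  · refine le_trans (le_of_eq ?_) ((eLpNorm_mono_measure _ (Measure.restrict_le_self (s := Ω))).trans e2)
    refine eLpNorm_congr_ae ((ae_restrict_mem ho.measurableSet).mono fun x hx => ?_)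
    simp only [hG, indicator_of_mem hx]

end Density

/-! ### Density of smooth functions -/

section GlobalDensity

variable {n : ℕ} {Ω : Set (Euc n)}

theorem exists_smooth_partition {ι : Type} [Finite ι] {K : Set (Euc n)} (hK : IsClosed K)
    (U : ι → Set (Euc n)) (hU : ∀ i, IsOpen (U i)) (hKU : K ⊆ ⋃ i, U i) :
    ∃ χ : ι → Euc n → ℝ, (∀ i, ContDiff ℝ 1 (χ i)) ∧ (∀ i x, 0 ≤ χ i x ∧ χ i x ≤ 1) ∧
      (∀ i, tsupport (χ i) ⊆ U i) ∧ ∀ x ∈ K, ∑ᶠ i, χ i x = 1 := by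
  obtain ⟨f, hf⟩ := SmoothPartitionOfUnity.exists_isSubordinate (modelWithCornersSelf ℝ (Euc n))
    hK U hU hKU
  exact ⟨fun i => f i, fun i => ((f i).contMDiff.contDiff).of_le (by simp),
    fun i x => ⟨f.nonneg i x, f.le_one i x⟩, hf, fun x hx => f.sum_eq_one hx⟩

theorem H1.norm_le_add (z : H1 Ω) : ‖z‖ ≤ ‖H1.toL2 Ω z‖ + ‖H1.grad Ω z‖ := by
  refine le_of_sq_le_sq ?_ (by positivity)
  rw [H1.norm_sq]
  nlinarith [norm_nonneg (H1.toL2 Ω z), norm_nonneg (H1.grad Ω z)]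

theorem gradient_sum_mul {ι : Type} [Fintype ι] {χ φ : ι → Euc n → ℝ}
    (hχ : ∀ i, ContDiff ℝ 1 (χ i)) (hφ : ∀ i, ContDiff ℝ 1 (φ i)) (x : Euc n) :
    gradient (fun x => ∑ i, χ i x * φ i x) x =
      ∑ i, (χ i x • gradient (φ i) x + φ i x • gradient (χ i) x) := by
  refine ext_inner_right ℝ fun v => ?_
  have h1 : ∀ i, DifferentiableAt ℝ (χ i) x := fun i => (hχ i).differentiable one_ne_zero x
  have h2 : ∀ i, DifferentiableAt ℝ (φ i) x := fun i => (hφ i).differentiable one_ne_zero x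
  rw [inner_gradient, fderiv_fun_sum fun i _ => (h1 i).fun_mul (h2 i), sum_inner]
  simp_rw [inner_add_left, real_inner_smul_left, inner_gradient]
  rw [sum_apply]
  refine Finset.sum_congr rfl fun i _ => ?_
  rw [fderiv_fun_mul (h1 i) (h2 i)]
  simp

/-- Restrictions of `C¹` functions are dense in `H¹(Ω)`. -/
theorem IsSmoothBoundedDomain.exists_contDiff_norm_sub_lt (hΩ : IsSmoothBoundedDomain Ω) (u : H1 Ω)
    {ε : ℝ} (hε : 0 < ε) :
    ∃ (φ : Euc n → ℝ) (z : H1 Ω), ContDiff ℝ 1 φ ∧ H1.toL2 Ω z =ᵐ[volume.restrict Ω] φ ∧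
      ‖z - u‖ < ε := by
  have ho := hΩ.isOpen
  have hK : IsCompact (closure Ω) := hΩ.isBounded.isCompact_closure
  choose U hUo hxU e c hc t₀ ht₀ hcone using fun x : closure Ω => hΩ.exists_inner_cone x.2
  obtain ⟨s, hs⟩ := hK.elim_finite_subcover U hUo fun x hx => mem_iUnion.2 ⟨⟨x, hx⟩, hxU _⟩
  obtain ⟨χ, hχd, hχ01, hχs, hχ1⟩ := exists_smooth_partition (ι := s) isClosed_closure
    (fun i => U i) (fun i => hUo i) (hs.trans fun x hx => by
      obtain ⟨i, hi, hx⟩ := mem_iUnion₂.1 hx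
      exact mem_iUnion.2 ⟨⟨i, hi⟩, hx⟩)
  simp_rw [finsum_eq_sum_of_fintype] at hχ1
  have hM : ∀ i, ∃ M, ∀ x ∈ closure Ω, ‖gradient (χ i) x‖ ≤ M := fun i =>
    hK.exists_bound_of_continuousOn (continuous_gradient (hχd i)).continuousOn
  choose M' hM' using hM
  let M : ℝ := ∑ i, |M' i|
  have hM0 : 0 ≤ M := Finset.sum_nonneg fun i _ => abs_nonneg _
  have hMi : ∀ i, ∀ x ∈ Ω, ‖gradient (χ i) x‖ ≤ M := fun i x hx =>
    (hM' i x (subset_closure hx)).trans ((le_abs_self _).trans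
      (Finset.single_le_sum (f := fun i => |M' i|) (fun j _ => abs_nonneg _) (Finset.mem_univ i)))
  let m : ℝ := Fintype.card s
  have hm : 0 ≤ m := Nat.cast_nonneg _
  have hpos : 0 < m * (2 + M) + 1 := by positivity
  let η : ℝ := ε / (m * (2 + M) + 1)
  have hη : 0 < η := div_pos hε hpos
  have happ : ∀ i : s, _ := fun i => exists_local_approximation ho u (hc i) (ht₀ i) (hcone i)
    (ENNReal.ofReal_pos.2 hη)
  choose φ Φ hφd hΦc hφΦ hφu hΦu using happ
  have hsum : ContDiff ℝ 1 fun x => ∑ i, χ i x * φ i x :=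
    ContDiff.sum fun i _ => (hχd i).mul (hφd i)
  obtain ⟨z, hz⟩ := exists_H1_of_contDiff hΩ.isBounded hsum
  refine ⟨_, z, hsum, hz, ?_⟩
  have hgz := H1.grad_ae_eq_gradient ho hsum hz
  have hum : AEStronglyMeasurable (H1.toL2 Ω u) (volume.restrict Ω) := (Lp.memLp _).1
  have hGm : AEStronglyMeasurable (H1.grad Ω u) (volume.restrict Ω) := (Lp.memLp _).1
  have hone : ∀ x ∈ Ω, ∑ i, χ i x = 1 := fun x hx => hχ1 x (subset_closure hx)
  have hgrad0 : ∀ x ∈ Ω, ∑ i, gradient (χ i) x = 0 := by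
    intro x hx
    have h1 := gradient_sum_mul (n := n) hχd (φ := fun _ _ => 1) (fun i => contDiff_const) x
    have h2 : (fun x => ∑ i, χ i x * 1) =ᶠ[𝓝 x] fun _ => 1 := by
      filter_upwards [ho.mem_nhds hx] with y hy
      simpa using hone y hy
    rw [h2.gradient_eq, gradient_fun_const] at h1
    simpa [gradient_fun_const] using h1.symm
  have b1 : ‖H1.toL2 Ω (z - u)‖ ≤ m * η := by
    rw [map_sub, Lp.norm_def]
    refine ENNReal.toReal_le_of_le_ofReal (by positivity) ?_
    have e1 : ⇑(H1.toL2 Ω z - H1.toL2 Ω u) =ᵐ[volume.restrict Ω]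
        ∑ i, fun x => χ i x * (φ i x - H1.toL2 Ω u x) := by
      filter_upwards [Lp.coeFn_sub (H1.toL2 Ω z) (H1.toL2 Ω u), hz,
        ae_restrict_mem ho.measurableSet] with x h1 h2 h3
      rw [h1, Pi.sub_apply, h2, Finset.sum_apply]
      simp_rw [mul_sub]
      rw [Finset.sum_sub_distrib, ← Finset.sum_mul, hone x h3, one_mul]
    rw [eLpNorm_congr_ae e1]
    refine (eLpNorm_sum_le (fun i _ => (hχd i).continuous.aestronglyMeasurable.mul
      ((hφd i).continuous.aestronglyMeasurable.sub hum)) (by norm_num)).trans ?_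
    calc _ ≤ ∑ i : s, ENNReal.ofReal η := by
          refine Finset.sum_le_sum fun i _ => (eLpNorm_mono fun x => ?_).trans (hφu i)
          change ‖χ i x * (φ i x - H1.toL2 Ω u x)‖ ≤ _
          rw [norm_mul, Real.norm_of_nonneg (hχ01 i x).1]
          exact mul_le_of_le_one_left (norm_nonneg _) (hχ01 i x).2
      _ = ENNReal.ofReal (m * η) := by
          rw [Finset.sum_const, ENNReal.ofReal_mul hm, nsmul_eq_mul, Finset.card_univ,
            ENNReal.ofReal_natCast]
  have b2 : ‖H1.grad Ω (z - u)‖ ≤ m * (η + M * η) := by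
    rw [map_sub, Lp.norm_def]
    refine ENNReal.toReal_le_of_le_ofReal (by positivity) ?_
    have e1 : ⇑(H1.grad Ω z - H1.grad Ω u) =ᵐ[volume.restrict Ω]
        ∑ i, ((fun x => χ i x • (Φ i x - H1.grad Ω u x)) +
          fun x => (φ i x - H1.toL2 Ω u x) • gradient (χ i) x) := by
      filter_upwards [Lp.coeFn_sub (H1.grad Ω z) (H1.grad Ω u), hgz,
        ae_restrict_mem ho.measurableSet] with x h1 h2 h3
      rw [h1, Pi.sub_apply, h2, Finset.sum_apply, gradient_sum_mul hχd hφd]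
      have h4 : ∀ i, χ i x • gradient (φ i) x = χ i x • Φ i x := by
        intro i
        by_cases hx : x ∈ U i
        · rw [hφΦ i x ⟨h3, hx⟩]
        · rw [image_eq_zero_of_notMem_tsupport fun h => hx (hχs i h), zero_smul, zero_smul]
      simp_rw [h4, Pi.add_apply, smul_sub, sub_smul]
      rw [Finset.sum_add_distrib, Finset.sum_add_distrib, Finset.sum_sub_distrib,
        Finset.sum_sub_distrib, ← Finset.sum_smul, ← Finset.smul_sum, hone x h3, hgrad0 x h3]
      simp only [one_smul, smul_zero]; abel
    have m1 : ∀ i, AEStronglyMeasurable (fun x => χ i x • (Φ i x - H1.grad Ω u x))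
        (volume.restrict Ω) := fun i => (hχd i).continuous.aestronglyMeasurable.smul
          ((hΦc i).aestronglyMeasurable.sub hGm)
    have m2 : ∀ i, AEStronglyMeasurable (fun x => (φ i x - H1.toL2 Ω u x) • gradient (χ i) x)
        (volume.restrict Ω) := fun i => ((hφd i).continuous.aestronglyMeasurable.sub hum).smul
          (continuous_gradient (hχd i)).aestronglyMeasurable
    rw [eLpNorm_congr_ae e1]
    refine (eLpNorm_sum_le (fun i _ => (m1 i).add (m2 i)) (by norm_num)).trans ?_
    calc _ ≤ ∑ i : s, ENNReal.ofReal (η + M * η) := by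
          refine Finset.sum_le_sum fun i _ => (eLpNorm_add_le (m1 i) (m2 i) (by norm_num)).trans ?_
          rw [ENNReal.ofReal_add hη.le (by positivity), ENNReal.ofReal_mul hM0]
          refine add_le_add ((eLpNorm_mono fun x => ?_).trans (hΦu i))
            ((eLpNorm_le_mul_eLpNorm_of_ae_le_mul (g := fun x => φ i x - H1.toL2 Ω u x) ?_
              2).trans (mul_le_mul_right (hφu i) _))
          · rw [norm_smul, Real.norm_of_nonneg (hχ01 i x).1]
            exact mul_le_of_le_one_left (norm_nonneg _) (hχ01 i x).2
          · filter_upwards [ae_restrict_mem ho.measurableSet] with x hx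
            rw [norm_smul, mul_comm]
            exact mul_le_mul_of_nonneg_right (hMi i x hx) (norm_nonneg _)
      _ = ENNReal.ofReal (m * (η + M * η)) := by
          rw [Finset.sum_const, ENNReal.ofReal_mul hm, nsmul_eq_mul, Finset.card_univ,
            ENNReal.ofReal_natCast]
  calc ‖z - u‖ ≤ m * η + m * (η + M * η) := (H1.norm_le_add _).trans (add_le_add b1 b2)
    _ < (m * (2 + M) + 1) * η := by nlinarith
    _ = ε := mul_div_cancel₀ _ hpos.ne'

end GlobalDensity

/-! ### Integration near the boundary -/

section BoundaryStrip

/-- Integrals over a Lipschitz image with respect to the Hausdorff measure. -/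
theorem lintegral_euclideanHausdorffMeasure_image_le {X Y : Type*} [EMetricSpace X]
    [MeasurableSpace X] [BorelSpace X] [EMetricSpace Y] [MeasurableSpace Y] [BorelSpace Y]
    {γ : X → Y} (hγ : Measurable γ) {K : ℝ≥0} {A : Set X} (hK : LipschitzOnWith K γ A) (m : ℕ)
    {H : Y → ℝ≥0∞} (hH : Measurable H) :
    ∫⁻ y in γ '' A, H y ∂Measure.euclideanHausdorffMeasure m ≤
      (K : ℝ≥0∞) ^ m * ∫⁻ x in A, H (γ x) ∂Measure.euclideanHausdorffMeasure m := by
  have hle : (Measure.euclideanHausdorffMeasure m : Measure Y).restrict (γ '' A) ≤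
      ((K : ℝ≥0∞) ^ m) • ((Measure.euclideanHausdorffMeasure m : Measure X).restrict A).map γ := by
    refine Measure.le_iff.2 fun B hB => ?_
    rw [Measure.restrict_apply hB, Measure.smul_apply, Measure.map_apply hγ hB,
      Measure.restrict_apply (hγ hB), smul_eq_mul, ← image_preimage_inter]
    rw [Measure.euclideanHausdorffMeasure_def, Measure.euclideanHausdorffMeasure_def,
      Measure.smul_apply, Measure.smul_apply, mul_smul_comm]
    refine smul_le_smul_of_nonneg_left ?_ zero_le
    have := (hK.mono (s := γ ⁻¹' B ∩ A) inter_subset_right).hausdorffMeasure_image_le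
      (d := (m : ℝ)) (Nat.cast_nonneg m)
    rwa [ENNReal.rpow_natCast] at this
  refine (lintegral_mono' hle le_rfl).trans (le_of_eq ?_)
  rw [lintegral_smul_measure, lintegral_map hH hγ, smul_eq_mul]

variable {n : ℕ} {Ω : Set (Euc n)}

/-- The splitting of `ℝⁿ` into the hyperplane orthogonal to the unit vector `e` and the line spanned
by `e`. -/
def orthogonalSplitting (e : Euc n) (he : ‖e‖ = 1) :
    ((Submodule.span ℝ {e})ᗮ × ℝ) ≃L[ℝ] Euc n :=
  LinearEquiv.toContinuousLinearEquiv
    { toFun := fun p => (p.1 : Euc n) + p.2 • e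
      map_add' := fun p q => by
        simp only [Prod.fst_add, Prod.snd_add, Submodule.coe_add, add_smul]; abel
      map_smul' := fun c p => by simp [smul_add, smul_smul]
      invFun := fun x => (⟨x - ⟪x, e⟫_ℝ • e, by
        rw [Submodule.mem_orthogonal_singleton_iff_inner_left, inner_sub_left,
          real_inner_smul_left, real_inner_self_eq_norm_sq, he]; ring⟩, ⟪x, e⟫_ℝ)
      left_inv := fun p => by
        have h : ⟪(p.1 : Euc n), e⟫_ℝ = 0 :=
          Submodule.mem_orthogonal_singleton_iff_inner_left.1 p.1.2
        have h2 : ⟪(p.1 : Euc n) + p.2 • e, e⟫_ℝ = p.2 := by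
          rw [inner_add_left, h, real_inner_smul_left, real_inner_self_eq_norm_sq, he]; ring
        ext1
        · ext1
          simp only [h2, add_sub_cancel_right]
        · exact h2
      right_inv := fun x => by simp }

/-- Fubini's theorem for the splitting into a hyperplane and a line. The Hausdorff measure of the
hyperplane is a Haar measure, so that its product with the Lebesgue measure of the line is a
multiple of the Lebesgue measure of `ℝⁿ`. -/
theorem exists_lintegral_orthogonalSplitting_le (e : Euc n) (he : ‖e‖ = 1) :
    ∃ C : ℝ≥0, ∀ F : Euc n → ℝ≥0∞, Measurable F →
      ∫⁻ w : (Submodule.span ℝ {e})ᗮ, (∫⁻ s : ℝ, F ((w : Euc n) + s • e))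
        ∂Measure.euclideanHausdorffMeasure (n - 1) ≤ C * ∫⁻ x, F x := by
  have hn : 1 ≤ n := by
    rcases Nat.eq_zero_or_pos n with rfl | h
    · have : e = 0 := Subsingleton.elim _ _
      simp [this] at he
    · exact h
  have hfin : Module.finrank ℝ (Submodule.span ℝ {e})ᗮ = n - 1 := by
    have : Fact (Module.finrank ℝ (Euc n) = (n - 1) + 1) := ⟨by simp; omega⟩
    exact Submodule.finrank_orthogonal_span_singleton (by rintro rfl; simp at he)
  have hH : (Measure.euclideanHausdorffMeasure (n - 1) :
      Measure (Submodule.span ℝ {e})ᗮ).IsAddHaarMeasure := by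
    rw [← hfin]; infer_instance
  set ν : Measure (Submodule.span ℝ {e})ᗮ := Measure.euclideanHausdorffMeasure (n - 1)
  have hmap : ((ν.prod volume).map (orthogonalSplitting e he)).IsAddHaarMeasure :=
    (orthogonalSplitting e he).isAddHaarMeasure_map (ν.prod volume)
  obtain ⟨C, heq⟩ : ∃ C : ℝ≥0, (ν.prod volume).map (orthogonalSplitting e he) = C • volume :=
    ⟨_, Measure.isAddLeftInvariant_eq_smul ((ν.prod volume).map (orthogonalSplitting e he))
      (volume : Measure (Euc n))⟩
  refine ⟨C, fun F hF => le_of_eq ?_⟩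
  · have hm : Measurable (orthogonalSplitting e he) := (orthogonalSplitting e he).continuous.measurable
    have h1 : ∫⁻ x, F x ∂((ν.prod volume).map (orthogonalSplitting e he)) =
        ∫⁻ w, (∫⁻ s : ℝ, F ((w : Euc n) + s • e)) ∂ν := by
      rw [lintegral_map hF hm, lintegral_prod (fun p => F (orthogonalSplitting e he p))
        (hF.comp hm).aemeasurable]
      rfl
    rw [← h1, heq, lintegral_smul_measure]
    rfl

/-- Near a boundary point, integrating over the boundary and then along short segments pointing
inwards is controlled by integration over the domain. -/
theorem IsSmoothBoundedDomain.exists_boundary_strip (hΩ : IsSmoothBoundedDomain Ω) {x : Euc n}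
    (hx : x ∈ frontier Ω) :
    ∃ U : Set (Euc n), IsOpen U ∧ x ∈ U ∧ ∃ e : Euc n, ‖e‖ = 1 ∧ ∃ δ > (0 : ℝ), ∃ C : ℝ≥0,
      ∀ F : Euc n → ℝ≥0∞, Measurable F →
        ∫⁻ y in frontier Ω ∩ U, (∫⁻ s in Ioo 0 δ, F (y + s • e))
          ∂Measure.euclideanHausdorffMeasure (n - 1) ≤ C * ∫⁻ y in Ω, F y := by
  obtain ⟨e, ψ, he, hψ, hV⟩ := hΩ.smooth_boundary x hx
  have hee : ⟪e, e⟫_ℝ = 1 := by rw [real_inner_self_eq_norm_sq, he, one_pow]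
  set P : Euc n → Euc n := fun y => y - ⟪y, e⟫_ℝ • e with hP
  have hPc : Continuous P := by fun_prop
  have hψ1 : ContDiff ℝ 1 ψ := hψ.of_le (by simp)
  obtain ⟨K, V', hV', hK⟩ := hψ1.locallyLipschitz (P x)
  obtain ⟨δ, hδ, hball⟩ := Metric.eventually_nhds_iff_ball.1
    (hV.and (hPc.continuousAt.preimage_mem_nhds hV'))
  set U := Metric.ball x (δ / 2) with hU
  have hUδ : ∀ y ∈ U, ∀ s ∈ Ioo 0 (δ / 2), y + s • e ∈ Metric.ball x δ := by
    intro y hy s hs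
    have h1 := mem_ball_iff_norm.1 hy
    rw [mem_ball_iff_norm]
    calc ‖y + s • e - x‖ = ‖(y - x) + s • e‖ := by congr 1; abel
      _ ≤ ‖y - x‖ + ‖s • e‖ := norm_add_le _ _
      _ < δ := by rw [norm_smul, he, mul_one, Real.norm_of_nonneg hs.1.le]; linarith [hs.2]
  have hUb : U ⊆ Metric.ball x δ := Metric.ball_subset_ball (by linarith)
  -- on `U` the boundary is the graph of `ψ`
  have hgraph : ∀ y ∈ frontier Ω ∩ U, ψ (P y) = ⟪y, e⟫_ℝ := by
    rintro y ⟨hyf, hyU⟩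
    rw [hΩ.isOpen.frontier_eq] at hyf
    refine le_antisymm ?_ (not_lt.1 fun h => hyf.2 ((hball y (hUb hyU)).1.2 h))
    have hfr : ∃ᶠ z in 𝓝 y, z ∈ Ω := mem_closure_iff_frequently.1 hyf.1
    have hfr' : ∃ᶠ z in 𝓝 y, ψ (P z) ≤ ⟪z, e⟫_ℝ :=
      (hfr.and_eventually (Metric.isOpen_ball.mem_nhds (hUb hyU))).mono fun z hz =>
        ((hball z hz.2).1.1 hz.1).le
    have hcl : IsClosed {z : Euc n | ψ (P z) ≤ ⟪z, e⟫_ℝ} :=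
      isClosed_le (hψ.continuous.comp hPc) (by fun_prop)
    exact hcl.closure_subset (mem_closure_iff_frequently.2 hfr')
  obtain ⟨C, hC⟩ := exists_lintegral_orthogonalSplitting_le e he
  let W := (Submodule.span ℝ {e})ᗮ
  let γ : W → Euc n := fun w => (w : Euc n) + ψ w • e
  let A : Set W := {w | γ w ∈ frontier Ω ∩ U}
  have hγc : Continuous γ := by
    have := hψ.continuous
    fun_prop
  have hwe : ∀ w : W, ⟪(w : Euc n), e⟫_ℝ = 0 := fun w =>
    Submodule.mem_orthogonal_singleton_iff_inner_left.1 w.2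
  have hPγ : ∀ (w : W) (s : ℝ), P ((w : Euc n) + s • e) = w := by
    intro w s
    simp only [hP]
    rw [inner_add_left, hwe, real_inner_smul_left, hee, zero_add, mul_one, add_sub_cancel_right]
  have himg : γ '' A = frontier Ω ∩ U := by
    refine Subset.antisymm (image_subset_iff.2 fun w hw => hw) fun y hy => ?_
    have hyW : P y ∈ W := by
      rw [Submodule.mem_orthogonal_singleton_iff_inner_left]
      simp only [hP]
      rw [inner_sub_left, real_inner_smul_left, hee]; ring
    have hγy : γ ⟨P y, hyW⟩ = y := by
      simp only [γ]
      rw [hgraph y hy]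
      simp [hP]
    exact ⟨⟨P y, hyW⟩, by simpa only [A, mem_ofPred_eq, hγy] using hy, hγy⟩
  have hLip : LipschitzOnWith (1 + K) γ A := by
    refine LipschitzOnWith.of_dist_le_mul fun w hw w' hw' => ?_
    have hm : ∀ v ∈ A, (v : Euc n) ∈ V' := fun v hv => by
      have := (hball _ (hUb hv.2)).2
      change P (γ v) ∈ V' at this
      rwa [hPγ] at this
    have h1 := hK.dist_le_mul _ (hm w hw) _ (hm w' hw')
    rw [Real.dist_eq] at h1
    have h0 : dist w w' = ‖(w : Euc n) - w'‖ := by rw [Subtype.dist_eq, dist_eq_norm]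
    rw [h0, dist_eq_norm]
    rw [dist_eq_norm] at h1
    calc ‖γ w - γ w'‖ = ‖((w : Euc n) - w') + (ψ w - ψ w') • e‖ := by
          simp only [γ, sub_smul]; congr 1; abel
      _ ≤ ‖(w : Euc n) - w'‖ + ‖(ψ w - ψ w') • e‖ := norm_add_le _ _
      _ ≤ ‖(w : Euc n) - w'‖ + K * ‖(w : Euc n) - w'‖ := by
          rw [norm_smul, he, mul_one, Real.norm_eq_abs]; gcongr
      _ = _ := by push_cast; ring
  refine ⟨U, Metric.isOpen_ball, Metric.mem_ball_self (by positivity), e, he, δ / 2, by positivity,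
    (1 + K) ^ (n - 1) * C, fun F hF => ?_⟩
  have hHm : Measurable fun y : Euc n => ∫⁻ s in Ioo 0 (δ / 2), F (y + s • e) :=
    Measurable.lintegral_prod_right' (f := fun p : Euc n × ℝ => F (p.1 + p.2 • e))
      (hF.comp (by fun_prop))
  have hFm : Measurable (Ω.indicator F) := hF.indicator hΩ.isOpen.measurableSet
  rw [← himg]
  refine (lintegral_euclideanHausdorffMeasure_image_le hγc.measurable hLip _ hHm).trans ?_
  push_cast
  rw [mul_assoc]
  refine mul_le_mul_right ?_ _
  rw [← lintegral_indicator hΩ.isOpen.measurableSet]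
  refine le_trans ?_ (hC _ hFm)
  have hAm : MeasurableSet A :=
    hγc.measurable (isClosed_frontier.measurableSet.inter Metric.isOpen_ball.measurableSet)
  refine le_trans (setLIntegral_mono' hAm fun w hw => ?_) (setLIntegral_le_lintegral A _)
  calc ∫⁻ s in Ioo 0 (δ / 2), F (γ w + s • e)
      ≤ ∫⁻ s in Ioo 0 (δ / 2), Ω.indicator F (γ w + s • e) := by
        refine setLIntegral_mono' measurableSet_Ioo fun s hs => ?_
        have hmem : γ w + s • e ∈ Ω := by
          refine (hball _ (hUδ _ hw.2 s hs)).1.2 ?_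
          have h1 : γ w + s • e = (w : Euc n) + (ψ w + s) • e := by
            simp only [γ, add_smul]; abel
          have h2 := hPγ w (ψ w + s)
          rw [← h1] at h2
          change ψ (P (γ w + s • e)) < _
          rw [h2, h1, inner_add_left, hwe, real_inner_smul_left, hee]
          linarith [hs.1]
        rw [indicator_of_mem hmem]
    _ ≤ ∫⁻ s : ℝ, Ω.indicator F (γ w + s • e) := setLIntegral_le_lintegral _ _
    _ = ∫⁻ s : ℝ, Ω.indicator F ((w : Euc n) + (ψ w + s) • e) := by
        refine lintegral_congr fun s => ?_
        congr 1
        simp only [γ, add_smul]; abel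
    _ = ∫⁻ s : ℝ, Ω.indicator F ((w : Euc n) + s • e) :=
        lintegral_add_left_eq_self (fun s => Ω.indicator F ((w : Euc n) + s • e)) (ψ w)

end BoundaryStrip

/-! ### Traces -/

section TraceInequality

/-- A one-dimensional trace inequality. -/
theorem mul_apply_zero_le_integral {g q : ℝ → ℝ} (hg : ContDiff ℝ 1 g) (hq : Continuous q)
    (hgq : ∀ s, g s ≤ q s) (hdq : ∀ s, |deriv g s| ≤ q s) {δ : ℝ} (hδ : 0 < δ) :
    δ * g 0 ≤ (1 + δ) * ∫ s in (0 : ℝ)..δ, q s := by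
  have hgc := hg.continuous
  have hdc : Continuous (deriv g) := hg.continuous_deriv le_rfl
  have hq0 : ∀ s, 0 ≤ q s := fun s => (abs_nonneg _).trans (hdq s)
  have h1 : ∀ s ∈ Icc 0 δ, g 0 ≤ g s + ∫ r in (0 : ℝ)..δ, q r := by
    intro s hs
    have e1 : ∫ r in (0 : ℝ)..s, deriv g r = g s - g 0 :=
      intervalIntegral.integral_deriv_eq_sub (fun r _ => (hg.differentiable one_ne_zero) r)
        (hdc.intervalIntegrable _ _)
    have e2 : -∫ r in (0 : ℝ)..s, q r ≤ ∫ r in (0 : ℝ)..s, deriv g r := by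
      rw [← intervalIntegral.integral_neg]
      exact intervalIntegral.integral_mono_on hs.1 (hq.neg.intervalIntegrable _ _)
        (hdc.intervalIntegrable _ _) fun r _ => (abs_le.1 (hdq r)).1
    have e3 : ∫ r in (0 : ℝ)..s, q r ≤ ∫ r in (0 : ℝ)..δ, q r := by
      rw [← intervalIntegral.integral_add_adjacent_intervals (hq.intervalIntegrable 0 s)
        (hq.intervalIntegrable s δ)]
      linarith [intervalIntegral.integral_nonneg (μ := volume) hs.2 fun r _ => hq0 r]
    linarith
  have h2 : ∫ s in (0 : ℝ)..δ, g 0 ≤ ∫ s in (0 : ℝ)..δ, (q s + ∫ r in (0 : ℝ)..δ, q r) :=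
    intervalIntegral.integral_mono_on hδ.le (continuous_const.intervalIntegrable _ _)
      ((hq.add continuous_const).intervalIntegrable _ _) fun s hs =>
        (h1 s hs).trans (by linarith [hgq s])
  rw [intervalIntegral.integral_const, intervalIntegral.integral_add (hq.intervalIntegrable _ _)
    (continuous_const.intervalIntegrable _ _), intervalIntegral.integral_const, sub_zero,
    smul_eq_mul, smul_eq_mul] at h2
  linarith

variable {n : ℕ} {Ω : Set (Euc n)}

theorem abs_fderiv_sq_le (φ : Euc n → ℝ) {e : Euc n} (he : ‖e‖ = 1) (y : Euc n) :
    |2 * φ y * fderiv ℝ φ y e| ≤ φ y ^ 2 + ‖gradient φ y‖ ^ 2 := by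
  have h1 : |fderiv ℝ φ y e| ≤ ‖gradient φ y‖ := by
    rw [← inner_gradient]
    simpa [he] using abs_real_inner_le_norm (gradient φ y) e
  rw [abs_mul, abs_mul, abs_two, ← sq_abs (φ y)]
  nlinarith [sq_nonneg (|φ y| - ‖gradient φ y‖), abs_nonneg (φ y),
    mul_le_mul_of_nonneg_left h1 (abs_nonneg (φ y))]

/-- The trace inequality for `C¹` functions. Locally it follows from the one-dimensional inequality
on segments pointing inwards; the boundary is compact. -/
theorem IsSmoothBoundedDomain.exists_lintegral_frontier_le (hΩ : IsSmoothBoundedDomain Ω) :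
    ∃ C : ℝ≥0, ∀ φ : Euc n → ℝ, ContDiff ℝ 1 φ →
      ∫⁻ y in frontier Ω, ENNReal.ofReal (φ y ^ 2) ∂Measure.euclideanHausdorffMeasure (n - 1) ≤
        C * ∫⁻ y in Ω, ENNReal.ofReal (φ y ^ 2 + ‖gradient φ y‖ ^ 2) := by
  have hK : IsCompact (frontier Ω) :=
    hΩ.isBounded.isCompact_closure.of_isClosed_subset isClosed_frontier frontier_subset_closure
  refine hK.induction_on (p := fun S => ∃ C : ℝ≥0, ∀ φ : Euc n → ℝ, ContDiff ℝ 1 φ →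
      ∫⁻ y in S, ENNReal.ofReal (φ y ^ 2) ∂Measure.euclideanHausdorffMeasure (n - 1) ≤
        C * ∫⁻ y in Ω, ENNReal.ofReal (φ y ^ 2 + ‖gradient φ y‖ ^ 2)) ⟨0, fun φ _ => by simp⟩ ?_ ?_ ?_
  · rintro S S' hS ⟨C, hC⟩
    exact ⟨C, fun φ hφ => (lintegral_mono_set hS).trans (hC φ hφ)⟩
  · rintro S S' ⟨C, hC⟩ ⟨C', hC'⟩
    refine ⟨C + C', fun φ hφ => (lintegral_union_le _ _ _).trans ?_⟩
    rw [ENNReal.coe_add, add_mul]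
    exact add_le_add (hC φ hφ) (hC' φ hφ)
  · intro x hx
    obtain ⟨U, hU, hxU, e, he, δ, hδ, C, hC⟩ := hΩ.exists_boundary_strip hx
    refine ⟨frontier Ω ∩ U, inter_mem_nhdsWithin _ (hU.mem_nhds hxU),
      Real.toNNReal ((1 + δ) / δ) * C, fun φ hφ => ?_⟩
    set Q : Euc n → ℝ := fun y => φ y ^ 2 + ‖gradient φ y‖ ^ 2 with hQ
    have hQc : Continuous Q := (hφ.continuous.pow 2).add ((continuous_gradient hφ).norm.pow 2)
    have hpt : ∀ y, ENNReal.ofReal (φ y ^ 2) ≤ ENNReal.ofReal ((1 + δ) / δ) *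
        ∫⁻ s in Ioo 0 δ, ENNReal.ofReal (Q (y + s • e)) := by
      intro y
      have hline : ContDiff ℝ 1 fun s : ℝ => y + s • e := by fun_prop
      have hqc : Continuous fun s : ℝ => Q (y + s • e) := hQc.comp hline.continuous
      have hd : ∀ s, HasDerivAt (fun s : ℝ => φ (y + s • e) ^ 2)
          (2 * φ (y + s • e) * fderiv ℝ φ (y + s • e) e) s := by
        intro s
        have h1 : HasDerivAt (fun s : ℝ => y + s • e) e s := by
          simpa using ((hasDerivAt_id s).smul_const e).const_add y
        have h2 := ((hφ.differentiable one_ne_zero (y + s • e)).hasFDerivAt.comp_hasDerivAt s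
          h1).pow 2
        exact h2.congr_deriv (by simp)
      have h1 := mul_apply_zero_le_integral ((hφ.comp hline).pow 2) hqc
        (fun s => le_add_of_nonneg_right (sq_nonneg _)) (fun s => by
          have : deriv (fun s => (φ ∘ fun s : ℝ => y + s • e) s ^ 2) s = _ := (hd s).deriv
          rw [this]
          exact abs_fderiv_sq_le φ he _) hδ
      have h2 : φ y ^ 2 ≤ (1 + δ) / δ * ∫ s in (0 : ℝ)..δ, Q (y + s • e) := by
        rw [div_mul_eq_mul_div, le_div_iff₀ hδ, mul_comm]
        simpa using h1
      refine (ENNReal.ofReal_le_ofReal h2).trans ?_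
      rw [ENNReal.ofReal_mul (by positivity), intervalIntegral.integral_of_le hδ.le,
        integral_Ioc_eq_integral_Ioo, ofReal_integral_eq_lintegral_ofReal]
      · exact (hqc.integrableOn_Icc).mono_set Ioo_subset_Icc_self
      · exact ae_of_all _ fun s => by positivity
    calc _ ≤ ∫⁻ y in frontier Ω ∩ U, (ENNReal.ofReal ((1 + δ) / δ) *
          ∫⁻ s in Ioo 0 δ, ENNReal.ofReal (Q (y + s • e)))
            ∂Measure.euclideanHausdorffMeasure (n - 1) := lintegral_mono hpt
      _ = ENNReal.ofReal ((1 + δ) / δ) * ∫⁻ y in frontier Ω ∩ U,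
          (∫⁻ s in Ioo 0 δ, ENNReal.ofReal (Q (y + s • e)))
            ∂Measure.euclideanHausdorffMeasure (n - 1) :=
          lintegral_const_mul' _ _ ENNReal.ofReal_ne_top
      _ ≤ ENNReal.ofReal ((1 + δ) / δ) * (C * ∫⁻ y in Ω, ENNReal.ofReal (Q y)) :=
          mul_le_mul_right (hC _ hQc.measurable.ennreal_ofReal) _
      _ = _ := by rw [ENNReal.coe_mul, mul_assoc]; rfl

/-- The boundary has finite surface measure: this is the trace inequality for the constant `1`. -/
theorem IsSmoothBoundedDomain.isFiniteMeasure_surface (hΩ : IsSmoothBoundedDomain Ω) :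
    IsFiniteMeasure (surface (frontier Ω)) := by
  obtain ⟨C, hC⟩ := hΩ.exists_lintegral_frontier_le
  have h := hC (fun _ => 1) contDiff_const
  simp only [gradient_fun_const, one_pow, norm_zero, ne_eq, OfNat.ofNat_ne_zero, not_false_eq_true,
    zero_pow, add_zero, ENNReal.ofReal_one, lintegral_const, one_mul, Measure.restrict_apply
    MeasurableSet.univ, univ_inter] at h
  refine ⟨?_⟩
  rw [surface, Measure.restrict_apply MeasurableSet.univ, univ_inter]
  exact h.trans_lt (ENNReal.mul_lt_top ENNReal.coe_lt_top hΩ.isBounded.measure_lt_top)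

theorem IsSmoothBoundedDomain.memLp_surface (hΩ : IsSmoothBoundedDomain Ω) {F : Type*}
    [NormedAddCommGroup F] {f : Euc n → F} (hf : Continuous f) :
    MemLp f 2 (surface (frontier Ω)) := by
  have := hΩ.isFiniteMeasure_surface
  obtain ⟨M, hM⟩ := hΩ.isBounded.isCompact_closure.exists_bound_of_continuousOn hf.continuousOn
  refine MemLp.of_bound hf.aestronglyMeasurable M ?_
  exact (ae_restrict_mem isClosed_frontier.measurableSet).mono fun x hx =>
    hM x (frontier_subset_closure hx)

/-- The trace inequality for restrictions of `C¹` functions, in terms of the norms of `L²(∂Ω)` and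
`H¹(Ω)`. -/
theorem IsSmoothBoundedDomain.exists_norm_le_of_contDiff (hΩ : IsSmoothBoundedDomain Ω) :
    ∃ C : ℝ, 0 ≤ C ∧ ∀ (φ : Euc n → ℝ) (z : H1 Ω) (w : L2surf (frontier Ω)), ContDiff ℝ 1 φ →
      H1.toL2 Ω z =ᵐ[volume.restrict Ω] φ → w =ᵐ[surface (frontier Ω)] φ → ‖w‖ ≤ C * ‖z‖ := by
  obtain ⟨C, hC⟩ := hΩ.exists_lintegral_frontier_le
  refine ⟨√C, Real.sqrt_nonneg _, fun φ z w hφ hz hw => ?_⟩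
  have hg := H1.grad_ae_eq_gradient hΩ.isOpen hφ hz
  have m1 := hΩ.memLp_surface hφ.continuous
  have m2 := memLp_restrict_of_continuous hΩ.isBounded hφ.continuous
  have m3 := memLp_restrict_of_continuous hΩ.isBounded (continuous_gradient hφ)
  have e1 : ‖w‖ ^ 2 = ∫ y, φ y ^ 2 ∂surface (frontier Ω) := by
    have : w = m1.toLp φ := Lp.ext (hw.trans m1.coeFn_toLp.symm)
    rw [this, norm_toLp_sq]
    simp_rw [Real.norm_eq_abs, sq_abs]
  have e2 : ‖z‖ ^ 2 = ∫ y in Ω, (φ y ^ 2 + ‖gradient φ y‖ ^ 2) := by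
    have h1 : H1.toL2 Ω z = m2.toLp φ := Lp.ext (hz.trans m2.coeFn_toLp.symm)
    have h2 : H1.grad Ω z = m3.toLp _ := Lp.ext (hg.trans m3.coeFn_toLp.symm)
    have i1 : Integrable (fun y => φ y ^ 2) (volume.restrict Ω) := m2.integrable_sq
    rw [H1.norm_sq, h1, h2, norm_toLp_sq, norm_toLp_sq, integral_add i1 m3.norm.integrable_sq]
    simp_rw [Real.norm_eq_abs, sq_abs]
  have i2 : Integrable (fun y => φ y ^ 2 + ‖gradient φ y‖ ^ 2) (volume.restrict Ω) :=
    m2.integrable_sq.add m3.norm.integrable_sq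
  have key := hC φ hφ
  rw [← ofReal_integral_eq_lintegral_ofReal (μ := (Measure.euclideanHausdorffMeasure
      (n - 1)).restrict (frontier Ω)) m1.integrable_sq (ae_of_all _ fun y => sq_nonneg _),
    ← ofReal_integral_eq_lintegral_ofReal i2 (ae_of_all _ fun y => by positivity), ← e2,
    ← ENNReal.ofReal_coe_nnreal, ← ENNReal.ofReal_mul (NNReal.coe_nonneg C),
    ENNReal.ofReal_le_ofReal_iff (by positivity)] at key
  have e3 : ‖w‖ ^ 2 ≤ C * ‖z‖ ^ 2 := e1.trans_le key
  refine le_of_sq_le_sq ?_ (by positivity)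
  rw [mul_pow, Real.sq_sqrt (NNReal.coe_nonneg C)]
  exact e3

end TraceInequality

section TraceOperator

variable {n : ℕ} {Ω : Set (Euc n)}

/-- The pairs `(φ|_Ω, φ|_∂Ω)` with `φ` of class `C¹`. -/
def smoothTraceGraph (Ω : Set (Euc n)) : Submodule ℝ (H1 Ω × L2surf (frontier Ω)) where
  carrier := {p | ∃ φ : Euc n → ℝ, ContDiff ℝ 1 φ ∧
    H1.toL2 Ω p.1 =ᵐ[volume.restrict Ω] φ ∧ p.2 =ᵐ[surface (frontier Ω)] φ}
  add_mem' := by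
    rintro p q ⟨φ, hφ, h1, h2⟩ ⟨χ, hχ, h3, h4⟩
    refine ⟨φ + χ, hφ.add hχ, ?_, ?_⟩
    · rw [Prod.fst_add, map_add]
      exact (Lp.coeFn_add _ _).trans (h1.add h3)
    · exact (Lp.coeFn_add _ _).trans (h2.add h4)
  zero_mem' := ⟨0, contDiff_const, by
    rw [Prod.fst_zero, map_zero]; exact Lp.coeFn_zero _ _ _, Lp.coeFn_zero _ _ _⟩
  smul_mem' := by
    rintro c p ⟨φ, hφ, h1, h2⟩
    refine ⟨c • φ, contDiff_const.smul hφ, ?_, ?_⟩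
    · rw [Prod.smul_fst, map_smul]
      exact (Lp.coeFn_smul _ _).trans (h1.const_smul c)
    · exact (Lp.coeFn_smul _ _).trans (h2.const_smul c)

theorem IsTrace.norm_le {C : ℝ} (hC : ∀ (φ : Euc n → ℝ) (z : H1 Ω) (w : L2surf (frontier Ω)),
      ContDiff ℝ 1 φ → H1.toL2 Ω z =ᵐ[volume.restrict Ω] φ → w =ᵐ[surface (frontier Ω)] φ →
        ‖w‖ ≤ C * ‖z‖) {u : H1 Ω} {w : L2surf (frontier Ω)} (h : IsTrace u w) :
    ‖w‖ ≤ C * ‖u‖ := by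
  have hcl : IsClosed {p : H1 Ω × L2surf (frontier Ω) | ‖p.2‖ ≤ C * ‖p.1‖} :=
    isClosed_le (continuous_norm.comp continuous_snd)
      (continuous_const.mul (continuous_norm.comp continuous_fst))
  have hsub : (smoothTraceGraph Ω : Set (H1 Ω × L2surf (frontier Ω))) ⊆
      {p | ‖p.2‖ ≤ C * ‖p.1‖} := by
    rintro p ⟨φ, hφ, h1, h2⟩
    exact hC φ p.1 p.2 hφ h1 h2
  have h1 : (u, w) ∈ closure (smoothTraceGraph Ω : Set (H1 Ω × L2surf (frontier Ω))) := h
  have h2 := closure_minimal hsub hcl h1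
  rwa [mem_ofPred_eq] at h2

theorem IsTrace.add {u u' : H1 Ω} {w w' : L2surf (frontier Ω)} (h : IsTrace u w)
    (h' : IsTrace u' w') : IsTrace (u + u') (w + w') :=
  (smoothTraceGraph Ω).topologicalClosure.add_mem (x := (u, w)) (y := (u', w')) h h'

theorem IsTrace.smul {u : H1 Ω} {w : L2surf (frontier Ω)} (c : ℝ) (h : IsTrace u w) :
    IsTrace (c • u) (c • w) :=
  (smoothTraceGraph Ω).topologicalClosure.smul_mem (x := (u, w)) c h

theorem IsSmoothBoundedDomain.isTrace_unique (hΩ : IsSmoothBoundedDomain Ω) {u : H1 Ω}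
    {w w' : L2surf (frontier Ω)} (h : IsTrace u w) (h' : IsTrace u w') : w = w' := by
  obtain ⟨C, -, hC⟩ := hΩ.exists_norm_le_of_contDiff
  have h1 := (h.add (h'.smul (-1))).norm_le hC
  rw [neg_one_smul, neg_one_smul, add_neg_cancel, norm_zero, mul_zero, ← sub_eq_add_neg] at h1
  exact sub_eq_zero.1 (norm_le_zero_iff.1 h1)

/-- A function of `H¹(Ω)` is approximated by restrictions of `C¹` functions, whose boundary values
converge to its trace. -/
theorem IsSmoothBoundedDomain.exists_seq_tendsto (hΩ : IsSmoothBoundedDomain Ω) (u : H1 Ω) :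
    ∃ (φ : ℕ → Euc n → ℝ) (z : ℕ → H1 Ω) (w : ℕ → L2surf (frontier Ω)) (w' : L2surf (frontier Ω)),
      (∀ k, ContDiff ℝ 1 (φ k)) ∧ (∀ k, H1.toL2 Ω (z k) =ᵐ[volume.restrict Ω] φ k) ∧
      (∀ k, w k =ᵐ[surface (frontier Ω)] φ k) ∧ Tendsto z atTop (𝓝 u) ∧
      Tendsto w atTop (𝓝 w') ∧ IsTrace u w' := by
  obtain ⟨C, hC0, hC⟩ := hΩ.exists_norm_le_of_contDiff
  choose φ z hφ hz hzu using fun k : ℕ =>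
    hΩ.exists_contDiff_norm_sub_lt u (Nat.one_div_pos_of_nat (α := ℝ) (n := k))
  have hm := fun k => hΩ.memLp_surface (hφ k).continuous
  let w : ℕ → L2surf (frontier Ω) := fun k => (hm k).toLp (φ k)
  have hzt : Tendsto z atTop (𝓝 u) := tendsto_iff_norm_sub_tendsto_zero.2
    (squeeze_zero (fun k => norm_nonneg _) (fun k => (hzu k).le)
      tendsto_one_div_add_atTop_nhds_zero_nat)
  have hmem : ∀ k, (z k, w k) ∈ smoothTraceGraph Ω := fun k => ⟨φ k, hφ k, hz k, (hm k).coeFn_toLp⟩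
  have hcau : CauchySeq w := by
    refine Metric.cauchySeq_iff'.2 fun ε hε => ?_
    obtain ⟨N, hN⟩ := Metric.cauchySeq_iff'.1 hzt.cauchySeq (ε / (C + 1)) (by positivity)
    refine ⟨N, fun k hk => ?_⟩
    obtain ⟨χ, hχ, h1, h2⟩ := (smoothTraceGraph Ω).sub_mem (hmem k) (hmem N)
    have h3 := hC χ (z k - z N) (w k - w N) hχ h1 h2
    have h4 := hN k hk
    rw [dist_eq_norm] at h4 ⊢
    rw [lt_div_iff₀ (by positivity)] at h4
    nlinarith [norm_nonneg (z k - z N)]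
  obtain ⟨w', hw'⟩ := cauchySeq_tendsto_of_complete hcau
  exact ⟨φ, z, w, w', hφ, hz, fun k => (hm k).coeFn_toLp, hzt, hw',
    mem_closure_of_tendsto (hzt.prodMk_nhds hw') (Eventually.of_forall hmem)⟩

theorem IsSmoothBoundedDomain.isTrace_trace (hΩ : IsSmoothBoundedDomain Ω) (u : H1 Ω) :
    IsTrace u (trace u) := by
  obtain ⟨-, -, -, w, -, -, -, -, -, h⟩ := hΩ.exists_seq_tendsto u
  have h' : ∃ w, IsTrace u w := ⟨w, h⟩
  rw [trace, dif_pos h']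
  exact h'.choose_spec

theorem IsSmoothBoundedDomain.trace_eq (hΩ : IsSmoothBoundedDomain Ω) {u : H1 Ω}
    {w : L2surf (frontier Ω)} (h : IsTrace u w) : trace u = w :=
  hΩ.isTrace_unique (hΩ.isTrace_trace u) h

/-- The trace operator, as a bounded linear map. -/
theorem IsSmoothBoundedDomain.exists_traceCLM (hΩ : IsSmoothBoundedDomain Ω) :
    ∃ τ : H1 Ω →L[ℝ] L2surf (frontier Ω), ∀ u, τ u = trace u := by
  obtain ⟨C, -, hC⟩ := hΩ.exists_norm_le_of_contDiff
  exact ⟨LinearMap.mkContinuous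
    { toFun := trace
      map_add' := fun u v => hΩ.trace_eq ((hΩ.isTrace_trace u).add (hΩ.isTrace_trace v))
      map_smul' := fun c u => hΩ.trace_eq ((hΩ.isTrace_trace u).smul c) } C
    fun u => (hΩ.isTrace_trace u).norm_le hC, fun u => rfl⟩

end TraceOperator

/-! ### Composition with monotone Lipschitz functions -/

section ChainRule

/-- A monotone Lipschitz function is a uniform limit of `C¹` functions with the same monotonicity and
Lipschitz constant. -/
theorem exists_contDiff_monotone_approximation {b : ℝ → ℝ} (hb : Monotone b) {L : ℝ≥0}
    (hL : LipschitzWith L b) {h : ℝ} (hh : 0 < h) :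
    ∃ b' : ℝ → ℝ, ContDiff ℝ 1 b' ∧ (∀ r, 0 ≤ deriv b' r ∧ deriv b' r ≤ L) ∧
      ∀ r, |b' r - b r| ≤ L * h := by
  have hbc := hL.continuous
  have hd : ∀ r, HasDerivAt (fun r => ∫ s in (0 : ℝ)..r, b s) (b r) r := fun r =>
    intervalIntegral.integral_hasDerivAt_right (hbc.intervalIntegrable _ _)
      (hbc.stronglyMeasurableAtFilter _ _) hbc.continuousAt
  have hd' : ∀ r, HasDerivAt (fun r => h⁻¹ * ((∫ s in (0 : ℝ)..(r + h), b s) - ∫ s in (0 : ℝ)..r, b s))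
      (h⁻¹ * (b (r + h) - b r)) r := fun r =>
    (((hd (r + h)).comp_add_const r h).sub (hd r)).const_mul _
  have hd'' : deriv (fun r => h⁻¹ * ((∫ s in (0 : ℝ)..(r + h), b s) - ∫ s in (0 : ℝ)..r, b s)) =
      fun r => h⁻¹ * (b (r + h) - b r) := funext fun r => (hd' r).deriv
  have hlip : ∀ r s : ℝ, |b r - b s| ≤ L * |r - s| := fun r s => by
    simpa [Real.dist_eq] using hL.dist_le_mul r s
  refine ⟨_, contDiff_one_iff_deriv.2 ⟨fun r => (hd' r).differentiableAt, ?_⟩, fun r => ?_,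
    fun r => ?_⟩
  · rw [hd'']; fun_prop
  · rw [hd'']
    have h1 := hb (le_add_of_nonneg_right hh.le : r ≤ r + h)
    have h2 := (le_abs_self _).trans (hlip (r + h) r)
    rw [add_sub_cancel_left, abs_of_pos hh] at h2
    constructor
    · exact mul_nonneg (inv_nonneg.2 hh.le) (sub_nonneg.2 h1)
    · rw [inv_mul_le_iff₀ hh]; linarith
  · have e1 : (∫ s in (0 : ℝ)..(r + h), b s) - (∫ s in (0 : ℝ)..r, b s) = ∫ s in r..(r + h), b s :=
      intervalIntegral.integral_interval_sub_left (hbc.intervalIntegrable _ _)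
        (hbc.intervalIntegrable _ _)
    have e2 : ∫ s in r..(r + h), b s = (∫ s in r..(r + h), (b s - b r)) + h * b r := by
      rw [intervalIntegral.integral_sub (hbc.intervalIntegrable _ _)
        (continuous_const.intervalIntegrable _ _), intervalIntegral.integral_const]
      simp
    have e3 : ‖∫ s in r..(r + h), (b s - b r)‖ ≤ (L * h) * |r + h - r| := by
      refine intervalIntegral.norm_integral_le_of_norm_le_const fun s hs => ?_
      rw [uIoc_of_le (by linarith)] at hs
      refine (hlip s r).trans ?_
      gcongr
      rw [abs_of_pos (by linarith [hs.1])]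
      linarith [hs.2]
    rw [add_sub_cancel_left, abs_of_pos hh, Real.norm_eq_abs] at e3
    rw [e1, e2, mul_add, ← mul_assoc, inv_mul_cancel₀ hh.ne', one_mul, add_sub_cancel_right, abs_mul,
      abs_inv, abs_of_pos hh, inv_mul_le_iff₀ hh]
    linarith

/-- Convergence in `L²` of superpositions `f k = b k ∘ g k`, where `b k` is within `ε k` of a
function with Lipschitz constant `L`. -/
theorem tendsto_Lp_of_abs_sub_le {S : Type*} [MeasurableSpace S] {μ : Measure S}
    [IsFiniteMeasure μ] {f g : ℕ → Lp ℝ 2 μ} {f' g' : Lp ℝ 2 μ} {ε : ℕ → ℝ} {L : ℝ} (hL : 0 ≤ L)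
    (hε0 : ∀ k, 0 ≤ ε k) (hε : Tendsto ε atTop (𝓝 0)) (hg : Tendsto g atTop (𝓝 g'))
    (h : ∀ k, ∀ᵐ x ∂μ, |f k x - f' x| ≤ ε k + L * |g k x - g' x|) :
    Tendsto f atTop (𝓝 f') := by
  rw [tendsto_iff_norm_sub_tendsto_zero]
  have hlim : Tendsto (fun k => ε k * ‖(memLp_const (1 : ℝ) : MemLp _ 2 μ).toLp _‖ +
      L * ‖g k - g'‖) atTop (𝓝 0) := by
    have := (hε.mul_const ‖(memLp_const (1 : ℝ) : MemLp _ 2 μ).toLp _‖).add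
      ((tendsto_iff_norm_sub_tendsto_zero.1 hg).const_mul L)
    simpa using this
  refine squeeze_zero (fun k => norm_nonneg _) (fun k => ?_) hlim
  have h1 : ‖f k - f'‖ ≤ ‖ε k • (memLp_const (1 : ℝ) : MemLp _ 2 μ).toLp _ + L • |g k - g'|‖ := by
    refine Lp.norm_le_norm_of_ae_le ?_
    filter_upwards [h k, Lp.coeFn_sub (f k) f', Lp.coeFn_sub (g k) g',
      Lp.coeFn_add (ε k • (memLp_const (1 : ℝ) : MemLp _ 2 μ).toLp _) (L • |g k - g'|),
      Lp.coeFn_smul (ε k) ((memLp_const (1 : ℝ) : MemLp _ 2 μ).toLp _),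
      Lp.coeFn_smul L |g k - g'|, Lp.coeFn_abs (g k - g'),
      (memLp_const (1 : ℝ) : MemLp _ 2 μ).coeFn_toLp] with x h1 h2 h3 h4 h5 h6 h7 h8
    rw [h2, h4, Pi.sub_apply, Pi.add_apply, h5, h6, Pi.smul_apply, Pi.smul_apply, h7, h8, h3,
      Pi.sub_apply, smul_eq_mul, smul_eq_mul, mul_one, Real.norm_eq_abs, Real.norm_eq_abs]
    exact h1.trans (le_abs_self _)
  refine h1.trans ((norm_add_le _ _).trans (le_of_eq ?_))
  rw [norm_smul, norm_smul, norm_abs_eq_norm, Real.norm_of_nonneg (hε0 k), Real.norm_of_nonneg hL]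

theorem exists_bound_of_tendsto {E : Type*} [NormedAddCommGroup E] {x : ℕ → E} {y : E}
    (h : Tendsto x atTop (𝓝 y)) : ∃ C, 0 ≤ C ∧ ∀ k, ‖x k‖ ≤ C := by
  obtain ⟨C, hC⟩ := h.norm.bddAbove_range
  exact ⟨C, (norm_nonneg _).trans (hC (mem_range_self 0)), fun k => hC (mem_range_self k)⟩

/-- Weak limits and strong limits of images under a bounded operator agree. -/
theorem eq_of_weak_of_tendsto {V H : Type*} [NormedAddCommGroup V] [InnerProductSpace ℝ V]
    [CompleteSpace V] [NormedAddCommGroup H] [InnerProductSpace ℝ H] [CompleteSpace H]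
    {l : Filter ℕ} [l.NeBot] (A : V →L[ℝ] H) {p : ℕ → V} {p' : V} {a : H}
    (hp : ∀ z, Tendsto (fun k => ⟪p k, z⟫_ℝ) l (𝓝 ⟪p', z⟫_ℝ))
    (ha : Tendsto (fun k => A (p k)) l (𝓝 a)) : A p' = a := by
  refine ext_inner_right ℝ fun y => ?_
  have h1 := hp ((A†) y)
  simp_rw [ContinuousLinearMap.adjoint_inner_right] at h1
  exact tendsto_nhds_unique h1 (ha.inner tendsto_const_nhds)

/-- The sign of a pairing of a weakly and a strongly convergent sequence persists in the limit. -/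
theorem inner_nonneg_of_weak_of_tendsto {V H : Type*} [NormedAddCommGroup V]
    [InnerProductSpace ℝ V] [CompleteSpace V] [NormedAddCommGroup H] [InnerProductSpace ℝ H]
    [CompleteSpace H] {l : Filter ℕ} [l.NeBot] (A : V →L[ℝ] H) {p : ℕ → V} {p' : V}
    (hp : ∀ z, Tendsto (fun k => ⟪p k, z⟫_ℝ) l (𝓝 ⟪p', z⟫_ℝ)) {g : ℕ → H} {g' : H}
    (hg : Tendsto g l (𝓝 g')) {C : ℝ} (hC : ∀ k, ‖A (p k)‖ ≤ C)
    (hpos : ∀ k, 0 ≤ ⟪g k, A (p k)⟫_ℝ) : 0 ≤ ⟪g', A p'⟫_ℝ := by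
  have h1 := hp ((A†) g')
  simp_rw [ContinuousLinearMap.adjoint_inner_right] at h1
  have h2 : Tendsto (fun k => ⟪A (p k), g k - g'⟫_ℝ) l (𝓝 0) := by
    have h3 := (tendsto_iff_norm_sub_tendsto_zero.1 hg).const_mul C
    rw [mul_zero] at h3
    refine squeeze_zero_norm (fun k => ?_) h3
    exact (norm_inner_le_norm _ _).trans (mul_le_mul_of_nonneg_right (hC k) (norm_nonneg _))
  have h4 := h1.add h2
  rw [add_zero, real_inner_comm] at h4
  refine ge_of_tendsto h4 (Eventually.of_forall fun k => ?_)
  rw [inner_sub_right, add_sub_cancel, real_inner_comm]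
  exact hpos k

variable {n : ℕ} {Ω : Set (Euc n)}

theorem gradient_comp {b φ : _ → ℝ} (hb : ContDiff ℝ 1 b) (hφ : ContDiff ℝ 1 φ) (x : Euc n) :
    gradient (fun x => b (φ x)) x = deriv b (φ x) • gradient φ x := by
  refine ext_inner_right ℝ fun v => ?_
  have h1 := ((hb.differentiable one_ne_zero (φ x)).hasDerivAt).comp_hasFDerivAt x
    ((hφ.differentiable one_ne_zero x).hasFDerivAt)
  have h2 : fderiv ℝ (fun x => b (φ x)) x = deriv b (φ x) • fderiv ℝ φ x := h1.fderiv
  rw [inner_gradient, h2, real_inner_smul_left, inner_gradient]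
  rfl

/-- Composition of a function of `H¹(Ω)` with a monotone Lipschitz function `b`. Only the sign of
`∇u · ∇b(u)` is recorded. -/
theorem IsSmoothBoundedDomain.exists_comp (hΩ : IsSmoothBoundedDomain Ω) {b : ℝ → ℝ}
    (hb : Monotone b) {L : ℝ≥0} (hL : LipschitzWith L b) (u : H1 Ω) :
    ∃ p : H1 Ω, (∀ᵐ x ∂volume.restrict Ω, H1.toL2 Ω p x = b (H1.toL2 Ω u x)) ∧
      (∀ᵐ x ∂surface (frontier Ω), trace p x = b (trace u x)) ∧
      0 ≤ ⟪H1.grad Ω u, H1.grad Ω p⟫_ℝ := by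
  have hfin1 : IsFiniteMeasure (volume.restrict Ω) :=
    ⟨by simpa using hΩ.isBounded.measure_lt_top⟩
  have hfin2 := hΩ.isFiniteMeasure_surface
  obtain ⟨τ, hτ⟩ := hΩ.exists_traceCLM
  obtain ⟨φ, z, w, w', hφ, hz, hw, hzu, hww', hT⟩ := hΩ.exists_seq_tendsto u
  rw [← hΩ.trace_eq hT] at hww'
  choose c hc hcd hcb using fun k : ℕ =>
    exists_contDiff_monotone_approximation hb hL (Nat.one_div_pos_of_nat (α := ℝ) (n := k))
  have hcφ : ∀ k, ContDiff ℝ 1 fun x => c k (φ k x) := fun k => (hc k).comp (hφ k)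
  choose p hp using fun k => exists_H1_of_contDiff hΩ.isBounded (hcφ k)
  have hgz := fun k => H1.grad_ae_eq_gradient hΩ.isOpen (hφ k) (hz k)
  have hgp := fun k => H1.grad_ae_eq_gradient hΩ.isOpen (hcφ k) (hp k)
  have hms := fun k => hΩ.memLp_surface (hcφ k).continuous
  have hτp : ∀ k, τ (p k) = (hms k).toLp _ := fun k => by
    rw [hτ]
    exact hΩ.trace_eq (subset_closure ⟨_, hcφ k, hp k, (hms k).coeFn_toLp⟩)
  have hlip : ∀ r s : ℝ, |b r - b s| ≤ L * |r - s| := fun r s => by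
    simpa [Real.dist_eq] using hL.dist_le_mul r s
  have hcomp : ∀ {S : Type} [MeasurableSpace S] {μ : Measure S} [IsFiniteMeasure μ] (f : Lp ℝ 2 μ),
      MemLp (fun x => b (f x)) 2 μ := by
    intro S _ μ _ f
    refine (((Lp.memLp f).norm.const_mul (L : ℝ)).add (memLp_const |b 0|)).mono'
      (hL.continuous.comp_aestronglyMeasurable (Lp.memLp f).1) (ae_of_all _ fun x => ?_)
    have h1 := hlip (f x) 0
    rw [sub_zero] at h1
    calc ‖b (f x)‖ = |(b (f x) - b 0) + b 0| := by rw [sub_add_cancel]; rfl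
      _ ≤ |b (f x) - b 0| + |b 0| := abs_add_le _ _
      _ ≤ L * ‖f x‖ + |b 0| := by rw [Real.norm_eq_abs]; linarith
  let ε : ℕ → ℝ := fun k => L * (1 / ((k : ℝ) + 1))
  have hε0 : ∀ k, 0 ≤ ε k := fun k => by positivity
  have hε : Tendsto ε atTop (𝓝 0) := by
    simpa [ε] using tendsto_one_div_add_atTop_nhds_zero_nat.const_mul (L : ℝ)
  have hpt : ∀ k (r s : ℝ), |c k r - b s| ≤ ε k + L * |r - s| := fun k r s =>
    calc |c k r - b s| = |(c k r - b r) + (b r - b s)| := by congr 1; ring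
      _ ≤ |c k r - b r| + |b r - b s| := abs_add_le _ _
      _ ≤ _ := add_le_add (hcb k r) (hlip r s)
  have hlim1 : Tendsto (fun k => H1.toL2 Ω (p k)) atTop (𝓝 ((hcomp (H1.toL2 Ω u)).toLp _)) := by
    refine tendsto_Lp_of_abs_sub_le L.2 hε0 hε (((H1.toL2 Ω).continuous.tendsto u).comp hzu)
      fun k => ?_
    filter_upwards [hp k, hz k, (hcomp (H1.toL2 Ω u)).coeFn_toLp] with x h1 h2 h3
    rw [h1, h3, Function.comp_apply, h2]
    exact hpt k _ _
  have hlim2 : Tendsto (fun k => τ (p k)) atTop (𝓝 ((hcomp (trace u)).toLp _)) := by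
    refine tendsto_Lp_of_abs_sub_le L.2 hε0 hε hww' fun k => ?_
    filter_upwards [(hms k).coeFn_toLp, hw k, (hcomp (trace u)).coeFn_toLp] with x h1 h2 h3
    rw [hτp, h1, h3, h2]
    exact hpt k _ _
  have hgrad : ∀ k, ‖H1.grad Ω (p k)‖ ≤ L * ‖H1.grad Ω (z k)‖ := by
    intro k
    refine Lp.norm_le_mul_norm_of_ae_le_mul ?_
    filter_upwards [hgz k, hgp k] with x h1 h2
    rw [h1, h2, gradient_comp (hc k) (hφ k), norm_smul, Real.norm_of_nonneg (hcd k _).1]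
    exact mul_le_mul_of_nonneg_right (hcd k _).2 (norm_nonneg _)
  obtain ⟨C₁, hC₁0, hC₁⟩ := exists_bound_of_tendsto hlim1
  have hgzu : Tendsto (fun k => H1.grad Ω (z k)) atTop (𝓝 (H1.grad Ω u)) :=
    ((H1.grad Ω).continuous.tendsto u).comp hzu
  obtain ⟨C₂, hC₂0, hC₂⟩ := exists_bound_of_tendsto hgzu
  have hgp' : ∀ k, ‖H1.grad Ω (p k)‖ ≤ L * C₂ := fun k =>
    (hgrad k).trans (mul_le_mul_of_nonneg_left (hC₂ k) L.2)
  let l : Ultrafilter ℕ := Filter.hyperfilter ℕ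
  have hl : (l : Filter ℕ) ≤ atTop := Nat.hyperfilter_le_atTop
  obtain ⟨p', hp'⟩ := exists_weak_limit l p (C₁ + L * C₂) fun k =>
    (H1.norm_le_add _).trans (add_le_add (hC₁ k) (hgp' k))
  have h1 := eq_of_weak_of_tendsto (H1.toL2 Ω) hp' (hlim1.mono_left hl)
  have h2 := eq_of_weak_of_tendsto τ hp' (hlim2.mono_left hl)
  refine ⟨p', ?_, ?_, ?_⟩
  · rw [h1]; exact (hcomp (H1.toL2 Ω u)).coeFn_toLp
  · rw [← hτ, h2]; exact (hcomp (trace u)).coeFn_toLp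
  · have hpos : ∀ k, 0 ≤ ⟪H1.grad Ω (z k), H1.grad Ω (p k)⟫_ℝ := by
      intro k
      rw [L2.inner_def]
      refine integral_nonneg_of_ae ?_
      filter_upwards [hgz k, hgp k] with x h1 h2
      rw [h1, h2, gradient_comp (hc k) (hφ k), inner_smul_right, real_inner_self_eq_norm_sq]
      exact mul_nonneg (hcd k _).1 (sq_nonneg _)
    exact inner_nonneg_of_weak_of_tendsto (H1.grad Ω) hp' (hgzu.mono_left hl) hgp' hpos

end ChainRule

/-! ### Monotone graphs on the line -/

section ScalarGraph

variable {β : ℝ → Set ℝ} {j : ℝ → ℝ}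

theorem IsBoundaryGraph.continuous (h : IsBoundaryGraph β j) : Continuous j :=
  h.convex.locallyLipschitz.continuous

theorem IsBoundaryGraph.le_of_mem (h : IsBoundaryGraph β j) {r s : ℝ} (hs : s ∈ β r) (y : ℝ) :
    j r + s * (y - r) ≤ j y := by
  rw [← h.subdifferential_eq] at hs
  exact hs y

theorem IsBoundaryGraph.zero_le (h : IsBoundaryGraph β j) (r : ℝ) : j 0 ≤ j r := by
  have := h.le_of_mem h.zero_mem r
  linarith

/-- The resolvent of `β` is everywhere defined: `r ∈ (1 + l β)(y)` where `y` is the proximal point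
of `r`. -/
theorem IsBoundaryGraph.exists_resolvent (h : IsBoundaryGraph β j) {l : ℝ} (hl : 0 < l) (r : ℝ) :
    ∃ s, s ∈ β (r - l * s) := by
  have hcont : Continuous fun y => j y + (y - r) ^ 2 / (2 * l) := by
    have := h.continuous
    fun_prop
  obtain ⟨y, hy⟩ := hcont.exists_forall_le' r (by
    set R : ℝ := 2 * l * (j r - j 0) + 1
    have hR : 1 ≤ R := by
      have := mul_nonneg (mul_nonneg zero_le_two hl.le) (sub_nonneg.2 (h.zero_le r))
      simp only [R]; linarith
    filter_upwards [tendsto_norm_cocompact_atTop.eventually_ge_atTop (|r| + R)] with y hy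
    rw [Real.norm_eq_abs] at hy
    have h1 : R ≤ |y - r| := by linarith [abs_sub_abs_le_abs_sub y r]
    have h2 : R ≤ (y - r) ^ 2 := by rw [← sq_abs]; nlinarith
    have h3 : j r - j 0 ≤ (y - r) ^ 2 / (2 * l) := by
      rw [le_div_iff₀ (by positivity)]
      simp only [R] at h2; nlinarith
    have := h.zero_le y
    simp only [sub_self, ne_eq, OfNat.ofNat_ne_zero, not_false_eq_true, zero_pow, zero_div, add_zero]
    linarith)
  refine ⟨(r - y) / l, ?_⟩
  have e : r - l * ((r - y) / l) = y := by field_simp; ring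
  rw [e, ← h.subdifferential_eq]
  intro w
  -- compare `y` with `y + t (w - y)` and let `t → 0`
  have hlim : Tendsto (fun t : ℝ => j w + t * ((w - y) ^ 2 / (2 * l))) (𝓝[>] 0) (𝓝 (j w)) := by
    have : Tendsto (fun t : ℝ => j w + t * ((w - y) ^ 2 / (2 * l))) (𝓝 0)
        (𝓝 (j w + 0 * ((w - y) ^ 2 / (2 * l)))) := Continuous.tendsto (by fun_prop) 0
    rw [zero_mul, add_zero] at this
    exact this.mono_left nhdsWithin_le_nhds
  refine ge_of_tendsto hlim ?_
  filter_upwards [Ioo_mem_nhdsGT one_pos] with t ht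
  have h1 := hy (y + t * (w - y))
  have h2 := h.convex.2 (mem_univ y) (mem_univ w) (sub_nonneg.2 ht.2.le) ht.1.le (by ring)
  simp only [smul_eq_mul] at h2
  rw [show (1 - t) * y + t * w = y + t * (w - y) by ring] at h2
  have h3 : (y + t * (w - y) - r) ^ 2 / (2 * l) = (y - r) ^ 2 / (2 * l) -
      t * ((r - y) / l * (w - y)) + t * (t * ((w - y) ^ 2 / (2 * l))) := by
    field_simp; ring
  rw [h3] at h1
  have h4 : t * (j y + (r - y) / l * (w - y)) ≤ t * (j w + t * ((w - y) ^ 2 / (2 * l))) := by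
    linarith
  exact le_of_mul_le_mul_left h4 ht.1

theorem IsBoundaryGraph.isClosed (h : IsBoundaryGraph β j) (r : ℝ) : IsClosed (β r) := by
  rw [← h.subdifferential_eq]
  have : subdifferential j r = ⋂ y, {s | j r + s * (y - r) ≤ j y} := by
    ext s; simp [subdifferential]
  rw [this]
  exact isClosed_iInter fun y => isClosed_le (by fun_prop) continuous_const

theorem IsBoundaryGraph.exists_min_abs (h : IsBoundaryGraph β j) (r : ℝ) :
    ∃ s ∈ β r, ∀ s' ∈ β r, |s| ≤ |s'| := by
  obtain ⟨s, hs, he⟩ := (h.isClosed r).exists_infDist_eq_dist (h.domain_eq r) 0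
  refine ⟨s, hs, fun s' hs' => ?_⟩
  have := Metric.infDist_le_dist_of_mem (x := (0 : ℝ)) hs'
  rwa [he, dist_zero_left, dist_zero_left] at this

/-- The growth condition extends from the minimal section to the whole graph: an element of `β r` is
dominated by the elements of `β r'` for `r'` on its outer side, and `j` is continuous. -/
theorem IsBoundaryGraph.abs_le_of_mem (h : IsBoundaryGraph β j) {D₁ D₂ : ℝ}
    (hD : ∀ r, ∀ s ∈ β r, (∀ s' ∈ β r, |s| ≤ |s'|) → |s| ≤ D₁ * j r + D₂) {r s : ℝ}
    (hs : s ∈ β r) : |s| ≤ D₁ * j r + D₂ := by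
  have hcont : Continuous fun r => D₁ * j r + D₂ := by
    have := h.continuous
    fun_prop
  rcases le_or_gt 0 s with h0 | h0
  · refine ge_of_tendsto ((hcont.tendsto r).mono_left nhdsWithin_le_nhds :
      Tendsto _ (𝓝[>] r) _) ?_
    filter_upwards [self_mem_nhdsWithin] with r' hr'
    obtain ⟨s', hs', hmin⟩ := h.exists_min_abs r'
    refine le_trans ?_ (hD r' s' hs' hmin)
    have h1 := h.maximalMonotone.monotone r' r s' hs' s hs
    have h2 := nonneg_of_mul_nonneg_left h1 (sub_pos.2 hr')
    rw [abs_of_nonneg h0]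
    exact le_trans (by linarith) (le_abs_self s')
  · refine ge_of_tendsto ((hcont.tendsto r).mono_left nhdsWithin_le_nhds :
      Tendsto _ (𝓝[<] r) _) ?_
    filter_upwards [self_mem_nhdsWithin] with r' hr'
    obtain ⟨s', hs', hmin⟩ := h.exists_min_abs r'
    refine le_trans ?_ (hD r' s' hs' hmin)
    have h1 := h.maximalMonotone.monotone r r' s hs s' hs'
    have h2 := nonneg_of_mul_nonneg_left h1 (sub_pos.2 hr')
    rw [abs_of_neg h0]
    exact le_trans (by linarith) (neg_le_abs s')

theorem yosida_zero {b : ℝ → ℝ → ℝ} (h : IsBoundaryGraph β j)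
    (hb : ∀ l > 0, ∀ r, b l r ∈ β (r - l * b l r)) {l : ℝ} (hl : 0 < l) : b l 0 = 0 := by
  have h1 := h.maximalMonotone.monotone _ _ _ (hb l hl 0) 0 h.zero_mem
  have h4 : b l 0 ^ 2 ≤ 0 := by
    by_contra hc
    push Not at hc
    linarith [mul_pos hl hc]
  exact pow_eq_zero_iff two_ne_zero |>.1 (le_antisymm h4 (sq_nonneg _))

/-- The Yosida approximations `b l` of `β` and the Moreau envelopes `B l` of `j - j 0`. The growth
condition, evaluated at the resolvent point `r - l b l r`, bounds `b l` by `B l` uniformly in `l`.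
-/
theorem IsBoundaryGraph.exists_yosida (h : IsBoundaryGraph β j) :
    ∃ (b B : ℝ → ℝ → ℝ) (D₁ D₂ : ℝ), 0 ≤ D₁ ∧ 0 ≤ D₂ ∧
      (∀ l > 0, ∀ r, b l r ∈ β (r - l * b l r)) ∧ (∀ l > 0, ∀ r, 0 ≤ B l r) ∧
      (∀ l > 0, ∀ r s, B l r - B l s ≤ b l r * (r - s)) ∧ (∀ l > 0, B l 0 = 0) ∧
      (∀ l > 0, ∀ r, B l r ≤ j r - j 0) ∧ ∀ l > 0, ∀ r, |b l r| ≤ D₁ * B l r + D₂ := by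
  obtain ⟨D₁, hD₁, D₂, hD₂, hD⟩ := h.growth
  have hex : ∀ l r : ℝ, ∃ s, 0 < l → s ∈ β (r - l * s) := fun l r => by
    by_cases hl : 0 < l
    · obtain ⟨s, hs⟩ := h.exists_resolvent hl r
      exact ⟨s, fun _ => hs⟩
    · exact ⟨0, fun h => absurd h hl⟩
  choose b hb using hex
  refine ⟨b, fun l r => j (r - l * b l r) + l / 2 * b l r ^ 2 - j 0, D₁, D₁ * |j 0| + D₂, hD₁.le,
    by positivity, fun l hl r => hb l r hl, fun l hl r => ?_, fun l hl r s => ?_, fun l hl => ?_,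
    fun l hl r => ?_, fun l hl r => ?_⟩
  · have := h.zero_le (r - l * b l r)
    have h2 : 0 ≤ l / 2 * b l r ^ 2 := by positivity
    linarith
  · have h1 := h.le_of_mem (hb l r hl) (s - l * b l s)
    nlinarith [mul_nonneg hl.le (sq_nonneg (b l r - b l s))]
  · simp [yosida_zero h (fun l hl r => hb l r hl) hl]
  · have h1 := h.le_of_mem (hb l r hl) r
    have h2 : 0 ≤ l / 2 * b l r ^ 2 := by positivity
    nlinarith
  · have h1 := h.abs_le_of_mem hD (hb l r hl)
    have h2 : 0 ≤ l / 2 * b l r ^ 2 := by positivity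
    have h3 : D₁ * (j (r - l * b l r) - j 0) ≤
        D₁ * (j (r - l * b l r) + l / 2 * b l r ^ 2 - j 0) := by gcongr; linarith
    have h4 : D₁ * j 0 ≤ D₁ * |j 0| := by gcongr; exact le_abs_self _
    linarith

section Yosida

variable {b : ℝ → ℝ → ℝ}

/-- Yosida approximations with different parameters take values in one graph, so that they are
jointly monotone in the resolvent points. -/
theorem yosida_monotone_pair (h : IsBoundaryGraph β j)
    (hb : ∀ l > 0, ∀ r, b l r ∈ β (r - l * b l r)) {l m : ℝ} (hl : 0 < l) (hm : 0 < m) (r s : ℝ) :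
    0 ≤ (b l r - b m s) * ((r - l * b l r) - (s - m * b m s)) :=
  h.maximalMonotone.monotone _ _ _ (hb l hl r) _ (hb m hm s)

theorem yosida_lipschitz (h : IsBoundaryGraph β j)
    (hb : ∀ l > 0, ∀ r, b l r ∈ β (r - l * b l r)) {l : ℝ} (hl : 0 < l) :
    LipschitzWith (Real.toNNReal l⁻¹) (b l) := by
  refine LipschitzWith.of_dist_le_mul fun r s => ?_
  rw [Real.dist_eq, Real.dist_eq, Real.coe_toNNReal _ (inv_nonneg.2 hl.le), ← div_eq_inv_mul,
    le_div_iff₀ hl]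
  have h1 := yosida_monotone_pair h hb hl hl r s
  have h2 : l * |b l r - b l s| ^ 2 ≤ |b l r - b l s| * |r - s| := by
    rw [sq_abs, ← abs_mul]
    exact le_trans (by linarith) (le_abs_self _)
  rcases (abs_nonneg (b l r - b l s)).eq_or_lt with h0 | h0
  · rw [← h0]; simp
  · nlinarith

theorem yosida_monotone (h : IsBoundaryGraph β j)
    (hb : ∀ l > 0, ∀ r, b l r ∈ β (r - l * b l r)) {l : ℝ} (hl : 0 < l) : Monotone (b l) := by
  intro r s hrs
  have h1 := yosida_monotone_pair h hb hl hl s r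
  by_contra hc
  push Not at hc
  nlinarith [mul_pos hl (sub_pos.2 hc), mul_pos (mul_pos hl (sub_pos.2 hc)) (sub_pos.2 hc),
    mul_nonneg (sub_pos.2 hc).le (sub_nonneg.2 hrs)]

end Yosida

end ScalarGraph

/-! ### The Yosida family of the boundary graph -/

section Nemytskii

variable {n : ℕ} {Ω Γ₀ Γ₁ : Set (Euc n)}

theorem IsBoundaryPartition.surface_le (hΓ : IsBoundaryPartition Ω Γ₀ Γ₁) :
    surface Γ₁ ≤ surface (frontier Ω) :=
  Measure.restrict_mono (hΓ.union_eq ▸ subset_union_right) le_rfl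

/-- The restriction to `Γ₁` of the functions on `∂Ω`, as a linear contraction. -/
theorem IsBoundaryPartition.exists_restrict (hΓ : IsBoundaryPartition Ω Γ₀ Γ₁) :
    ∃ R : L2surf (frontier Ω) →L[ℝ] L2surf Γ₁, (∀ w, R w =ᵐ[surface Γ₁] w) ∧ ∀ w, ‖R w‖ ≤ ‖w‖ := by
  have hm : ∀ w : L2surf (frontier Ω), MemLp w 2 (surface Γ₁) := fun w =>
    (Lp.memLp w).mono_measure hΓ.surface_le
  have hae : ∀ {p : Euc n → Prop}, (∀ᵐ x ∂surface (frontier Ω), p x) → ∀ᵐ x ∂surface Γ₁, p x :=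
    fun h => ae_mono hΓ.surface_le h
  have hn : ∀ w : L2surf (frontier Ω), ‖(hm w).toLp w‖ ≤ 1 * ‖w‖ := fun w => by
    rw [one_mul, Lp.norm_toLp, Lp.norm_def]
    exact ENNReal.toReal_mono (Lp.eLpNorm_ne_top w) (eLpNorm_mono_measure _ hΓ.surface_le)
  refine ⟨LinearMap.mkContinuous
    { toFun := fun w => (hm w).toLp w
      map_add' := fun w w' => Lp.ext ?_
      map_smul' := fun c w => Lp.ext ?_ } 1 hn, fun w => (hm w).coeFn_toLp, fun w => ?_⟩
  · filter_upwards [(hm (w + w')).coeFn_toLp, Lp.coeFn_add ((hm w).toLp w) ((hm w').toLp w'),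
      (hm w).coeFn_toLp, (hm w').coeFn_toLp, hae (Lp.coeFn_add w w')] with x h1 h2 h3 h4 h5
    rw [h1, h2, h5, Pi.add_apply, Pi.add_apply, h3, h4]
  · filter_upwards [(hm (c • w)).coeFn_toLp, Lp.coeFn_smul c ((hm w).toLp w),
      (hm w).coeFn_toLp, hae (Lp.coeFn_smul c w)] with x h1 h2 h3 h4
    rw [RingHom.id_apply, h1, h2, h4, Pi.smul_apply, Pi.smul_apply, h3]
  · simpa using hn w

/-- The superposition operator of `b` lies in the subdifferential of the integral functional of `B`.
-/
theorem integral_sub_le_inner {S : Type*} [MeasurableSpace S] {μ : Measure S} {b B : ℝ → ℝ}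
    (hsub : ∀ r s, B r - B s ≤ b r * (r - s)) {z w p : Lp ℝ 2 μ} (hp : p =ᵐ[μ] fun x => b (z x))
    (hz : Integrable (fun x => B (z x)) μ) (hw : Integrable (fun x => B (w x)) μ) :
    (∫ x, B (z x) ∂μ) - (∫ x, B (w x) ∂μ) ≤ ⟪z - w, p⟫_ℝ := by
  rw [← integral_sub hz hw, L2.inner_def]
  refine integral_mono_ae (hz.sub hw) (L2.integrable_inner (z - w) p) ?_
  filter_upwards [hp, Lp.coeFn_sub z w] with x h1 h2
  simp only [h1, h2, Pi.sub_apply, RCLike.inner_apply, conj_trivial]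
  exact hsub _ _

/-- The integral functional of the potential of a Lipschitz function is locally Lipschitz on `L²`.
-/
theorem continuous_integral_potential {S : Type*} [MeasurableSpace S] {μ : Measure S} {b B : ℝ → ℝ}
    {L : ℝ≥0} (hL : LipschitzWith L b) (hb0 : b 0 = 0) (hsub : ∀ r s, B r - B s ≤ b r * (r - s))
    (hint : ∀ z : Lp ℝ 2 μ, Integrable (fun x => B (z x)) μ) :
    Continuous fun z : Lp ℝ 2 μ => ∫ x, B (z x) ∂μ := by
  have key : ∀ z w : Lp ℝ 2 μ, (∫ x, B (z x) ∂μ) - (∫ x, B (w x) ∂μ) ≤ L * ‖z‖ * ‖z - w‖ := by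
    intro z w
    have h1 := integral_sub_le_inner hsub (hL.coeFn_compLp hb0 z) (hint z) (hint w)
    refine h1.trans ((real_inner_le_norm _ _).trans ?_)
    rw [mul_comm]
    exact mul_le_mul_of_nonneg_right (hL.norm_compLp_le hb0 z) (norm_nonneg _)
  refine continuous_iff_continuousAt.2 fun z => tendsto_iff_norm_sub_tendsto_zero.2 ?_
  have hlim : Tendsto (fun w : Lp ℝ 2 μ => L * (‖w‖ + ‖z‖) * ‖w - z‖) (𝓝 z) (𝓝 0) := by
    have : Tendsto (fun w : Lp ℝ 2 μ => L * (‖w‖ + ‖z‖) * ‖w - z‖) (𝓝 z)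
        (𝓝 (L * (‖z‖ + ‖z‖) * ‖z - z‖)) := Continuous.tendsto (by fun_prop) z
    simpa using this
  refine squeeze_zero (fun w => norm_nonneg _) (fun w => ?_) hlim
  have h1 := key w z
  have h2 := key z w
  rw [norm_sub_rev z w] at h2
  have h3 : 0 ≤ (L : ℝ) * ‖z‖ * ‖w - z‖ := by positivity
  have h4 : 0 ≤ (L : ℝ) * ‖w‖ * ‖w - z‖ := by positivity
  rw [Real.norm_eq_abs, abs_le]
  constructor <;> linarith

/-- The superposition operators of the Yosida approximations of `β` form a Yosida family on
`L²(Γ₁)`, whose potentials stay bounded at initial values with integrable `j`. The last clause holds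
because `N 1 (x + ξ)` takes its values in `β` at the resolvent point `x + ξ - N 1 (x + ξ)`, which is
`x`. -/
theorem exists_isYosidaFamily (hΩ : IsSmoothBoundedDomain Ω) (hΓ : IsBoundaryPartition Ω Γ₀ Γ₁)
    {β : ℝ → Set ℝ} {j : ℝ → ℝ} (hβ : IsBoundaryGraph β j) {τ : H1 Ω →L[ℝ] L2surf Γ₁}
    (hτ : ∀ u, τ u =ᵐ[surface Γ₁] trace u) :
    ∃ (N : ℝ → L2surf Γ₁ → L2surf Γ₁) (Ψ : ℝ → L2 Ω → ℝ) (D₁ D₂ : ℝ), 0 ≤ D₁ ∧ 0 ≤ D₂ ∧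
      IsYosidaFamily (H1.toL2 Ω) (H1.grad Ω) τ N Ψ (fun z => ∫ x in Ω, |z x|) D₁ D₂ ∧
      (∀ u₀ : L2 Ω, Integrable (fun x => j (u₀ x)) (volume.restrict Ω) →
        ∃ M, ∀ l > 0, Ψ l u₀ ≤ M) ∧
      ∀ x ξ : L2surf Γ₁, ξ = N 1 (x + ξ) → ∀ᵐ s ∂surface Γ₁, ξ s ∈ β (x s) := by
  have hfin : IsFiniteMeasure (volume.restrict Ω) :=
    ⟨by simpa using hΩ.isBounded.measure_lt_top⟩
  obtain ⟨b, B, D₁, D₂, hD₁, hD₂, hb, hB0, hsub, hBz, hBj, hgr⟩ := hβ.exists_yosida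
  have hb0 : ∀ {l}, 0 < l → b l 0 = 0 := fun hl => yosida_zero hβ hb hl
  have hbL : ∀ {l}, 0 < l → LipschitzWith (Real.toNNReal l⁻¹) (b l) := fun hl =>
    yosida_lipschitz hβ hb hl
  have habs : ∀ {l : ℝ}, 0 < l → ∀ r, |b l r| ≤ l⁻¹ * |r| := by
    intro l hl r
    have := (hbL hl).dist_le_mul r 0
    rwa [hb0 hl, dist_zero_right, dist_zero_right, Real.coe_toNNReal _ (inv_nonneg.2 hl.le)] at this
  have hBc : ∀ {l}, 0 < l → Continuous (B l) := by
    intro l hl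
    refine continuous_iff_continuousAt.2 fun r => tendsto_iff_norm_sub_tendsto_zero.2 ?_
    have hbc := (hbL hl).continuous
    have hlim : Tendsto (fun s => (|b l s| + |b l r|) * |s - r|) (𝓝 r) (𝓝 0) := by
      have : Tendsto (fun s => (|b l s| + |b l r|) * |s - r|) (𝓝 r)
        (𝓝 ((|b l r| + |b l r|) * |r - r|)) := Continuous.tendsto (by fun_prop) r
      simpa using this
    refine squeeze_zero (fun w => norm_nonneg _) (fun s => ?_) hlim
    have h1 := (hsub l hl s r).trans (le_abs_self _)
    have h2 := (hsub l hl r s).trans (le_abs_self _)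
    rw [abs_mul] at h1 h2
    rw [abs_sub_comm r s] at h2
    have h3 := mul_nonneg (abs_nonneg (b l r)) (abs_nonneg (s - r))
    have h4 := mul_nonneg (abs_nonneg (b l s)) (abs_nonneg (s - r))
    rw [Real.norm_eq_abs, abs_le]
    constructor <;> linarith
  have hBsq : ∀ {l : ℝ}, 0 < l → ∀ r, B l r ≤ l⁻¹ * r ^ 2 := by
    intro l hl r
    have h1 := (hsub l hl r 0).trans (le_abs_self _)
    rw [hBz l hl, sub_zero, sub_zero, abs_mul] at h1
    have h2 := mul_le_mul_of_nonneg_right (habs hl r) (abs_nonneg r)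
    rw [mul_assoc, ← sq, sq_abs] at h2
    exact h1.trans h2
  have hint : ∀ {l}, 0 < l → ∀ z : L2 Ω, Integrable (fun x => B l (z x)) (volume.restrict Ω) := by
    intro l hl z
    refine ((Lp.memLp z).integrable_sq.const_mul l⁻¹).mono'
      ((hBc hl).comp_aestronglyMeasurable (Lp.memLp z).1) (ae_of_all _ fun x => ?_)
    rw [Real.norm_of_nonneg (hB0 l hl _)]
    exact hBsq hl _
  let N : ℝ → L2surf Γ₁ → L2surf Γ₁ := fun l x =>
    if hl : 0 < l then (hbL hl).compLp (hb0 hl) x else 0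
  have hN : ∀ {l}, 0 < l → ∀ x, N l x =ᵐ[surface Γ₁] fun s => b l (x s) := by
    intro l hl x
    simp only [N, dif_pos hl]
    exact (hbL hl).coeFn_compLp (hb0 hl) x
  refine ⟨N, fun l z => ∫ x in Ω, B l (z x), D₁, ∫ x in Ω, D₂, hD₁, integral_nonneg fun _ => hD₂,
    ?_, fun u₀ hu₀ => ⟨∫ x in Ω, (j (u₀ x) - j 0), fun l hl =>
      integral_mono (hint hl u₀) (hu₀.sub (integrable_const _)) fun x => hBj l hl _⟩,
    fun x ξ hξ => ?_⟩
  · refine ⟨fun l hl => ?_, fun l hl m hm x y => ?_, fun l hl z => integral_nonneg fun x => hB0 l hl _,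
      fun l hl => continuous_integral_potential (hbL hl) (hb0 hl) (hsub l hl) (hint hl),
      fun l hl => ⟨l⁻¹, fun z => ?_⟩, fun l hl u => ?_⟩
    · simp only [N, dif_pos hl]
      exact LipschitzWith.compLp_zero _ _
    · rw [L2.inner_def]
      refine integral_nonneg_of_ae ?_
      filter_upwards [hN hl x, hN hm y, Lp.coeFn_sub (N l x) (N m y),
        Lp.coeFn_sub (x - l • N l x) (y - m • N m y), Lp.coeFn_sub x (l • N l x),
        Lp.coeFn_sub y (m • N m y), Lp.coeFn_smul l (N l x), Lp.coeFn_smul m (N m y)]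
        with s h1 h2 h3 h4 h5 h6 h7 h8
      rw [h3, h4, Pi.sub_apply, Pi.sub_apply, h5, h6, Pi.sub_apply, Pi.sub_apply, h7, h8,
        Pi.smul_apply, Pi.smul_apply, h1, h2]
      simp only [Pi.zero_apply, RCLike.inner_apply, conj_trivial, smul_eq_mul]
      rw [mul_comm]
      exact yosida_monotone_pair hβ hb hl hm _ _
    · have h1 : ‖z‖ ^ 2 = ∫ x in Ω, (z x) ^ 2 := by
        rw [← real_inner_self_eq_norm_sq, L2.inner_def]
        refine integral_congr_ae (ae_of_all _ fun x => ?_)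
        simp [sq]
      rw [h1, ← integral_const_mul]
      exact integral_mono (hint hl z) ((Lp.memLp z).integrable_sq.const_mul _) fun x => hBsq hl _
    · obtain ⟨p, hp1, hp2, hp3⟩ := hΩ.exists_comp (yosida_monotone hβ hb hl) (hbL hl) u
      refine ⟨p, Lp.ext ?_, hp3, fun z =>
        integral_sub_le_inner (hsub l hl) hp1 (hint hl _) (hint hl z), ?_⟩
      · filter_upwards [hτ p, hτ u, hN hl (τ u), ae_mono hΓ.surface_le hp2] with s h1 h2 h3 h4
        rw [h1, h3, h2, h4]
      · rw [← integral_const_mul, ← integral_add ((hint hl _).const_mul _) (integrable_const _)]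
        refine integral_mono_ae ((Lp.memLp (H1.toL2 Ω p)).integrable (by norm_num)).abs
          (((hint hl _).const_mul _).add (integrable_const _)) ?_
        filter_upwards [hp1] with x hx
        simp only [hx]
        exact hgr l hl _
  · have h1 := hN one_pos (x + ξ)
    rw [← hξ] at h1
    filter_upwards [h1, Lp.coeFn_add x ξ] with s h2 h3
    have h4 := hb 1 one_pos ((x + ξ) s)
    rw [← h2, h3, Pi.add_apply, one_mul, add_sub_cancel_right] at h4
    exact h4

end Nemytskii

/-! ### Weak time derivatives and the integrated equation -/

section WeakDerivative

variable {F : Type*} [NormedAddCommGroup F] [NormedSpace ℝ F] [CompleteSpace F]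

theorem continuousOn_primitive_timeMeasure {T : ℝ} (hT : 0 < T) {r : ℝ → F}
    (hr : Integrable r (timeMeasure T)) :
    ContinuousOn (fun t => ∫ s in (0 : ℝ)..t, r s) (Icc 0 T) := by
  have := intervalIntegral.continuousOn_primitive_interval (μ := volume) (f := r) (a := 0) (b := T)
    (by rw [uIcc_of_le hT.le, integrableOn_Icc_iff_integrableOn_Ioo]; exact hr)
  rwa [uIcc_of_le hT.le] at this

/-- A function whose weak derivative is `r`, and which agrees almost everywhere with a continuous
function `W`, is `W 0` plus the primitive of `r`. -/
theorem ae_eq_add_primitive {T : ℝ} (hT : 0 < T) {w r W : ℝ → F}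
    (hw : Integrable w (timeMeasure T)) (hr : Integrable r (timeMeasure T))
    (h : ∀ φ, IsTestFunction (Ioo 0 T) φ →
      ∫ t, deriv φ t • w t ∂timeMeasure T = -∫ t, φ t • r t ∂timeMeasure T)
    (hW : ContinuousOn W (Icc 0 T)) (hWw : ∀ᵐ t ∂timeMeasure T, W t = w t) :
    ∀ᵐ t ∂timeMeasure T, w t = W 0 + ∫ s in (0 : ℝ)..t, r s := by
  have hPc := continuousOn_primitive_timeMeasure hT hr
  have hPi : Integrable (fun t => ∫ s in (0 : ℝ)..t, r s) (timeMeasure T) :=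
    (hPc.integrableOn_Icc).mono_set Ioo_subset_Icc_self
  have hφm : ∀ {φ : ℝ → ℝ}, IsTestFunction (Ioo 0 T) φ → ∀ {f : ℝ → F}, Integrable f (timeMeasure T) →
      Integrable (fun t => deriv φ t • f t) (timeMeasure T) := by
    intro φ hφ f hf
    have hd : Continuous (deriv φ) := hφ.contDiff.continuous_deriv (by simp)
    obtain ⟨M, hM⟩ := isCompact_Icc.exists_bound_of_continuousOn (s := Icc 0 T) hd.continuousOn
    exact hf.bdd_smul M hd.aestronglyMeasurable
      ((ae_restrict_mem measurableSet_Ioo).mono fun t ht => hM t (Ioo_subset_Icc_self ht))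
  obtain ⟨c, hc⟩ := ae_eq_const_of_integral_deriv_smul hT (w := fun t => w t - ∫ s in (0 : ℝ)..t, r s)
    (hw.sub hPi) fun φ hφ => by
      have h1 := h φ hφ
      have h2 := integral_deriv_smul_primitive (hφ.contDiff.of_le (by simp))
        (image_eq_zero_of_notMem_tsupport fun hT' => lt_irrefl T (hφ.tsupport_subset hT').2) hr
      simp_rw [smul_sub]
      refine (integral_sub (hφm hφ hw) (hφm hφ hPi)).trans ?_
      exact sub_eq_zero.2 (h1.trans h2.symm)
  have heq : W =ᵐ[volume.restrict (Icc 0 T)] fun t => c + ∫ s in (0 : ℝ)..t, r s := by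
    rw [← restrict_Ioo_eq_restrict_Icc]
    filter_upwards [hc, hWw] with t h1 h2
    rw [h2, ← h1]; abel
  have h0 := Measure.eqOn_Icc_of_ae_eq volume hT.ne heq hW (continuousOn_const.add hPc)
    (left_mem_Icc.2 hT.le)
  simp only [intervalIntegral.integral_same, add_zero] at h0
  filter_upwards [hc] with t h1
  rw [h0, ← h1]; abel

/-- A primitive of `r` has the weak derivative `r`. -/
theorem integral_deriv_smul_of_ae_eq_add_primitive {T : ℝ} (hT : 0 < T) {w r : ℝ → F} {c : F}
    (hr : Integrable r (timeMeasure T))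
    (hw : ∀ᵐ t ∂timeMeasure T, w t = c + ∫ s in (0 : ℝ)..t, r s) {φ : ℝ → ℝ}
    (hφ : IsTestFunction (Ioo 0 T) φ) :
    ∫ t, deriv φ t • w t ∂timeMeasure T = -∫ t, φ t • r t ∂timeMeasure T := by
  have hφ1 : ContDiff ℝ 1 φ := hφ.contDiff.of_le (by simp)
  have hφ0 : ∀ t, t ∉ Ioo 0 T → φ t = 0 := fun t ht =>
    image_eq_zero_of_notMem_tsupport fun h => ht (hφ.tsupport_subset h)
  have hd : Continuous (deriv φ) := hφ1.continuous_deriv le_rfl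
  have hPc := continuousOn_primitive_timeMeasure hT hr
  have i1 : Integrable (fun t => deriv φ t • c) (timeMeasure T) :=
    ((hd.smul continuous_const).continuousOn.integrableOn_Icc (a := 0) (b := T)).mono_set
      Ioo_subset_Icc_self
  have i2 : Integrable (fun t => deriv φ t • ∫ s in (0 : ℝ)..t, r s) (timeMeasure T) :=
    ((hd.continuousOn.smul hPc).integrableOn_Icc).mono_set Ioo_subset_Icc_self
  have e1 : ∫ t, deriv φ t • w t ∂timeMeasure T =
      ∫ t, (deriv φ t • c + deriv φ t • ∫ s in (0 : ℝ)..t, r s) ∂timeMeasure T :=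
    integral_congr_ae (hw.mono fun t ht => by simp only [ht, smul_add])
  have e2 : ∫ t, deriv φ t • c ∂timeMeasure T = 0 := by
    rw [integral_smul_const, integral_timeMeasure hT.le,
      intervalIntegral.integral_deriv_eq_sub (fun t _ => hφ1.differentiable one_ne_zero t)
        (hd.intervalIntegrable _ _), hφ0 T (by simp), hφ0 0 (by simp), sub_zero, zero_smul]
  rw [e1, integral_add i1 i2, e2, zero_add]
  exact integral_deriv_smul_primitive hφ1 (hφ0 T (by simp)) hr

/-- Two integrable functions of time with the same integrals against test functions agree. -/
theorem ae_eq_of_integral_smul_eq {T : ℝ} {f f' : ℝ → F} (hf : Integrable f (timeMeasure T))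
    (hf' : Integrable f' (timeMeasure T))
    (h : ∀ φ, IsTestFunction (Ioo 0 T) φ →
      ∫ t, φ t • f t ∂timeMeasure T = ∫ t, φ t • f' t ∂timeMeasure T) :
    f =ᵐ[timeMeasure T] f' := by
  have key := isOpen_Ioo.ae_eq_zero_of_integral_contDiff_smul_eq_zero (μ := volume)
    (f := fun t => f t - f' t) (U := Ioo 0 T)
    ((IntegrableOn.locallyIntegrableOn (hf.sub hf'))) fun φ hφ hφc hφs => by
      have hi : ∀ {f : ℝ → F}, Integrable f (timeMeasure T) →
          Integrable (fun t => φ t • f t) (timeMeasure T) := by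
        intro f hf
        obtain ⟨M, hM⟩ := hφc.exists_bound_of_continuous hφ.continuous
        exact hf.bdd_smul M hφ.continuous.aestronglyMeasurable (ae_of_all _ hM)
      rw [← setIntegral_eq_integral_of_forall_compl_eq_zero (s := Ioo 0 T) fun t ht => by
        rw [image_eq_zero_of_notMem_tsupport fun h => ht (hφs h), zero_smul]]
      simp_rw [smul_sub]
      refine (integral_sub (hi hf) (hi hf')).trans ?_
      exact sub_eq_zero.2 (h φ ⟨hφ, hφc, hφs⟩)
  rw [EventuallyEq, timeMeasure, ae_restrict_iff' measurableSet_Ioo]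
  exact key.mono fun t ht hm => sub_eq_zero.1 (ht hm)

variable {V : Type*} [NormedAddCommGroup V] [NormedSpace ℝ V] [CompleteSpace V]

theorem map_primitive (R : V →L[ℝ] F) {T : ℝ} {r : ℝ → V}
    (hr : Integrable r (timeMeasure T)) {t : ℝ} (ht : t ∈ Ioo 0 T) :
    ∫ s in (0 : ℝ)..t, R (r s) = R (∫ s in (0 : ℝ)..t, r s) :=
  R.intervalIntegral_comp_comm
    ((intervalIntegrable_of_integrable (ht.1.trans ht.2).le hr).mono_set (by
      rw [uIcc_of_le (ht.1.trans ht.2).le, uIcc_of_le ht.1.le]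
      exact Icc_subset_Icc_right ht.2.le))

/-- `ae_eq_add_primitive` for a derivative in a larger space: `R` is an embedding. -/
theorem ae_eq_add_primitive_of_injective {R : V →L[ℝ] F} (hR : Function.Injective R) {T : ℝ}
    (hT : 0 < T) {y r : ℝ → V} {y₀ : V} {w dv W : ℝ → F} (hy : Integrable y (timeMeasure T))
    (hr : Integrable r (timeMeasure T)) (hwy : ∀ t, w t = R (y t))
    (hdv : ∀ᵐ t ∂timeMeasure T, dv t = R (r t))
    (h : ∀ φ, IsTestFunction (Ioo 0 T) φ →
      ∫ t, deriv φ t • w t ∂timeMeasure T = -∫ t, φ t • dv t ∂timeMeasure T)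
    (hW : ContinuousOn W (Icc 0 T)) (hWw : ∀ᵐ t ∂timeMeasure T, W t = w t) (hW0 : W 0 = R y₀) :
    ∀ᵐ t ∂timeMeasure T, y t = y₀ + ∫ s in (0 : ℝ)..t, r s := by
  have hwi : Integrable w (timeMeasure T) :=
    (R.integrable_comp hy).congr (ae_of_all _ fun t => (hwy t).symm)
  have hri : Integrable (fun t => R (r t)) (timeMeasure T) := R.integrable_comp hr
  have h1 := ae_eq_add_primitive hT hwi hri (fun φ hφ => by
    rw [h φ hφ]
    congr 1
    exact integral_congr_ae (hdv.mono fun t ht => by simp only [ht])) hW hWw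
  filter_upwards [h1, ae_restrict_mem measurableSet_Ioo] with t h2 ht
  rw [hwy, hW0, map_primitive R hr ht, ← map_add] at h2
  exact hR h2

/-- Converse of `ae_eq_add_primitive_of_injective`. -/
theorem exists_primitive_of_ae_eq (R : V →L[ℝ] F) {T : ℝ} (hT : 0 < T) {y r : ℝ → V} {y₀ : V}
    (hr : Integrable r (timeMeasure T))
    (h : ∀ᵐ t ∂timeMeasure T, y t = y₀ + ∫ s in (0 : ℝ)..t, r s) :
    (∀ φ, IsTestFunction (Ioo 0 T) φ →
      ∫ t, deriv φ t • R (y t) ∂timeMeasure T = -∫ t, φ t • R (r t) ∂timeMeasure T) ∧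
    ∃ W : ℝ → F, ContinuousOn W (Icc 0 T) ∧ (∀ᵐ t ∂timeMeasure T, W t = R (y t)) ∧ W 0 = R y₀ := by
  refine ⟨fun φ hφ => ?_, fun t => R (y₀ + ∫ s in (0 : ℝ)..t, r s),
    R.continuous.comp_continuousOn (continuousOn_const.add (continuousOn_primitive_timeMeasure hT hr)),
    h.mono fun t ht => by rw [ht], by simp⟩
  refine integral_deriv_smul_of_ae_eq_add_primitive hT (c := R y₀) (R.integrable_comp hr) ?_ hφ
  filter_upwards [h, ae_restrict_mem measurableSet_Ioo] with t h1 ht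
  rw [h1, map_add]
  congr 1
  exact (map_primitive R hr ht).symm

end WeakDerivative

section Riesz

/-- The Riesz isomorphism of a real Hilbert space, as a linear map (`InnerProductSpace.toDual` is
conjugate-linear, with the trivial conjugation of `ℝ`). -/
def rieszMap (V : Type*) [NormedAddCommGroup V] [InnerProductSpace ℝ V] [CompleteSpace V] :
    V →L[ℝ] StrongDual ℝ V where
  toFun := InnerProductSpace.toDual ℝ V
  map_add' := map_add _
  map_smul' := fun c x => by simp
  cont := (InnerProductSpace.toDual ℝ V).continuous

theorem rieszMap_apply {V : Type*} [NormedAddCommGroup V] [InnerProductSpace ℝ V] [CompleteSpace V]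
    (x y : V) : rieszMap V x y = ⟪x, y⟫_ℝ := InnerProductSpace.toDual_apply_apply

theorem rieszMap_injective (V : Type*) [NormedAddCommGroup V] [InnerProductSpace ℝ V]
    [CompleteSpace V] : Function.Injective (rieszMap V) := (InnerProductSpace.toDual ℝ V).injective

variable {V : Type*} [NormedAddCommGroup V] [InnerProductSpace ℝ V] [CompleteSpace V] {T : ℝ}

theorem memLp_rieszMap {r : ℝ → V} (hr : MemLp r 2 (timeMeasure T)) :
    MemLp (fun t => rieszMap V (r t)) 2 (timeMeasure T) := (rieszMap V).comp_memLp' hr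

/-- A weak time derivative in the dual space, in integrated form. -/
theorem ae_eq_add_primitive_of_riesz (hT : 0 < T) {y r : ℝ → V} {y₀ : V}
    {w dv W : ℝ → StrongDual ℝ V} (hy : Integrable y (timeMeasure T))
    (hr : Integrable r (timeMeasure T)) (hwy : ∀ t, w t = rieszMap V (y t))
    (hdv : ∀ᵐ t ∂timeMeasure T, dv t = rieszMap V (r t))
    (h : ∀ φ, IsTestFunction (Ioo 0 T) φ →
      ∫ t, deriv φ t • w t ∂timeMeasure T = -∫ t, φ t • dv t ∂timeMeasure T)
    (hW : ContinuousOn W (Icc 0 T)) (hWw : ∀ᵐ t ∂timeMeasure T, W t = w t)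
    (hW0 : W 0 = rieszMap V y₀) :
    ∀ᵐ t ∂timeMeasure T, y t = y₀ + ∫ s in (0 : ℝ)..t, r s :=
  ae_eq_add_primitive_of_injective (R := rieszMap V) (rieszMap_injective V) hT hy hr hwy hdv h hW hWw
    hW0

/-- Conversely, a primitive of a square-integrable function has a weak time derivative in the dual
space, and a representative which is continuous with values in the dual space. -/
theorem exists_weak_derivative_of_riesz {V : Type} [NormedAddCommGroup V] [InnerProductSpace ℝ V]
    [CompleteSpace V] {T : ℝ} (hT : 0 < T) {y r : ℝ → V} {y₀ : V} (hr : MemLp r 2 (timeMeasure T))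
    (h : ∀ᵐ t ∂timeMeasure T, y t = y₀ + ∫ s in (0 : ℝ)..t, r s) :
    ∃ dv : L2T T (StrongDual ℝ V), (∀ᵐ t ∂timeMeasure T, dv t = rieszMap V (r t)) ∧
      (∀ φ, IsTestFunction (Ioo 0 T) φ → ∫ t, deriv φ t • rieszMap V (y t) ∂timeMeasure T =
        -∫ t, φ t • dv t ∂timeMeasure T) ∧
      ∃ W : ℝ → StrongDual ℝ V, ContinuousOn W (Icc 0 T) ∧
        (∀ᵐ t ∂timeMeasure T, W t = rieszMap V (y t)) ∧ W 0 = rieszMap V y₀ := by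
  have hm := memLp_rieszMap hr
  obtain ⟨h1, h2⟩ := exists_primitive_of_ae_eq (rieszMap V) hT (hr.integrable (by norm_num)) h
  refine ⟨hm.toLp _, hm.coeFn_toLp, fun φ hφ => ?_, h2⟩
  rw [h1 φ hφ]
  congr 1
  exact integral_congr_ae (hm.coeFn_toLp.mono fun t ht => by simp only [ht])

end Riesz

section Translation

variable {n : ℕ} {Ω Γ₁ : Set (Euc n)}

theorem inner_eq_integral_mul {S : Type*} [MeasurableSpace S] {μ : Measure S} (f w : Lp ℝ 2 μ)
    {w' : S → ℝ} (hw : w =ᵐ[μ] w') : ⟪f, w⟫_ℝ = ∫ x, f x * w' x ∂μ := by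
  rw [L2.inner_def]
  refine integral_congr_ae (hw.mono fun x hx => ?_)
  simp [hx, mul_comm]

/-- Under the Riesz isomorphism, the embedding of `L²(Ω)` into the dual of `H¹(Ω)` is the adjoint of
the embedding of `H¹(Ω)` into `L²(Ω)`. -/
theorem toH1dual_eq (f : L2 Ω) : L2.toH1dual f = rieszMap (H1 Ω) (((H1.toL2 Ω)†) f) := by
  ext z
  rw [rieszMap_apply, ContinuousLinearMap.adjoint_inner_left]
  rfl

/-- The right-hand side of the evolution equation, as an element of `H¹(Ω)`. -/
def residual (τ : H1 Ω →L[ℝ] L2surf Γ₁) (g : L2 Ω) (h : L2surf Γ₁) (u : H1 Ω) (ξ : L2surf Γ₁) :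
    H1 Ω :=
  ((H1.toL2 Ω)†) g + (τ†) h - ((H1.grad Ω)†) (H1.grad Ω u) - (τ†) ξ

/-- The variational identity for all `z` says that `dv` is the Riesz representation of the residual.
-/
theorem equation_iff {τ : H1 Ω →L[ℝ] L2surf Γ₁} (hτ : ∀ u, τ u =ᵐ[surface Γ₁] trace u)
    (dv : H1dual Ω) (g : L2 Ω) (h : L2surf Γ₁) (u : H1 Ω) (ξ : L2surf Γ₁) :
    (∀ z : H1 Ω, dv z + (∫ x in Ω, inner ℝ (H1.grad Ω u x) (H1.grad Ω z x))
          + (∫ x, ξ x * trace z x ∂surface Γ₁)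
        = (∫ x in Ω, g x * H1.toL2 Ω z x) + (∫ x, h x * trace z x ∂surface Γ₁)) ↔
      dv = rieszMap (H1 Ω) (residual τ g h u ξ) := by
  rw [ContinuousLinearMap.ext_iff]
  refine forall_congr' fun z => ?_
  rw [rieszMap_apply, residual, inner_sub_left, inner_sub_left, inner_add_left,
    ContinuousLinearMap.adjoint_inner_left, ContinuousLinearMap.adjoint_inner_left,
    ContinuousLinearMap.adjoint_inner_left, ContinuousLinearMap.adjoint_inner_left,
    inner_eq_integral_mul g _ EventuallyEq.rfl, inner_eq_integral_mul h _ (hτ z),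
    inner_eq_integral_mul ξ _ (hτ z), L2.inner_def]
  constructor <;> intro h <;> linarith

theorem mem_graphOperator_linearGraph {α : ℝ} {u v : L2 Ω} :
    v ∈ graphOperator (linearGraph α) u ↔ v = α • u := by
  constructor
  · intro h
    refine Lp.ext ?_
    have h' : ∀ᵐ x ∂volume.restrict Ω, v x ∈ linearGraph α (u x) := h
    filter_upwards [h', Lp.coeFn_smul α u] with x h1 h2
    rw [h2]; exact h1
  · rintro rfl
    exact (Lp.coeFn_smul α u).mono fun x hx => by rw [hx]; rfl

theorem memLp_residual {T : ℝ} {τ : H1 Ω →L[ℝ] L2surf Γ₁} {g : ℝ → L2 Ω} {h : ℝ → L2surf Γ₁}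
    {u : ℝ → H1 Ω} {ξ : ℝ → L2surf Γ₁} (hg : MemLp g 2 (timeMeasure T))
    (hh : MemLp h 2 (timeMeasure T)) (hu : MemLp u 2 (timeMeasure T))
    (hξ : MemLp ξ 2 (timeMeasure T)) :
    MemLp (fun t => residual τ (g t) (h t) (u t) (ξ t)) 2 (timeMeasure T) :=
  (((((H1.toL2 Ω)†).comp_memLp' hg).add ((τ†).comp_memLp' hh)).sub
    (((H1.grad Ω)†).comp_memLp' ((H1.grad Ω).comp_memLp' hu))).sub ((τ†).comp_memLp' hξ)

set_option maxHeartbeats 2000000 in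
/-- Every solution of the variational problem satisfies the evolution equation integrated in time. -/
theorem IsSolution.integrated {T : ℝ} (hT : 0 < T) {α : ℝ} {β : ℝ → Set ℝ}
    {τ : H1 Ω →L[ℝ] L2surf Γ₁} (hτ : ∀ u, τ u =ᵐ[surface Γ₁] trace u) {u₀ v₀ : L2 Ω}
    {g : L2T T (L2 Ω)} {h : L2T T (L2surf Γ₁)} {u : L2T T (H1 Ω)} {v : L2T T (L2 Ω)}
    {ξ : L2T T (L2surf Γ₁)} (hs : IsSolution (linearGraph α) β v₀ g h u v ξ)
    (hv₀ : v₀ ∈ graphOperator (linearGraph α) u₀) :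
    ∀ᵐ t ∂timeMeasure T, α • ((H1.toL2 Ω)†) (H1.toL2 Ω (u t)) = α • ((H1.toL2 Ω)†) u₀ +
      ∫ s in (0 : ℝ)..t, residual τ (g s) (h s) (u s) (ξ s) := by
  obtain ⟨dv, hdv, heq⟩ := hs.equation
  obtain ⟨W, hW, hWv, hW0⟩ := hs.initial
  have hv₀' := mem_graphOperator_linearGraph.1 hv₀
  have hvi : Integrable (fun t => ((H1.toL2 Ω)†) (v t)) (timeMeasure T) :=
    ContinuousLinearMap.integrable_comp _ ((Lp.memLp v).integrable (by norm_num))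
  have hres : Integrable (fun t => residual τ (g t) (h t) (u t) (ξ t)) (timeMeasure T) :=
    (memLp_residual (Lp.memLp g) (Lp.memLp h) (Lp.memLp u) (Lp.memLp ξ)).integrable (by norm_num)
  have h1 := ae_eq_add_primitive_of_riesz hT hvi hres
    (fun t => toH1dual_eq (v t)) (heq.mono fun t ht => (equation_iff hτ _ _ _ _ _).1 ht) hdv hW hWv
    (hW0.trans (toH1dual_eq v₀))
  filter_upwards [h1, hs.mem_gamma] with t h2 h3
  rw [mem_graphOperator_linearGraph.1 h3, hv₀', map_smul, map_smul] at h2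
  exact h2

set_option maxHeartbeats 2000000 in
/-- Conversely, a solution of the integrated evolution equation solves the variational problem. -/
theorem isSolution_of_integrated {T : ℝ} (hT : 0 < T) {α : ℝ} {β : ℝ → Set ℝ}
    {τ : H1 Ω →L[ℝ] L2surf Γ₁} (hτ : ∀ u, τ u =ᵐ[surface Γ₁] trace u) {u₀ v₀ : L2 Ω}
    {g : L2T T (L2 Ω)} {h : L2T T (L2surf Γ₁)} {u : ℝ → H1 Ω} {ξ : ℝ → L2surf Γ₁}
    (hu : MemLp u 2 (timeMeasure T)) (hξ : MemLp ξ 2 (timeMeasure T))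
    (hv₀ : v₀ ∈ graphOperator (linearGraph α) u₀)
    (heq : ∀ᵐ t ∂timeMeasure T, α • ((H1.toL2 Ω)†) (H1.toL2 Ω (u t)) = α • ((H1.toL2 Ω)†) u₀ +
      ∫ s in (0 : ℝ)..t, residual τ (g s) (h s) (u s) (ξ s))
    (hmem : ∀ᵐ t ∂timeMeasure T, ∀ᵐ x ∂surface Γ₁, ξ t x ∈ β (τ (u t) x)) :
    ∃ (u' : L2T T (H1 Ω)) (v : L2T T (L2 Ω)) (ξ' : L2T T (L2surf Γ₁)),
      IsSolution (linearGraph α) β v₀ g h u' v ξ' := by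
  have hvm : MemLp (fun t => α • H1.toL2 Ω (u t)) 2 (timeMeasure T) :=
    ((H1.toL2 Ω).comp_memLp' hu).const_smul α
  have hrm := memLp_residual (τ := τ) (Lp.memLp g) (Lp.memLp h) hu hξ
  obtain ⟨dv, hdv, hweak, W, hW, hWy, hW0⟩ := exists_weak_derivative_of_riesz hT
    (y := fun t => ((H1.toL2 Ω)†) (hvm.toLp _ t)) (y₀ := ((H1.toL2 Ω)†) v₀) hrm (by
      filter_upwards [heq, hvm.coeFn_toLp] with t h1 h2
      rw [h2, mem_graphOperator_linearGraph.1 hv₀, map_smul, map_smul, h1])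
  have hJ : (fun t => L2.toH1dual (hvm.toLp _ t)) =
      fun t => rieszMap (H1 Ω) (((H1.toL2 Ω)†) (hvm.toLp _ t)) := funext fun t => toH1dual_eq _
  refine ⟨hu.toLp u, hvm.toLp _, hξ.toLp ξ, ⟨dv, fun φ hφ => ?_, ?_⟩, ?_, ?_, ?_⟩
  · exact (congrArg (fun f : ℝ → H1dual Ω => ∫ t, deriv φ t • f t ∂timeMeasure T) hJ).trans (hweak φ hφ)
  · filter_upwards [hdv, hu.coeFn_toLp, hξ.coeFn_toLp] with t h1 h2 h3
    rw [h2, h3]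
    exact (equation_iff hτ _ _ _ _ _).2 h1
  · filter_upwards [hvm.coeFn_toLp, hu.coeFn_toLp] with t h1 h2
    rw [h1, h2]
    exact mem_graphOperator_linearGraph.2 rfl
  · filter_upwards [hmem, hu.coeFn_toLp, hξ.coeFn_toLp] with t h1 h2 h3
    rw [h2, h3]
    filter_upwards [h1, hτ (u t)] with x h4 h5
    rwa [h5] at h4
  · exact ⟨W, hW, hWy.mono fun t ht => ht.trans (toH1dual_eq _).symm, hW0.trans (toH1dual_eq _).symm⟩

end Translation

/-! ### Stability, uniqueness and existence -/

section Source

variable {S : Type*} [MeasurableSpace S] {μ : Measure S}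

/-- The norm of `L^∞` is lower semicontinuous on `L²`. In particular it is Borel, so that `t ↦
‖g(t)‖_∞` is measurable. -/
theorem lowerSemicontinuous_eLpNorm_top :
    LowerSemicontinuous fun f : Lp ℝ 2 μ => eLpNorm f ⊤ μ := by
  refine lowerSemicontinuous_iff_isClosed_preimage.2 fun c => IsSeqClosed.isClosed fun f f₀ hf hlim => ?_
  obtain ⟨k, -, hk⟩ := (tendstoInMeasure_of_tendsto_Lp hlim).exists_seq_tendsto_ae
  have hb : ∀ᵐ x ∂μ, ∀ i, ‖f (k i) x‖ₑ ≤ c := ae_all_iff.2 fun i => by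
    have h := hf (k i)
    rw [mem_preimage, mem_Iic, eLpNorm_exponent_top] at h
    filter_upwards [enorm_ae_le_eLpNormEssSup (f (k i)) μ] with x hx using hx.trans h
  rw [mem_preimage, mem_Iic, eLpNorm_exponent_top]
  refine eLpNormEssSup_le_of_ae_enorm_bound ?_
  filter_upwards [hk, hb] with x h1 h2
  exact le_of_tendsto h1.enorm (Eventually.of_forall h2)

theorem inner_le_eLpNorm_top_mul_integral [IsFiniteMeasure μ] {f : Lp ℝ 2 μ}
    (hf : eLpNorm f ⊤ μ ≠ ⊤) (z : Lp ℝ 2 μ) :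
    ⟪f, z⟫_ℝ ≤ (eLpNorm f ⊤ μ).toReal * ∫ x, |z x| ∂μ := by
  have hz : Integrable (fun x => |z x|) μ := ((Lp.memLp z).integrable (by norm_num)).abs
  rw [inner_eq_integral_mul f z EventuallyEq.rfl, ← integral_const_mul]
  refine integral_mono_ae ((Lp.memLp f).integrable_mul (Lp.memLp z)) (hz.const_mul _) ?_
  filter_upwards [enorm_ae_le_eLpNormEssSup f μ] with x hx
  rw [← eLpNorm_exponent_top] at hx
  have h1 : |f x| ≤ (eLpNorm f ⊤ μ).toReal := by
    have := ENNReal.toReal_mono hf hx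
    rwa [toReal_enorm, Real.norm_eq_abs] at this
  calc f x * z x ≤ |f x * z x| := le_abs_self _
    _ = |f x| * |z x| := abs_mul _ _
    _ ≤ _ := mul_le_mul_of_nonneg_right h1 (abs_nonneg _)

/-- A function in `L¹(0,T;L^∞)` acts on `L¹` with an integrable norm. -/
theorem exists_integrable_bound_of_lintegral_eLpNorm_top [IsFiniteMeasure μ] {T : ℝ}
    {g : ℝ → Lp ℝ 2 μ} (hgm : AEStronglyMeasurable g (timeMeasure T))
    (hg : ∫⁻ t, eLpNorm (g t) ⊤ μ ∂timeMeasure T < ⊤) :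
    ∃ G : ℝ → ℝ, Integrable G (timeMeasure T) ∧ (∀ t, 0 ≤ G t) ∧
      ∀ᵐ t ∂timeMeasure T, ∀ z : Lp ℝ 2 μ, ⟪g t, z⟫_ℝ ≤ G t * ∫ x, |z x| ∂μ := by
  let _ : MeasurableSpace (Lp ℝ 2 μ) := borel _
  have : BorelSpace (Lp ℝ 2 μ) := ⟨rfl⟩
  have hm : AEMeasurable (fun t => eLpNorm (g t) ⊤ μ) (timeMeasure T) :=
    lowerSemicontinuous_eLpNorm_top.measurable.comp_aemeasurable hgm.aemeasurable
  refine ⟨fun t => (eLpNorm (g t) ⊤ μ).toReal, integrable_toReal_of_lintegral_ne_top hm hg.ne,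
    fun t => ENNReal.toReal_nonneg, ?_⟩
  filter_upwards [ae_lt_top' hm hg.ne] with t ht z
  exact inner_le_eLpNorm_top_mul_integral ht.ne z

end Source

section Primitive

variable {F : Type*} [NormedAddCommGroup F] [NormedSpace ℝ F] [CompleteSpace F] {T : ℝ}

theorem ae_eq_add_primitive_sub {y₁ y₂ r₁ r₂ : ℝ → F} {a₁ a₂ : F}
    (hr₁ : Integrable r₁ (timeMeasure T)) (hr₂ : Integrable r₂ (timeMeasure T))
    (h₁ : ∀ᵐ t ∂timeMeasure T, y₁ t = a₁ + ∫ s in (0 : ℝ)..t, r₁ s)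
    (h₂ : ∀ᵐ t ∂timeMeasure T, y₂ t = a₂ + ∫ s in (0 : ℝ)..t, r₂ s) :
    ∀ᵐ t ∂timeMeasure T, y₁ t - y₂ t = (a₁ - a₂) + ∫ s in (0 : ℝ)..t, (r₁ s - r₂ s) := by
  filter_upwards [h₁, h₂, ae_restrict_mem measurableSet_Ioo] with t h1 h2 ht
  have hi : ∀ {r : ℝ → F}, Integrable r (timeMeasure T) → IntervalIntegrable r volume 0 t :=
    fun hr => (intervalIntegrable_of_integrable (ht.1.trans ht.2).le hr).mono_set (by
      rw [uIcc_of_le (ht.1.trans ht.2).le, uIcc_of_le ht.1.le]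
      exact Icc_subset_Icc_right ht.2.le)
  rw [intervalIntegral.integral_sub (hi hr₁) (hi hr₂), h1, h2]
  abel

/-- The derivative is determined by the function. -/
theorem ae_eq_of_ae_eq_add_primitive (hT : 0 < T) {y r₁ r₂ : ℝ → F} {a : F}
    (hr₁ : Integrable r₁ (timeMeasure T)) (hr₂ : Integrable r₂ (timeMeasure T))
    (h₁ : ∀ᵐ t ∂timeMeasure T, y t = a + ∫ s in (0 : ℝ)..t, r₁ s)
    (h₂ : ∀ᵐ t ∂timeMeasure T, y t = a + ∫ s in (0 : ℝ)..t, r₂ s) :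
    r₁ =ᵐ[timeMeasure T] r₂ :=
  ae_eq_of_integral_smul_eq hr₁ hr₂ fun _ hφ => neg_injective <|
    (integral_deriv_smul_of_ae_eq_add_primitive hT hr₁ h₁ hφ).symm.trans
      (integral_deriv_smul_of_ae_eq_add_primitive hT hr₂ h₂ hφ)

end Primitive

section Stability

variable {n : ℕ} {Ω Γ₀ Γ₁ : Set (Euc n)}

/-- The trace operator on a part `Γ₁` of the boundary, with a bound independent of `Γ₁`. -/
theorem IsSmoothBoundedDomain.exists_traceCLM_restrict (hΩ : IsSmoothBoundedDomain Ω) :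
    ∃ c : ℝ, 0 ≤ c ∧ ∀ Γ₀ Γ₁ : Set (Euc n), IsBoundaryPartition Ω Γ₀ Γ₁ →
      ∃ τ : H1 Ω →L[ℝ] L2surf Γ₁, (∀ u, τ u =ᵐ[surface Γ₁] trace u) ∧ ∀ u, ‖τ u‖ ≤ c * ‖u‖ := by
  obtain ⟨τ, hτ⟩ := hΩ.exists_traceCLM
  refine ⟨‖τ‖, τ.opNorm_nonneg, fun Γ₀ Γ₁ hΓ => ?_⟩
  obtain ⟨R, hR, hR'⟩ := hΓ.exists_restrict
  refine ⟨R ∘L τ, fun u => ?_, fun u => (hR' _).trans (τ.le_opNorm u)⟩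
  rw [← hτ]
  exact hR _

/-- The traces on `Γ₁` are dense in `L²(Γ₁)`, since they contain the smooth functions. -/
theorem IsSmoothBoundedDomain.adjoint_trace_injective (hΩ : IsSmoothBoundedDomain Ω)
    (hΓ : IsBoundaryPartition Ω Γ₀ Γ₁) {τ : H1 Ω →L[ℝ] L2surf Γ₁}
    (hτ : ∀ u, τ u =ᵐ[surface Γ₁] trace u) : Function.Injective (τ†) := by
  rw [injective_iff_map_eq_zero]
  intro ξ hξ
  have := hΩ.isFiniteMeasure_surface
  have hfin : IsFiniteMeasure (surface Γ₁) := isFiniteMeasure_of_le _ hΓ.surface_le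
  have hξi : Integrable ξ (surface Γ₁) := (Lp.memLp ξ).integrable (by norm_num)
  refine (Lp.eq_zero_iff_ae_eq_zero).2
    (ae_eq_zero_of_integral_contDiff_smul_eq_zero hξi.locallyIntegrable fun φ hφ _ => ?_)
  have hφ1 : ContDiff ℝ 1 φ := hφ.of_le (by simp)
  obtain ⟨z, hz⟩ := exists_H1_of_contDiff hΩ.isBounded hφ1
  have hw := hΩ.memLp_surface hφ.continuous
  have htr : trace z = hw.toLp φ := hΩ.trace_eq (subset_closure ⟨φ, hφ1, hz, hw.coeFn_toLp⟩)
  have hτz : τ z =ᵐ[surface Γ₁] φ := by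
    refine (hτ z).trans ?_
    rw [htr]
    exact ae_mono hΓ.surface_le hw.coeFn_toLp
  have h0 : ⟪ξ, τ z⟫_ℝ = 0 := by
    rw [← ContinuousLinearMap.adjoint_inner_left, hξ, inner_zero_left]
  rw [inner_eq_integral_mul ξ _ hτz] at h0
  rw [← h0]
  exact integral_congr_ae (ae_of_all _ fun x => mul_comm _ _)

/-- The residual is linear in all data. -/
theorem residual_sub (τ : H1 Ω →L[ℝ] L2surf Γ₁) (g₁ g₂ : L2 Ω) (h₁ h₂ : L2surf Γ₁) (u₁ u₂ : H1 Ω)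
    (ξ₁ ξ₂ : L2surf Γ₁) : residual τ g₁ h₁ u₁ ξ₁ - residual τ g₂ h₂ u₂ ξ₂ =
      residual τ (g₁ - g₂) (h₁ - h₂) (u₁ - u₂) (ξ₁ - ξ₂) := by
  simp only [residual, map_sub]
  abel

/-- The residual tested with `u`: a boundary term of the right sign can be dropped. -/
theorem inner_residual_le {τ : H1 Ω →L[ℝ] L2surf Γ₁} {c : ℝ} (hc : ∀ u, ‖τ u‖ ≤ c * ‖u‖)
    {g : L2 Ω} {h : L2surf Γ₁} {u : H1 Ω} {ξ : L2surf Γ₁} (hξ : 0 ≤ ⟪ξ, τ u⟫_ℝ) :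
    ⟪residual τ g h u ξ, u⟫_ℝ ≤ -‖H1.grad Ω u‖ ^ 2 + (‖g‖ + c * ‖h‖) * ‖u‖ := by
  have h1 : ‖H1.toL2 Ω u‖ ≤ ‖u‖ := by
    refine abs_le_of_sq_le_sq' ?_ (norm_nonneg _) |>.2
    rw [H1.norm_sq]
    exact le_add_of_nonneg_right (sq_nonneg _)
  have h2 := (real_inner_le_norm g (H1.toL2 Ω u)).trans
    (mul_le_mul_of_nonneg_left h1 (norm_nonneg g))
  have h3 := (real_inner_le_norm h (τ u)).trans (mul_le_mul_of_nonneg_left (hc u) (norm_nonneg h))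
  rw [residual, inner_sub_left, inner_sub_left, inner_add_left,
    ContinuousLinearMap.adjoint_inner_left, ContinuousLinearMap.adjoint_inner_left,
    ContinuousLinearMap.adjoint_inner_left, ContinuousLinearMap.adjoint_inner_left,
    real_inner_self_eq_norm_sq]
  linarith

/-- The monotonicity of `β` gives the boundary term of the difference of two solutions its sign. -/
theorem inner_sub_trace_nonneg {β : ℝ → Set ℝ}
    (hβ : ∀ x y, ∀ a ∈ β x, ∀ b ∈ β y, 0 ≤ (a - b) * (x - y)) {τ : H1 Ω →L[ℝ] L2surf Γ₁}
    (hτ : ∀ u, τ u =ᵐ[surface Γ₁] trace u) {u₁ u₂ : H1 Ω} {ξ₁ ξ₂ : L2surf Γ₁}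
    (h₁ : ∀ᵐ x ∂surface Γ₁, ξ₁ x ∈ β (trace u₁ x)) (h₂ : ∀ᵐ x ∂surface Γ₁, ξ₂ x ∈ β (trace u₂ x)) :
    0 ≤ ⟪ξ₁ - ξ₂, τ (u₁ - u₂)⟫_ℝ := by
  rw [inner_eq_integral_mul _ _ EventuallyEq.rfl, map_sub]
  refine integral_nonneg_of_ae ?_
  filter_upwards [h₁, h₂, hτ u₁, hτ u₂, Lp.coeFn_sub ξ₁ ξ₂, Lp.coeFn_sub (τ u₁) (τ u₂)]
    with x h3 h4 h5 h6 h7 h8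
  rw [h7, h8, Pi.sub_apply, Pi.sub_apply, h5, h6]
  exact hβ _ _ _ h3 _ h4

set_option maxHeartbeats 2000000 in
/-- The difference of two solutions, tested with itself. -/
theorem IsSolution.energy_bound_sub {T : ℝ} (hT : 0 < T) {α : ℝ} (hα : 0 < α) {β : ℝ → Set ℝ}
    (hβ : ∀ x y, ∀ a ∈ β x, ∀ b ∈ β y, 0 ≤ (a - b) * (x - y))
    {τ : H1 Ω →L[ℝ] L2surf Γ₁} (hτ : ∀ u, τ u =ᵐ[surface Γ₁] trace u)
    {c : ℝ} (hc : ∀ u, ‖τ u‖ ≤ c * ‖u‖) {u₀₁ v₀₁ u₀₂ v₀₂ : L2 Ω} {g₁ g₂ : L2T T (L2 Ω)}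
    {h₁ h₂ : L2T T (L2surf Γ₁)} {u₁ u₂ : L2T T (H1 Ω)} {v₁ v₂ : L2T T (L2 Ω)}
    {ξ₁ ξ₂ : L2T T (L2surf Γ₁)} (hs₁ : IsSolution (linearGraph α) β v₀₁ g₁ h₁ u₁ v₁ ξ₁)
    (hs₂ : IsSolution (linearGraph α) β v₀₂ g₂ h₂ u₂ v₂ ξ₂)
    (hv₁ : v₀₁ ∈ graphOperator (linearGraph α) u₀₁)
    (hv₂ : v₀₂ ∈ graphOperator (linearGraph α) u₀₂) :
    (∫ t, ‖u₁ t - u₂ t‖ ^ 2 ∂timeMeasure T ≤ α * (Real.exp (2 * (2 / α * (T + 1))) *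
      (‖u₀₁ - u₀₂‖ ^ 2 + 2 * α⁻¹ * ∫ t, (‖g₁ t - g₂ t‖ + c * ‖h₁ t - h₂ t‖) ^ 2 ∂timeMeasure T))) ∧
    ∀ᵐ t ∂timeMeasure T, ‖H1.toL2 Ω (u₁ t - u₂ t)‖ ^ 2 ≤ Real.exp (2 * (2 / α * (T + 1))) *
      (‖u₀₁ - u₀₂‖ ^ 2 + 2 * α⁻¹ * ∫ t, (‖g₁ t - g₂ t‖ + c * ‖h₁ t - h₂ t‖) ^ 2 ∂timeMeasure T) := by
  have hr₁ := memLp_residual (τ := τ) (Lp.memLp g₁) (Lp.memLp h₁) (Lp.memLp u₁) (Lp.memLp ξ₁)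
  have hr₂ := memLp_residual (τ := τ) (Lp.memLp g₂) (Lp.memLp h₂) (Lp.memLp u₂) (Lp.memLp ξ₂)
  have hb : MemLp (fun t => ‖g₁ t - g₂ t‖ + c * ‖h₁ t - h₂ t‖) 2 (timeMeasure T) :=
    ((Lp.memLp g₁).sub (Lp.memLp g₂)).norm.add (((Lp.memLp h₁).sub (Lp.memLp h₂)).norm.const_mul c)
  refine energy_bound (J := H1.toL2 Ω) (D := H1.grad Ω) H1.norm_sq hα hT
    ((Lp.memLp u₁).sub (Lp.memLp u₂)) (hr₁.sub hr₂) hb ?_ ?_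
  · have key := ae_eq_add_primitive_sub (hr₁.integrable (by norm_num)) (hr₂.integrable (by norm_num))
      (hs₁.integrated hT hτ hv₁) (hs₂.integrated hT hτ hv₂)
    filter_upwards [key] with t ht
    rw [map_sub, map_sub, map_sub, smul_sub, smul_sub]
    exact ht
  · filter_upwards [hs₁.mem_beta, hs₂.mem_beta] with t h3 h4
    rw [Pi.sub_apply, residual_sub]
    exact inner_residual_le hc (inner_sub_trace_nonneg hβ hτ h3 h4)

theorem Lp.norm_sub_sq {S E : Type*} [MeasurableSpace S] {μ : Measure S} [NormedAddCommGroup E]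
    [InnerProductSpace ℝ E] (f g : Lp E 2 μ) : ‖f - g‖ ^ 2 = ∫ t, ‖f t - g t‖ ^ 2 ∂μ := by
  rw [← real_inner_self_eq_norm_sq, L2.inner_def]
  refine integral_congr_ae ((Lp.coeFn_sub f g).mono fun t ht => ?_)
  simp only [ht, Pi.sub_apply, real_inner_self_eq_norm_sq]

/-- The source term of the energy estimate in terms of the norms of the data. -/
theorem integral_add_sq_le {S E F : Type*} [MeasurableSpace S] {μ : Measure S}
    [NormedAddCommGroup E] [InnerProductSpace ℝ E] [NormedAddCommGroup F] [InnerProductSpace ℝ F]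
    (f₁ f₂ : Lp E 2 μ) (g₁ g₂ : Lp F 2 μ) (c : ℝ) :
    ∫ t, (‖f₁ t - f₂ t‖ + c * ‖g₁ t - g₂ t‖) ^ 2 ∂μ ≤
      2 * ‖f₁ - f₂‖ ^ 2 + 2 * c ^ 2 * ‖g₁ - g₂‖ ^ 2 := by
  have hf : MemLp (fun t => ‖f₁ t - f₂ t‖) 2 μ := ((Lp.memLp f₁).sub (Lp.memLp f₂)).norm
  have hg : MemLp (fun t => ‖g₁ t - g₂ t‖) 2 μ := ((Lp.memLp g₁).sub (Lp.memLp g₂)).norm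
  rw [Lp.norm_sub_sq, Lp.norm_sub_sq, ← integral_const_mul, ← integral_const_mul,
    ← integral_add (hf.integrable_sq.const_mul _) (hg.integrable_sq.const_mul _)]
  refine integral_mono_ae (hf.add (hg.const_mul c)).integrable_sq
    ((hf.integrable_sq.const_mul _).add (hg.integrable_sq.const_mul _)) (ae_of_all _ fun t => ?_)
  simp only
  nlinarith [sq_nonneg (‖f₁ t - f₂ t‖ - c * ‖g₁ t - g₂ t‖)]

/-- The norm of `L²(0,T;H¹(Ω)) ∩ L^∞(0,T;L²(Ω))` from bounds of its two parts. -/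
theorem energyNorm_sq_le {T : ℝ} {w : L2T T (H1 Ω)} {a b : ℝ} (ha : ‖w‖ ^ 2 ≤ a) (hb0 : 0 ≤ b)
    (hb : ∀ᵐ t ∂timeMeasure T, ‖H1.toL2 Ω (w t)‖ ^ 2 ≤ b) :
    energyNorm w ^ 2 ≤ ENNReal.ofReal (2 * (a + b)) := by
  have ha0 : 0 ≤ a := (sq_nonneg _).trans ha
  have h1 : energyNorm w ≤ ENNReal.ofReal (√a + √b) := by
    rw [ENNReal.ofReal_add (Real.sqrt_nonneg _) (Real.sqrt_nonneg _)]
    refine add_le_add (ENNReal.ofReal_le_ofReal (Real.le_sqrt_of_sq_le ha)) ?_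
    rw [eLpNorm_exponent_top]
    refine eLpNormEssSup_le_of_ae_bound ?_
    exact hb.mono fun t ht => Real.le_sqrt_of_sq_le ht
  refine (pow_le_pow_left₀ zero_le h1 2).trans ?_
  rw [← ENNReal.ofReal_pow (by positivity)]
  refine ENNReal.ofReal_le_ofReal ?_
  nlinarith [Real.sq_sqrt ha0, Real.sq_sqrt hb0, sq_nonneg (√a - √b)]

/-- The solution is determined by the data. -/
theorem IsSolution.unique (hΩ : IsSmoothBoundedDomain Ω) (hΓ : IsBoundaryPartition Ω Γ₀ Γ₁) {T : ℝ}
    (hT : 0 < T) {α : ℝ} (hα : 0 < α) {β : ℝ → Set ℝ}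
    (hβ : ∀ x y, ∀ a ∈ β x, ∀ b ∈ β y, 0 ≤ (a - b) * (x - y))
    {u₀ v₀ : L2 Ω} {g : L2T T (L2 Ω)}
    {h : L2T T (L2surf Γ₁)} {u₁ u₂ : L2T T (H1 Ω)} {v₁ v₂ : L2T T (L2 Ω)}
    {ξ₁ ξ₂ : L2T T (L2surf Γ₁)} (hs₁ : IsSolution (linearGraph α) β v₀ g h u₁ v₁ ξ₁)
    (hs₂ : IsSolution (linearGraph α) β v₀ g h u₂ v₂ ξ₂)
    (hv : v₀ ∈ graphOperator (linearGraph α) u₀) : u₁ = u₂ ∧ v₁ = v₂ ∧ ξ₁ = ξ₂ := by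
  obtain ⟨c, -, hc⟩ := hΩ.exists_traceCLM_restrict
  obtain ⟨τ, hτ, hτc⟩ := hc Γ₀ Γ₁ hΓ
  have hu : u₁ = u₂ := by
    have h1 := (hs₁.energy_bound_sub hT hα hβ hτ hτc hs₂ hv hv).1
    rw [← Lp.norm_sub_sq] at h1
    simp only [sub_self, norm_zero, mul_zero, add_zero, ne_eq, OfNat.ofNat_ne_zero,
      not_false_eq_true, zero_pow, integral_zero] at h1
    exact sub_eq_zero.1 (norm_eq_zero.1 (pow_eq_zero_iff two_ne_zero |>.1
      (le_antisymm h1 (sq_nonneg _))))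
  subst hu
  refine ⟨rfl, Lp.ext ?_, Lp.ext ?_⟩
  · filter_upwards [hs₁.mem_gamma, hs₂.mem_gamma] with t h1 h2
    rw [mem_graphOperator_linearGraph.1 h1, mem_graphOperator_linearGraph.1 h2]
  · have hr₁ := memLp_residual (τ := τ) (Lp.memLp g) (Lp.memLp h) (Lp.memLp u₁) (Lp.memLp ξ₁)
    have hr₂ := memLp_residual (τ := τ) (Lp.memLp g) (Lp.memLp h) (Lp.memLp u₁) (Lp.memLp ξ₂)
    filter_upwards [ae_eq_of_ae_eq_add_primitive hT (hr₁.integrable (by norm_num))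
      (hr₂.integrable (by norm_num)) (hs₁.integrated hT hτ hv) (hs₂.integrated hT hτ hv)] with t ht
    exact hΩ.adjoint_trace_injective hΓ hτ (sub_right_injective ht)

set_option maxHeartbeats 1000000 in
/-- Existence, from the abstract evolution equation with `V = H¹(Ω)`, `H = L²(Ω)`, `X = L²(Γ₁)` and
the trace operator `τ`. -/
theorem exists_isSolution (hΩ : IsSmoothBoundedDomain Ω) (hΓ : IsBoundaryPartition Ω Γ₀ Γ₁) {T : ℝ}
    (hT : 0 < T) {α : ℝ} (hα : 0 < α) {β : ℝ → Set ℝ} {βhat : ℝ → ℝ} (hβ : IsBoundaryGraph β βhat)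
    {u₀ v₀ : L2 Ω} {g : L2T T (L2 Ω)} (h : L2T T (L2surf Γ₁))
    (hd : IsAdmissible (linearGraph α) βhat u₀ v₀ g) :
    ∃ (u : L2T T (H1 Ω)) (v : L2T T (L2 Ω)) (ξ : L2T T (L2surf Γ₁)),
      IsSolution (linearGraph α) β v₀ g h u v ξ := by
  obtain ⟨c, -, hc⟩ := hΩ.exists_traceCLM_restrict
  obtain ⟨τ, hτ, -⟩ := hc Γ₀ Γ₁ hΓ
  obtain ⟨N, Ψ, D₁, D₂, hD₁, hD₂, hN, hM, hNβ⟩ := exists_isYosidaFamily hΩ hΓ hβ hτ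
  obtain ⟨M, hM⟩ := hM u₀ hd.initial_integrable
  have : IsFiniteMeasure (volume.restrict Ω) :=
    isFiniteMeasure_restrict.2 hΩ.isBounded.measure_lt_top.ne
  obtain ⟨G, hG, hG0, hgG⟩ :=
    exists_integrable_bound_of_lintegral_eLpNorm_top (Lp.aestronglyMeasurable g) hd.source
  obtain ⟨u, ξ, hu, hξ, heq, hmin⟩ := exists_evolution_solution H1.norm_sq hN hD₁ hD₂ hα hT hM
    (Lp.memLp g) (Lp.memLp h) hG hG0 hgG
  exact isSolution_of_integrated hT hτ hu hξ hd.initial_mem heq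
    (hmin.mono fun t ht => hNβ _ _ ht)

end Stability

end DoublyNonlinear

end

theorem theorem2p4 (n : ℕ) (hn : 1 ≤ n) (Ω : Set (Euc n)) (hΩ : IsSmoothBoundedDomain Ω)
    (T : ℝ) (hT : 0 < T) (α : ℝ) (hα : 0 < α) :
    (∃ C : ℝ, 0 < C ∧
      ∀ (Γ₀ Γ₁ : Set (Euc n)), IsBoundaryPartition Ω Γ₀ Γ₁ →
      ∀ (β : ℝ → Set ℝ) (βhat : ℝ → ℝ), IsBoundaryGraph β βhat →
      ∀ (u₀₁ v₀₁ u₀₂ v₀₂ : L2 Ω) (g₁ g₂ : L2T T (L2 Ω)) (h₁ h₂ : L2T T (L2surf Γ₁)),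
        IsAdmissible (linearGraph α) βhat u₀₁ v₀₁ g₁ →
        IsAdmissible (linearGraph α) βhat u₀₂ v₀₂ g₂ →
      ∀ (u₁ u₂ : L2T T (H1 Ω)) (v₁ v₂ : L2T T (L2 Ω)) (ξ₁ ξ₂ : L2T T (L2surf Γ₁)),
        IsSolution (linearGraph α) β v₀₁ g₁ h₁ u₁ v₁ ξ₁ →
        IsSolution (linearGraph α) β v₀₂ g₂ h₂ u₂ v₂ ξ₂ →
        energyNorm (u₁ - u₂) ^ 2 ≤
          ENNReal.ofReal (C * (‖u₀₁ - u₀₂‖ ^ 2 + ‖g₁ - g₂‖ ^ 2 + ‖h₁ - h₂‖ ^ 2))) ∧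
    (∀ (Γ₀ Γ₁ : Set (Euc n)), IsBoundaryPartition Ω Γ₀ Γ₁ →
      ∀ (β : ℝ → Set ℝ) (βhat : ℝ → ℝ), IsBoundaryGraph β βhat →
      ∀ (u₀ v₀ : L2 Ω) (g : L2T T (L2 Ω)) (h : L2T T (L2surf Γ₁)),
        IsAdmissible (linearGraph α) βhat u₀ v₀ g →
        ∃! s : L2T T (H1 Ω) × L2T T (L2 Ω) × L2T T (L2surf Γ₁),
          IsSolution (linearGraph α) β v₀ g h s.1 s.2.1 s.2.2) := by
  obtain ⟨c, hc0, hc⟩ := hΩ.exists_traceCLM_restrict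
  set E := Real.exp (2 * (2 / α * (T + 1))) with hE
  have hE0 : 0 < E := Real.exp_pos _
  -- the energy bound gives `α E (...)` and `E (...)` for the two squared norms, and the square of their
  -- sum is at most twice the sum of the squares
  refine ⟨⟨2 * ((α + 1) * (E * (1 + 4 * α⁻¹ * (1 + c ^ 2)))), by positivity, ?_⟩, ?_⟩
  · intro Γ₀ Γ₁ hΓ β βhat hβ u₀₁ v₀₁ u₀₂ v₀₂ g₁ g₂ h₁ h₂ hd₁ hd₂ u₁ u₂ v₁ v₂ ξ₁ ξ₂ hs₁ hs₂
    obtain ⟨τ, hτ, hτc⟩ := hc Γ₀ Γ₁ hΓ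
    obtain ⟨e1, e2⟩ := hs₁.energy_bound_sub hT hα hβ.maximalMonotone.monotone hτ hτc hs₂
      hd₁.initial_mem hd₂.initial_mem
    rw [← Lp.norm_sub_sq] at e1
    have hb := integral_add_sq_le g₁ g₂ h₁ h₂ c
    have hb0 : 0 ≤ ∫ t, (‖g₁ t - g₂ t‖ + c * ‖h₁ t - h₂ t‖) ^ 2 ∂timeMeasure T :=
      integral_nonneg fun t => sq_nonneg _
    set B := ∫ t, (‖g₁ t - g₂ t‖ + c * ‖h₁ t - h₂ t‖) ^ 2 ∂timeMeasure T
    have e3 : ∀ᵐ t ∂timeMeasure T, ‖H1.toL2 Ω ((u₁ - u₂ : L2T T (H1 Ω)) t)‖ ^ 2 ≤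
        E * (‖u₀₁ - u₀₂‖ ^ 2 + 2 * α⁻¹ * B) := by
      filter_upwards [e2, Lp.coeFn_sub u₁ u₂] with t h3 h4
      rwa [h4, Pi.sub_apply]
    refine (energyNorm_sq_le e1 (by positivity) e3).trans (ENNReal.ofReal_le_ofReal ?_)
    have hα' : 0 < α⁻¹ := inv_pos.2 hα
    have key : ‖u₀₁ - u₀₂‖ ^ 2 + 2 * α⁻¹ * B ≤ (1 + 4 * α⁻¹ * (1 + c ^ 2)) *
        (‖u₀₁ - u₀₂‖ ^ 2 + ‖g₁ - g₂‖ ^ 2 + ‖h₁ - h₂‖ ^ 2) := by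
      have h5 := mul_le_mul_of_nonneg_left hb (by positivity : 0 ≤ 2 * α⁻¹)
      have h6 : 0 ≤ 4 * α⁻¹ * (1 + c ^ 2) * ‖u₀₁ - u₀₂‖ ^ 2 := by positivity
      have h7 : 0 ≤ (1 + 4 * α⁻¹ * c ^ 2) * ‖g₁ - g₂‖ ^ 2 := by positivity
      have h8 : 0 ≤ (1 + 4 * α⁻¹) * ‖h₁ - h₂‖ ^ 2 := by positivity
      linarith
    have h9 := mul_le_mul_of_nonneg_left key (by positivity : 0 ≤ 2 * ((α + 1) * E))
    linarith
  · intro Γ₀ Γ₁ hΓ β βhat hβ u₀ v₀ g h hd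
    obtain ⟨u, v, ξ, hs⟩ := exists_isSolution hΩ hΓ hT hα hβ h hd
    refine ⟨(u, v, ξ), hs, ?_⟩
    rintro ⟨u', v', ξ'⟩ hs'
    obtain ⟨rfl, rfl, rfl⟩ :=
      hs.unique hΩ hΓ hT hα hβ.maximalMonotone.monotone hs' hd.initial_mem
    rfl
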